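/- Let $\beta=\frac{\sqrt{13}-1}{4}$, $D_x=x\frac{\mathrm d}{\mathrm dx}$, $q(\zeta)=(\zeta+\frac12)\,\zeta\,(\zeta^2-\frac32\zeta-\frac14)=(\zeta+\frac12)(\zeta+\beta-\frac12)\,\zeta\,(\zeta-\beta-1)$ and $r(\zeta)=2(\zeta+1)(\zeta+\frac12)$. For $k\in\mathbb N_0$, $\alpha\in\mathbb R$ put $|v|_{k,\alpha}^2=\sum_{j=0}^k\int_0^\infty x^{-2\alpha}|D_x^jv|^2\,\frac{\mathrm dx}{x}$. Let $f:(0,\infty)\times\mathbb R\to\mathbb C$, $(x,\eta)\mapsto f(x,\eta)$, be such that $f(\cdot,\eta)\in C^\infty((0,\infty))$ for every $\eta\in\mathbb R$. We say that $f$ satisfies $(G_0)$ if for every set $\mathcal J$ that is a non-empty compact interval contained in $\mathbb R\setminus\{0\}$ or is equal to $\{0\}$, there are $\varepsilon>0$ and $\bar f=\bar f(x_1,x_2,\eta):[0,\varepsilon]\times[0,\varepsilon^\beta]\times\mathcal J\to\mathbb C$ such that (i) $f(x,\eta)=\bar f(x,x^\beta,\eta)$ for $(x,\eta)\in(0,\varepsilon]\times\mathcal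 J$, and for each $\eta\in\mathcal J$ the function $\bar f(\cdot,\cdot,\eta)$ is analytic (up to the boundary, i.e. extends analytically to a neighbourhood of the rectangle) with $\partial_{x_2}^j\bar f(0,0,\eta)=0$ for all $j\ge1$; (ii) with $|\bar g|_\omega=\sum_{k,\ell\ge0}\frac{\varepsilon^{k+\beta\ell}}{k!\,\ell!}|\partial_{x_1}^k\partial_{x_2}^\ell\bar g(0,0)|$, one has $|\bar f(\cdot,\cdot,\eta)|_\omega<\infty$ for all $\eta\in\mathcal J$, and $\eta\mapsto\bar f(\cdot,\cdot,\eta)$ is continuous on $\mathcal J$ with respect to $|\cdot|_\omega$. We say that $f$ satisfies $(G_\infty)$ if (i) $\limsup_{x\to\infty}\bigl|e^{\nu x^{1/4}}\frac{\mathrm d^jf}{\mathrm dx^j}(x,0)\bigr|<\infty$ for all $j\in\mathbb N_0$ and $\nu\in[0,2^{3/2})$; (ii) for all $\eta\ne0$, $j\in\mathbb N_0$ and $\nu\in[0,|\eta|)$, $\limsup_{x\to\infty}\bigl|e^{\nu x}\frac{\mathrm d^jf}{\mathrm dx^j}(x,\eta)\bigr|<\infty$; (iii) for all $x_0>0$,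 $k\in\mathbb N_0$, $\eta_0\ne0$ and $\nu\in[0,|\eta_0|)$, with $|g|_{k,x_0,\nu}=\max_{0\le j\le k}\sup_{x\ge x_0}e^{\nu x}\bigl|\frac{\mathrm d^jg}{\mathrm dx^j}(x)\bigr|$, one has $|f(\cdot,\eta_0)|_{k,x_0,\nu}<\infty$ and $|f(\cdot,\eta)-f(\cdot,\eta_0)|_{k,x_0,\nu}\to0$ as $\eta\to\eta_0$. **Proposition.** Suppose that $f(\cdot,\eta)\in C^\infty((0,\infty))$ for every $\eta\in\mathbb R$, that $f$ satisfies $(G_0)$ with functions $\bar f$ such that $(\bar f,\partial_{x_1}\partial_{x_2}\bar f)(0,0,\eta)=(0,0)$ for all $\eta\in\mathcal J$, that $f$ satisfies $(G_\infty)$, and that for every $j\ge0$ the derivative $\frac{\mathrm d^jf}{\mathrm dx^j}$ is continuous in $\{(x,\eta):x>0,\ \eta\ne0\}$. Then for every $\eta\in\mathbb R$ there is exactly one $v(\cdot,\eta)\in C^\infty((0,\infty);\mathbb C)$ that solves $$x\,v+q(D_x)v-\eta^2x^2\,r(D_x)v+\eta^4x^4\,v=f(\cdot,\eta)\qquad\text{for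 }x>0$$ and for which there is some $\delta\in(0,\frac1{10})$ such that $|v|_{k,-\delta-k}<\infty$ for $k=0,1,2$. Moreover, the function $v:(0,\infty)\times\mathbb R\to\mathbb C$ so defined satisfies $(G_0)$ and $(G_\infty)$, and for every $j\ge0$ the derivative $\frac{\mathrm d^jv}{\mathrm dx^j}$ is continuous in $\{(x,\eta):x>0,\ \eta\ne0\}$. -/

import Mathlib

open Filter Topology
open scoped ContDiff Polynomial

namespace ThinFilmResolvent

noncomputable section

/-- The exponent `β = (√13 - 1) / 4`. -/
def beta : ℝ := (√13 - 1) / 4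

/-- The symbol `q(ζ) = (ζ + 1/2) ζ (ζ² - (3/2) ζ - 1/4)`, which equals
`(ζ + 1/2) (ζ + β - 1/2) ζ (ζ - β - 1)`. -/
def q : ℝ[X] :=
  (Polynomial.X + Polynomial.C (1 / 2)) * Polynomial.X *
    (Polynomial.X ^ 2 - Polynomial.C (3 / 2) * Polynomial.X - Polynomial.C (1 / 4))

/-- The symbol `r(ζ) = 2 (ζ + 1) (ζ + 1/2)`. -/
def r : ℝ[X] :=
  Polynomial.C 2 * (Polynomial.X + Polynomial.C 1) * (Polynomial.X + Polynomial.C (1 / 2))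

/-- The scaling-invariant derivative `D_x = x d/dx`. Functions on `(0, ∞)` are represented by
functions on `ℝ` whose values at `x ≤ 0` are never used. -/
def Dx (v : ℝ → ℂ) : ℝ → ℂ := fun x => (x : ℂ) * deriv v x

/-- `p(D_x) v` for a real polynomial `p`. -/
def polyOp (p : ℝ[X]) (v : ℝ → ℂ) (x : ℝ) : ℂ :=
  p.sum fun j c => (c : ℂ) * (Dx^[j] v) x

/-- `v` solves `x v + q(D_x) v - η² x² r(D_x) v + η⁴ x⁴ v = f` for `x > 0`. -/
def SolvesResolvent (f : ℝ → ℂ) (η : ℝ) (v : ℝ → ℂ) : Prop :=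
  ∀ x : ℝ, 0 < x →
    (x : ℂ) * v x + polyOp q v x - (η : ℂ) ^ 2 * (x : ℂ) ^ 2 * polyOp r v x
      + (η : ℂ) ^ 4 * (x : ℂ) ^ 4 * v x = f x

/-- The square of the weighted norm `|v|_{k,α}`, i.e.
`∑_{j ≤ k} ∫_0^∞ x^{-2α} |D_x^j v|² dx/x`, with values in `[0, ∞]`. -/
def weightedNormSq (k : ℕ) (α : ℝ) (v : ℝ → ℂ) : ENNReal :=
  ∑ j ∈ Finset.range (k + 1),
    ∫⁻ x in Set.Ioi (0 : ℝ), ENNReal.ofReal (x ^ (-2 * α) * ‖(Dx^[j] v) x‖ ^ 2 / x)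

/-- `∂_{x₁}^k ∂_{x₂}^ℓ g (0, 0)`. -/
def partialZero (k l : ℕ) (g : ℝ → ℝ → ℂ) : ℂ :=
  iteratedDeriv k (fun x₁ => iteratedDeriv l (fun x₂ => g x₁ x₂) 0) 0

/-- The norm `|g|_ω = ∑_{k,ℓ} ε^{k + βℓ} / (k! ℓ!) |∂_{x₁}^k ∂_{x₂}^ℓ g (0, 0)|`, with values
in `[0, ∞]`. -/
def omegaNorm (ε : ℝ) (g : ℝ → ℝ → ℂ) : ENNReal :=
  ∑' p : ℕ × ℕ,
    ENNReal.ofReal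
      (ε ^ ((p.1 : ℝ) + beta * (p.2 : ℝ)) / ((p.1.factorial : ℝ) * (p.2.factorial : ℝ)))
      * ‖partialZero p.1 p.2 g‖ₑ

/-- `J` is a compact interval contained in `ℝ \ {0}`, or `J = {0}`. -/
def AdmissibleInterval (J : Set ℝ) : Prop :=
  (∃ a b : ℝ, a ≤ b ∧ J = Set.Icc a b ∧ (0 : ℝ) ∉ J) ∨ J = {0}

/-- `F = F(x₁, x₂, η)` unfolds `f = f(x, η)` for `0 < x ≤ ε` and `η ∈ J`: it is analytic on
`[0, ε] × [0, ε^β]` for each `η ∈ J` (that is, in a neighbourhood of every point), has no pure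
powers of `x₂`, satisfies `f(x, η) = F(x, x^β, η)`, and `η ↦ F(·, ·, η)` is a continuous map from
`J` to the functions with finite norm `|·|_ω`. -/
structure Unfolds (f : ℝ → ℝ → ℂ) (J : Set ℝ) (ε : ℝ) (F : ℝ → ℝ → ℝ → ℂ) : Prop where
  eq : ∀ η ∈ J, ∀ x ∈ Set.Ioc 0 ε, f x η = F x (x ^ beta) η
  analytic : ∀ η ∈ J,
    AnalyticOnNhd ℝ (fun p : ℝ × ℝ => F p.1 p.2 η) (Set.Icc 0 ε ×ˢ Set.Icc 0 (ε ^ beta))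
  no_pure : ∀ η ∈ J, ∀ j : ℕ, 1 ≤ j → partialZero 0 j (fun x₁ x₂ => F x₁ x₂ η) = 0
  finite : ∀ η ∈ J, omegaNorm ε (fun x₁ x₂ => F x₁ x₂ η) < ⊤
  continuous : ∀ η₀ ∈ J,
    Tendsto (fun η => omegaNorm ε (fun x₁ x₂ => F x₁ x₂ η - F x₁ x₂ η₀)) (𝓝[J] η₀) (𝓝 0)

/-- Condition `(G₀)`. -/
def G0 (f : ℝ → ℝ → ℂ) : Prop :=
  ∀ J : Set ℝ, AdmissibleInterval J → ∃ ε : ℝ, 0 < ε ∧ ∃ F : ℝ → ℝ → ℝ → ℂ, Unfolds f J ε F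

/-- Condition `(G₀)` where, in addition, the unfolded functions satisfy
`(F, ∂_{x₁} ∂_{x₂} F)(0, 0, η) = (0, 0)`. -/
def G0Vanishing (f : ℝ → ℝ → ℂ) : Prop :=
  ∀ J : Set ℝ, AdmissibleInterval J → ∃ ε : ℝ, 0 < ε ∧ ∃ F : ℝ → ℝ → ℝ → ℂ, Unfolds f J ε F ∧
    ∀ η ∈ J, F 0 0 η = 0 ∧ partialZero 1 1 (fun x₁ x₂ => F x₁ x₂ η) = 0

/-- The norm `|g|_{k,x₀,ν} = max_{j ≤ k} sup_{x ≥ x₀} e^{νx} |d^j g / dx^j (x)|`, with values in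
`[0, ∞]`. -/
def expNorm (k : ℕ) (x₀ ν : ℝ) (g : ℝ → ℂ) : ENNReal :=
  ⨆ j ∈ Set.Iic k, ⨆ x ∈ Set.Ici x₀, ENNReal.ofReal (Real.exp (ν * x)) * ‖iteratedDeriv j g x‖ₑ

/-- Condition `(G_∞)`. In `decay_zero` and `decay`, boundedness as `x → ∞` says that the limit
superior is finite. -/
structure GInfty (f : ℝ → ℝ → ℂ) : Prop where
  decay_zero : ∀ j : ℕ, ∀ ν ∈ Set.Ico (0 : ℝ) (2 ^ (3 / 2 : ℝ)),
    IsBoundedUnder (· ≤ ·) atTop fun x : ℝ =>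
      Real.exp (ν * x ^ (1 / 4 : ℝ)) * ‖iteratedDeriv j (fun y => f y 0) x‖
  decay : ∀ η : ℝ, η ≠ 0 → ∀ j : ℕ, ∀ ν ∈ Set.Ico (0 : ℝ) |η|,
    IsBoundedUnder (· ≤ ·) atTop fun x : ℝ =>
      Real.exp (ν * x) * ‖iteratedDeriv j (fun y => f y η) x‖
  finite : ∀ x₀ : ℝ, 0 < x₀ → ∀ k : ℕ, ∀ η : ℝ, η ≠ 0 → ∀ ν ∈ Set.Ico (0 : ℝ) |η|,
    expNorm k x₀ ν (fun y => f y η) < ⊤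
  continuous : ∀ x₀ : ℝ, 0 < x₀ → ∀ k : ℕ, ∀ η₀ : ℝ, η₀ ≠ 0 → ∀ ν ∈ Set.Ico (0 : ℝ) |η₀|,
    Tendsto (fun η => expNorm k x₀ ν (fun y => f y η - f y η₀)) (𝓝 η₀) (𝓝 0)

/-- All derivatives `d^j f / dx^j`, `j ≥ 0`, are continuous in `{(x, η) : x > 0, η ≠ 0}`. -/
def DerivsContinuous (f : ℝ → ℝ → ℂ) : Prop :=
  ∀ j : ℕ, ContinuousOn (fun p : ℝ × ℝ => iteratedDeriv j (fun y => f y p.2) p.1)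
    {p : ℝ × ℝ | 0 < p.1 ∧ p.2 ≠ 0}

/-- `v` is a smooth solution, for the parameter `η`, such that for some `δ ∈ (0, 1/10)` the norms
`|v|_{k,-δ-k}`, `k = 0, 1, 2`, are finite. -/
def IsControlledSolution (f : ℝ → ℂ) (η : ℝ) (v : ℝ → ℂ) : Prop :=
  ContDiffOn ℝ ∞ v (Set.Ioi 0) ∧ SolvesResolvent f η v ∧
    ∃ δ ∈ Set.Ioo (0 : ℝ) (1 / 10), ∀ k : ℕ, k ≤ 2 → weightedNormSq k (-δ - k) v < ⊤

end

end ThinFilmResolvent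

/-!
In the variable `t = log x` the equation becomes a linear first-order system for the state
`(v, D v, D² v, D³ v)`, whose homogeneous solutions behave at `t → -∞` like `e ^ (ζ t)`, where `ζ`
runs through the roots `-1/2 < 1/2 - β < 0 < 1 + β` of `q`. The norms `|v|_{k,-δ-k}` with
`δ < 1/10` exclude the first two exponents. At infinity two of the four homogeneous solutions decay
exponentially. Hence a controlled solution is a point in the intersection of two affine planes in
the four-dimensional solution space.

*Near `x = 0`.* Inserting `v = ∑ a_{kl} x ^ (k + β l)` gives the recursion `IsCoeff`, which divides
by `q(k + β l)`. This is zero only for `(k, l) = (0, 0)` and `(1, 1)`. There the hypotheses on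
`f̄(0,0)` and `∂₁∂₂f̄(0,0)` make the right-hand side vanish, and the coefficients are two free
parameters `A`, `B`. Each step of the recursion raises `k` and gains at least the factor
`r / q = O(k ^ (-2))`, so a discrete Grönwall argument (`exists_wnorm_le`) bounds the solution in
the weighted `ℓ¹` norm that corresponds to `|·|_ω`, without loss in the radius and locally uniformly
in `η`. A function that is analytic on the rectangle and has finite norm `|·|_ω` is the sum of its
Taylor series at the corner (`Unfolds.eq_expSeries`),
and conversely a series with finite norm unfolds its sum (`unfolds_of_expSeries`).

*Near infinity.* After division by the leading coefficient, and in the variable `y = x` for `η ≠ 0`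
or `y = x ^ (1/4)` for `η = 0`, the operator is a small perturbation of
`(d²/dy² - λ₁²) (d²/dy² - λ₂²)` with `Re λᵢ` equal to `|η|` or `2 ^ (3/2)`. A Neumann series in a
space of functions that decay like `e ^ (-ν y)` yields a particular solution and two independent
homogeneous solutions that depend continuously on `η` (`exists_decayingBasis`,
`exists_decayingBasis_zero`).

*Uniqueness and matching.* A homogeneous solution that is regular at `0` and decays at infinity
vanishes, because a quadratic form in its state is nonincreasing, is nonpositive near `0`, and is
near infinity the sum of an integrable function and of the derivative of one
(`comb_eq_zero_of_decay`). Hence the `2 × 2` system for the intersection of the two planes is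
invertible, and Cramer's rule gives existence and continuity in `η` at once (`exists_matching`).

*Derivatives.* The matched solutions provide the state of `v`, its expansion, its decay and its
continuity in `η`. The fourth derivative of `v` is a combination of lower derivatives and of `f`
with coefficients polynomial in `η` and `1 / x`, so every class of functions that is stable under
these operations contains all derivatives of `v` (`StableClass.iteratedDeriv_ofState`).
-/

namespace ThinFilmResolvent

noncomputable section

/-! ### Double power series -/

/-- The sum of the double power series `∑ A (k, l) x ^ k y ^ l`. -/
def doubleSeries (A : ℕ × ℕ → ℂ) (x y : ℝ) : ℂ := ∑' p : ℕ × ℕ, A p * (x : ℂ) ^ p.1 * (y : ℂ) ^ p.2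

lemma iteratedDeriv_zero_of_hasSum {f : ℝ → ℂ} {c : ℕ → ℂ} {R : ℝ} (hR : 0 < R)
    (h : ∀ x : ℝ, |x| < R → HasSum (fun n => c n * (x : ℂ) ^ n) (f x)) (n : ℕ) :
    iteratedDeriv n f 0 = (n.factorial : ℂ) * c n := by
  let p : FormalMultilinearSeries ℝ ℝ ℂ := fun n => ContinuousMultilinearMap.mkPiRing ℝ (Fin n) (c n)
  have hp : HasFPowerSeriesAt f p 0 := by
    rw [hasFPowerSeriesAt_iff]
    filter_upwards [Metric.ball_mem_nhds (0 : ℝ) hR] with z hz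
    have := h z (by simpa using hz)
    rw [zero_add]
    have he : (fun n => z ^ n • p.coeff n) = fun n => c n * (z : ℂ) ^ n := by
      funext m
      simp [p, FormalMultilinearSeries.coeff, mul_comm]
    rw [he]
    exact this
  obtain ⟨r, hr⟩ := hp
  have := hr.factorial_smul 1 n
  rw [iteratedDeriv_eq_iteratedFDeriv, ← this]
  simp [p]

section DoubleSeries

variable {A : ℕ × ℕ → ℂ} {R S : ℝ}

lemma norm_doubleSeries_term_le (hR : 0 < R) {x y : ℝ} (hx : |x| ≤ R) (hy : |y| ≤ S)
    (p : ℕ × ℕ) :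
    ‖A p * (x : ℂ) ^ p.1 * (y : ℂ) ^ p.2‖ ≤ ‖A p‖ * R ^ p.1 * S ^ p.2 := by
  simp only [norm_mul, norm_pow, Complex.norm_real, Real.norm_eq_abs]
  gcongr

lemma summable_doubleSeries (hR : 0 < R)
    (hA : Summable fun p : ℕ × ℕ => ‖A p‖ * R ^ p.1 * S ^ p.2) {x y : ℝ} (hx : |x| ≤ R)
    (hy : |y| ≤ S) : Summable fun p : ℕ × ℕ => A p * (x : ℂ) ^ p.1 * (y : ℂ) ^ p.2 :=
  Summable.of_norm_bounded hA (norm_doubleSeries_term_le hR hx hy)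

/-- The Taylor coefficients of a double power series at the origin. -/
lemma partialZero_doubleSeries (hR : 0 < R) (hS : 0 < S)
    (hA : Summable fun p : ℕ × ℕ => ‖A p‖ * R ^ p.1 * S ^ p.2) (k l : ℕ) :
    partialZero k l (doubleSeries A) = (k.factorial : ℂ) * ((l.factorial : ℂ) * A (k, l)) := by
  have hsum : ∀ x y : ℝ, |x| ≤ R → |y| ≤ S →
      Summable fun p : ℕ × ℕ => A p * (x : ℂ) ^ p.1 * (y : ℂ) ^ p.2 :=
    fun x y hx hy => summable_doubleSeries hR hA hx hy
  have hcol : ∀ x : ℝ, |x| < R → ∀ l, Summable fun k => A (k, l) * (x : ℂ) ^ k := by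
    intro x hx l
    have h1 := (hsum x S hx.le (by rw [abs_of_pos hS])).comp_injective
      (i := fun k : ℕ => (k, l)) (fun a b h => by simpa using h)
    have hS' : (S : ℂ) ^ l ≠ 0 := pow_ne_zero _ (by exact_mod_cast hS.ne')
    simpa [Function.comp_def, hS'] using h1.mul_right ((S : ℂ) ^ l)⁻¹
  have hinner : ∀ x : ℝ, |x| < R → iteratedDeriv l (fun y => doubleSeries A x y) 0
      = (l.factorial : ℂ) * ∑' k, A (k, l) * (x : ℂ) ^ k := by
    intro x hx
    refine iteratedDeriv_zero_of_hasSum (c := fun l => ∑' k, A (k, l) * (x : ℂ) ^ k) hS ?_ l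
    intro y hy
    have h1 := (hsum x y hx.le hy.le).hasSum
    have h2 := ((Equiv.prodComm ℕ ℕ).hasSum_iff.mpr h1).prod_fiberwise
      (g := fun l => (∑' k, A (k, l) * (x : ℂ) ^ k) * (y : ℂ) ^ l) ?_
    · exact h2
    · intro l
      simpa using (hcol x hx l).hasSum.mul_right ((y : ℂ) ^ l)
  have hev : (fun x => iteratedDeriv l (fun y => doubleSeries A x y) 0) =ᶠ[𝓝 0]
      fun x : ℝ => (l.factorial : ℂ) * ∑' k, A (k, l) * (x : ℂ) ^ k := by
    filter_upwards [Metric.ball_mem_nhds (0 : ℝ) hR] with x hx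
    exact hinner x (by simpa using hx)
  unfold partialZero
  rw [hev.iteratedDeriv_eq]
  refine iteratedDeriv_zero_of_hasSum (c := fun k => (l.factorial : ℂ) * A (k, l)) hR ?_ k
  intro x hx
  simpa [mul_assoc] using (hcol x hx l).hasSum.mul_left (l.factorial : ℂ)

/-- The `n`-linear map on `ℝ × ℝ` whose value on the diagonal is the monomial `x ^ k y ^ (n - k)`. -/
def monomialMap (k n : ℕ) : ContinuousMultilinearMap ℝ (fun _ : Fin n => ℝ × ℝ) ℝ :=
  (ContinuousMultilinearMap.mkPiAlgebra ℝ (Fin n) ℝ).compContinuousLinearMap fun i =>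
    if (i : ℕ) < k then ContinuousLinearMap.fst ℝ ℝ ℝ else ContinuousLinearMap.snd ℝ ℝ ℝ

lemma norm_monomialMap_le (k n : ℕ) : ‖monomialMap k n‖ ≤ 1 := by
  refine ContinuousMultilinearMap.opNorm_le_bound zero_le_one fun m => ?_
  simp only [monomialMap, ContinuousMultilinearMap.compContinuousLinearMap_apply,
    ContinuousMultilinearMap.mkPiAlgebra_apply, norm_prod, one_mul]
  refine Finset.prod_le_prod (fun _ _ => norm_nonneg _) fun i _ => ?_
  split_ifs
  · exact norm_fst_le _
  · exact norm_snd_le _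

lemma monomialMap_apply (k l : ℕ) (v : ℝ × ℝ) :
    monomialMap k (k + l) (fun _ => v) = v.1 ^ k * v.2 ^ l := by
  simp only [monomialMap, ContinuousMultilinearMap.compContinuousLinearMap_apply,
    ContinuousMultilinearMap.mkPiAlgebra_apply, Fin.prod_univ_add]
  congr 1
  · rw [Finset.prod_congr rfl (g := fun _ => v.1)]
    · simp
    · intro i _; simp
  · rw [Finset.prod_congr rfl (g := fun _ => v.2)]
    · simp
    · intro i _; simp

/-- The formal power series on `ℝ × ℝ` with coefficients `A`. -/
def doubleFormal (A : ℕ × ℕ → ℂ) : FormalMultilinearSeries ℝ (ℝ × ℝ) ℂ := fun n =>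
  ∑ p ∈ Finset.HasAntidiagonal.antidiagonal n, (monomialMap p.1 n).smulRight (A p)

lemma doubleFormal_apply (A : ℕ × ℕ → ℂ) (n : ℕ) (v : ℝ × ℝ) :
    doubleFormal A n (fun _ => v)
      = ∑ p ∈ Finset.HasAntidiagonal.antidiagonal n, A p * (v.1 : ℂ) ^ p.1 * (v.2 : ℂ) ^ p.2 := by
  simp only [doubleFormal, sum_apply,
    ContinuousMultilinearMap.smulRight_apply]
  refine Finset.sum_congr rfl fun p hp => ?_
  obtain rfl := Finset.HasAntidiagonal.mem_antidiagonal.mp hp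
  rw [monomialMap_apply]
  simp only [Complex.real_smul]
  push_cast
  ring

lemma hasSum_antidiagonal {f : ℕ × ℕ → ℂ} {a : ℂ} (h : HasSum f a) :
    HasSum (fun n => ∑ p ∈ Finset.HasAntidiagonal.antidiagonal n, f p) a := by
  have := (Finset.HasAntidiagonal.sigmaAntidiagonalEquivProd (A := ℕ)).hasSum_iff.mpr h
  refine this.sigma fun n => ?_
  have := Finset.hasSum (Finset.HasAntidiagonal.antidiagonal n) f
  exact this

lemma hasFPowerSeriesOnBall_doubleSeries_one (hA : Summable fun p : ℕ × ℕ => ‖A p‖) :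
    HasFPowerSeriesOnBall (fun v : ℝ × ℝ => doubleSeries A v.1 v.2) (doubleFormal A) 0 1 := by
  refine ⟨?_, one_pos, ?_⟩
  · have h1 : Summable fun n => ‖doubleFormal A n‖ * ((1 : NNReal) : ℝ) ^ n := by
      have h2 : Summable fun n => ∑ p ∈ Finset.HasAntidiagonal.antidiagonal n, ‖A p‖ := by
        have := (Finset.HasAntidiagonal.sigmaAntidiagonalEquivProd (A := ℕ)).summable_iff.mpr hA
        have := this.sigma
        refine this.congr fun n => ?_
        rw [tsum_fintype]
        exact Finset.sum_coe_sort (Finset.HasAntidiagonal.antidiagonal n) fun p => ‖A p‖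
      refine Summable.of_nonneg_of_le (fun n => by positivity) (fun n => ?_) h2
      simp only [NNReal.coe_one, one_pow, mul_one]
      refine (norm_sum_le _ _).trans (Finset.sum_le_sum fun p _ => ?_)
      rw [ContinuousMultilinearMap.norm_smulRight]
      exact mul_le_of_le_one_left (norm_nonneg _) (norm_monomialMap_le _ _)
    simpa using FormalMultilinearSeries.le_radius_of_summable_norm _ h1
  · intro v hv
    have hv' : ‖v‖ < 1 := by simpa [enorm_eq_nnnorm, ← NNReal.coe_lt_coe] using hv
    have h1 : |v.1| ≤ 1 := (norm_fst_le v).trans hv'.le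
    have h2 : |v.2| ≤ 1 := (norm_snd_le v).trans hv'.le
    have hs : Summable fun p : ℕ × ℕ => A p * (v.1 : ℂ) ^ p.1 * (v.2 : ℂ) ^ p.2 :=
      summable_doubleSeries one_pos (by simpa using hA) h1 h2
    simpa [doubleFormal_apply, doubleSeries] using hasSum_antidiagonal hs.hasSum

lemma analyticAt_doubleSeries (hR : 0 < R) (hS : 0 < S)
    (hA : Summable fun p : ℕ × ℕ => ‖A p‖ * R ^ p.1 * S ^ p.2) {v : ℝ × ℝ} (hx : |v.1| < R)
    (hy : |v.2| < S) : AnalyticAt ℝ (fun v : ℝ × ℝ => doubleSeries A v.1 v.2) v := by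
  set B : ℕ × ℕ → ℂ := fun p => A p * (R : ℂ) ^ p.1 * (S : ℂ) ^ p.2 with hB
  have hBs : Summable fun p => ‖B p‖ := by
    refine hA.congr fun p => ?_
    simp [hB, abs_of_pos hR, abs_of_pos hS]
  have h1 := (hasFPowerSeriesOnBall_doubleSeries_one hBs).analyticOnNhd
  have heq : (fun v : ℝ × ℝ => doubleSeries A v.1 v.2)
      = (fun v : ℝ × ℝ => doubleSeries B v.1 v.2) ∘ fun v => (v.1 / R, v.2 / S) := by
    funext v
    simp only [doubleSeries, hB, Function.comp]
    refine tsum_congr fun p => ?_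
    have hR' : (R : ℂ) ≠ 0 := by exact_mod_cast hR.ne'
    have hS' : (S : ℂ) ≠ 0 := by exact_mod_cast hS.ne'
    push_cast
    rw [div_pow, div_pow]
    field_simp
  rw [heq]
  refine AnalyticAt.comp (h1 _ ?_) ?_
  · have : ‖(v.1 / R, v.2 / S)‖ < 1 := by
      rw [Prod.norm_def, max_lt_iff, Real.norm_eq_abs, Real.norm_eq_abs, abs_div, abs_div,
        abs_of_pos hR, abs_of_pos hS, div_lt_one hR, div_lt_one hS]
      exact ⟨hx, hy⟩
    rw [Metric.mem_eball, edist_zero_right, enorm_eq_nnnorm]; exact_mod_cast this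
  · exact (analyticAt_fst.div_const).prod (analyticAt_snd.div_const)

end DoubleSeries

/-- An analytic function on the line whose derivatives all vanish at a point of a preconnected
set vanishes on that set. -/
lemma eqOn_zero_of_iteratedDeriv_eq_zero {f : ℝ → ℂ} {U : Set ℝ} (hf : AnalyticOnNhd ℝ f U)
    (hU : IsPreconnected U) {x : ℝ} (hx : x ∈ U) (h : ∀ n, iteratedDeriv n f x = 0) :
    Set.EqOn f 0 U := by
  refine hf.eqOn_zero_of_preconnected_of_eventuallyEq_zero hU hx ?_
  obtain ⟨p, r, hr⟩ := hf x hx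
  have hp : p = 0 := by
    ext1 n
    have h1 := hr.factorial_smul 1 n
    have h2 := h n
    rw [iteratedDeriv_eq_iteratedFDeriv] at h2
    rw [h2] at h1
    have h3 : p n (fun _ => 1) = 0 := by
      simpa [Nat.factorial_ne_zero] using h1
    rw [← FormalMultilinearSeries.mkPiRing_coeff_eq p n]
    have h4 : p.coeff n = 0 := h3
    rw [h4]
    ext
    simp
  rw [hp] at hr
  exact hr.eventually_eq_zero

/-- Iterated derivatives in the second variable of a jointly analytic function are jointly
analytic. -/
lemma analyticOnNhd_iteratedDeriv_snd {G : ℝ × ℝ → ℂ} {U : Set (ℝ × ℝ)}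
    (hG : AnalyticOnNhd ℝ G U) (l : ℕ) :
    AnalyticOnNhd ℝ (fun p : ℝ × ℝ => iteratedDeriv l (fun y => G (p.1, y)) p.2) U := by
  induction l generalizing G with
  | zero => simpa using hG
  | succ l ih =>
    have h1 : AnalyticOnNhd ℝ (fun p => fderiv ℝ G p (0, 1)) U := fun p hp =>
      ((ContinuousLinearMap.apply ℝ ℂ ((0, 1) : ℝ × ℝ)).analyticAt _).comp (hG p hp).fderiv
    have h2 := ih h1
    intro p hp
    refine (h2 p hp).congr ?_
    filter_upwards [(hG p hp).eventually_analyticAt] with z hz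
    rw [iteratedDeriv_succ']
    refine Filter.EventuallyEq.iteratedDeriv_eq l ?_
    have hc : Tendsto (fun y => (z.1, y)) (𝓝 z.2) (𝓝 z) := by
      have : Continuous fun y : ℝ => (z.1, y) := by fun_prop
      simpa using this.tendsto z.2
    filter_upwards [hc.eventually hz.eventually_analyticAt] with y hy
    have h3 : HasDerivAt (fun y => G (z.1, y)) (fderiv ℝ G (z.1, y) (0, 1)) y := by
      have h4 : HasDerivAt (fun y : ℝ => (z.1, y)) ((0 : ℝ), (1 : ℝ)) y :=
        (hasDerivAt_const y z.1).prodMk (hasDerivAt_id y)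
      exact hy.differentiableAt.hasFDerivAt.comp_hasDerivAt y h4
    exact h3.deriv.symm

section Germ

variable {G H : ℝ → ℝ → ℂ}

lemma analyticAt_iteratedDeriv_snd_zero (hG : AnalyticAt ℝ (fun p : ℝ × ℝ => G p.1 p.2) (0, 0))
    (l : ℕ) : AnalyticAt ℝ (fun x => iteratedDeriv l (fun y => G x y) 0) 0 := by
  obtain ⟨U, hU, hGU⟩ := hG.exists_mem_nhds_analyticOnNhd
  have h1 := analyticOnNhd_iteratedDeriv_snd hGU l (0, 0) (mem_of_mem_nhds hU)
  exact h1.comp_of_eq (f := fun x : ℝ => (x, (0 : ℝ))) (analyticAt_id.prod analyticAt_const) rfl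

lemma eventually_analyticAt_snd (hG : AnalyticAt ℝ (fun p : ℝ × ℝ => G p.1 p.2) (0, 0)) :
    ∀ᶠ x in 𝓝 (0 : ℝ), AnalyticAt ℝ (fun y => G x y) 0 := by
  have hc : Tendsto (fun x : ℝ => (x, (0 : ℝ))) (𝓝 0) (𝓝 (0, 0)) := by
    have : Continuous fun x : ℝ => (x, (0 : ℝ)) := by fun_prop
    simpa using this.tendsto 0
  filter_upwards [hc.eventually hG.eventually_analyticAt] with x hx
  exact hx.comp_of_eq (f := fun y : ℝ => (x, y)) (analyticAt_const.prod analyticAt_id) rfl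

lemma partialZero_sub (hG : AnalyticAt ℝ (fun p : ℝ × ℝ => G p.1 p.2) (0, 0))
    (hH : AnalyticAt ℝ (fun p : ℝ × ℝ => H p.1 p.2) (0, 0)) (k l : ℕ) :
    partialZero k l (fun x y => G x y - H x y) = partialZero k l G - partialZero k l H := by
  have h1 : (fun x => iteratedDeriv l (fun y => G x y - H x y) 0) =ᶠ[𝓝 0]
      (fun x => iteratedDeriv l (fun y => G x y) 0) - fun x => iteratedDeriv l (fun y => H x y) 0 := by
    filter_upwards [eventually_analyticAt_snd hG, eventually_analyticAt_snd hH] with x hx hx'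
    exact iteratedDeriv_sub hx.contDiffAt hx'.contDiffAt
  unfold partialZero
  rw [h1.iteratedDeriv_eq, iteratedDeriv_sub]
  · exact (analyticAt_iteratedDeriv_snd_zero hG l).contDiffAt
  · exact (analyticAt_iteratedDeriv_snd_zero hH l).contDiffAt

/-- A function of two variables that is analytic at the origin and has vanishing Taylor
coefficients there vanishes near the origin. -/
lemma eventually_eq_zero_of_partialZero (hG : AnalyticAt ℝ (fun p : ℝ × ℝ => G p.1 p.2) (0, 0))
    (h : ∀ k l, partialZero k l G = 0) : (fun p : ℝ × ℝ => G p.1 p.2) =ᶠ[𝓝 (0, 0)] 0 := by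
  obtain ⟨U, hU, hGU⟩ := hG.exists_mem_nhds_analyticOnNhd
  obtain ⟨ρ, hρ, hball⟩ := Metric.mem_nhds_iff.mp hU
  have hmem : ∀ x y : ℝ, x ∈ Metric.ball (0 : ℝ) ρ → y ∈ Metric.ball (0 : ℝ) ρ → (x, y) ∈ U := by
    intro x y hx hy
    refine hball ?_
    rw [← ball_prod_same]
    exact ⟨hx, hy⟩
  have h0 : (0 : ℝ) ∈ Metric.ball (0 : ℝ) ρ := Metric.mem_ball_self hρ
  have hconn : IsPreconnected (Metric.ball (0 : ℝ) ρ) := (convex_ball (0 : ℝ) ρ).isPreconnected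
  have h1 : ∀ l, Set.EqOn (fun x => iteratedDeriv l (fun y => G x y) 0) 0 (Metric.ball 0 ρ) := by
    intro l
    refine eqOn_zero_of_iteratedDeriv_eq_zero ?_ hconn h0 fun k => h k l
    intro x hx
    exact (analyticOnNhd_iteratedDeriv_snd hGU l (x, 0) (hmem x 0 hx h0)).comp_of_eq
      (f := fun x : ℝ => (x, (0 : ℝ))) (analyticAt_id.prod analyticAt_const) rfl
  have h2 : ∀ x ∈ Metric.ball (0 : ℝ) ρ, Set.EqOn (fun y => G x y) 0 (Metric.ball 0 ρ) := by
    intro x hx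
    refine eqOn_zero_of_iteratedDeriv_eq_zero ?_ hconn h0 fun l => h1 l hx
    intro y hy
    exact (hGU (x, y) (hmem x y hx hy)).comp_of_eq
      (f := fun y : ℝ => (x, y)) (analyticAt_const.prod analyticAt_id) rfl
  filter_upwards [Metric.ball_mem_nhds ((0 : ℝ), (0 : ℝ)) hρ] with p hp
  rw [← ball_prod_same] at hp
  exact h2 p.1 hp.1 hp.2

/-- A function that is analytic on a rectangle is the sum of its Taylor series at the corner, as
soon as that series converges absolutely at the opposite corner. -/
lemma eq_doubleSeries_of_analyticOnNhd {A : ℕ × ℕ → ℂ} {R S : ℝ} (hR : 0 < R) (hS : 0 < S)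
    (hG : AnalyticOnNhd ℝ (fun p : ℝ × ℝ => G p.1 p.2) (Set.Icc 0 R ×ˢ Set.Icc 0 S))
    (hA : Summable fun p : ℕ × ℕ => ‖A p‖ * R ^ p.1 * S ^ p.2)
    (hGA : ∀ k l, partialZero k l G = (k.factorial : ℂ) * ((l.factorial : ℂ) * A (k, l)))
    {x y : ℝ} (hx : x ∈ Set.Ico 0 R) (hy : y ∈ Set.Ico 0 S) : G x y = doubleSeries A x y := by
  have hconn : IsPreconnected (Set.Ico (0 : ℝ) R ×ˢ Set.Ico (0 : ℝ) S) :=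
    ((convex_Ico _ _).prod (convex_Ico _ _)).isPreconnected
  have hG' : AnalyticOnNhd ℝ (fun p : ℝ × ℝ => G p.1 p.2) (Set.Ico 0 R ×ˢ Set.Ico 0 S) :=
    hG.mono (Set.prod_mono Set.Ico_subset_Icc_self Set.Ico_subset_Icc_self)
  have hA' : AnalyticOnNhd ℝ (fun p : ℝ × ℝ => doubleSeries A p.1 p.2)
      (Set.Ico 0 R ×ˢ Set.Ico 0 S) := by
    intro p hp
    refine analyticAt_doubleSeries hR hS hA ?_ ?_
    · rw [abs_of_nonneg hp.1.1]; exact hp.1.2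
    · rw [abs_of_nonneg hp.2.1]; exact hp.2.2
  have h0 : ((0 : ℝ), (0 : ℝ)) ∈ Set.Ico (0 : ℝ) R ×ˢ Set.Ico (0 : ℝ) S :=
    ⟨⟨le_rfl, hR⟩, ⟨le_rfl, hS⟩⟩
  have hev := eventually_eq_zero_of_partialZero (G := fun x y => G x y - doubleSeries A x y)
    ((hG' _ h0).sub (hA' _ h0)) fun k l => by
      rw [partialZero_sub (hG' _ h0) (hA' _ h0), hGA, ← partialZero_doubleSeries hR hS hA]
      exact sub_self _
  refine hG'.eqOn_of_preconnected_of_eventuallyEq hA' hconn h0 ?_ (show (x, y) ∈ _ from ⟨hx, hy⟩)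
  filter_upwards [hev] with p hp
  exact sub_eq_zero.mp hp

end Germ

/-! ### Generalised power series with exponents `k + β l` -/

lemma beta_bounds : (0.651 : ℝ) < beta ∧ beta < 0.652 := by
  have h1 : (3.605 : ℝ) < √13 := Real.lt_sqrt_of_sq_lt (by norm_num)
  have h2 : √13 < (3.606 : ℝ) := (Real.sqrt_lt' (by norm_num)).mpr (by norm_num)
  unfold beta
  constructor <;> linarith

lemma beta_pos : 0 < beta := by linarith [beta_bounds.1]

lemma beta_sq : beta ^ 2 = 3 / 4 - beta / 2 := by
  have h : √13 ^ 2 = 13 := Real.sq_sqrt (by norm_num)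
  unfold beta
  linear_combination h / 16

/-- The exponent `k + β l` attached to the pair `(k, l)`. -/
def expo (p : ℕ × ℕ) : ℝ := (p.1 : ℝ) + beta * (p.2 : ℝ)

lemma expo_nonneg (p : ℕ × ℕ) : 0 ≤ expo p := by
  have := beta_pos
  unfold expo
  positivity

/-- The weighted `ℓ¹` norm `∑ |a (k, l)| e ^ (T (k + β l))`, with values in `[0, ∞]`. -/
def wnorm (T : ℝ) (a : ℕ × ℕ → ℂ) : ENNReal :=
  ∑' p, ‖a p‖ₑ * ENNReal.ofReal (Real.exp (T * expo p))

lemma summable_of_wnorm {T : ℝ} {a : ℕ × ℕ → ℂ} (h : wnorm T a < ⊤) :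
    Summable fun p => ‖a p‖ * Real.exp (T * expo p) := by
  have h1 := ENNReal.summable_toReal h.ne
  refine h1.congr fun p => ?_
  rw [ENNReal.toReal_mul, ENNReal.toReal_ofReal (Real.exp_pos _).le, toReal_enorm]

lemma toReal_wnorm (T : ℝ) (a : ℕ × ℕ → ℂ) :
    (wnorm T a).toReal = ∑' p, ‖a p‖ * Real.exp (T * expo p) := by
  rw [wnorm, ENNReal.tsum_toReal_eq]
  · refine tsum_congr fun p => ?_
    rw [ENNReal.toReal_mul, ENNReal.toReal_ofReal (Real.exp_pos _).le, toReal_enorm]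
  · intro p
    exact ENNReal.mul_ne_top enorm_ne_top ENNReal.ofReal_ne_top

lemma exp_mul_expo (x : ℝ) (hx : 0 < x) (p : ℕ × ℕ) :
    Real.exp (Real.log x * expo p) = x ^ p.1 * (x ^ beta) ^ p.2 := by
  rw [← Real.rpow_def_of_pos hx, expo, Real.rpow_add hx, Real.rpow_natCast, Real.rpow_mul hx.le,
    Real.rpow_natCast]

lemma exp_mul_expo_le {T T' : ℝ} (h : T' ≤ T) (p : ℕ × ℕ) :
    Real.exp (T' * expo p) ≤ Real.exp (T * expo p) :=
  Real.exp_le_exp.mpr (mul_le_mul_of_nonneg_right h (expo_nonneg p))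

lemma wnorm_mono {T T' : ℝ} (h : T' ≤ T) (a : ℕ × ℕ → ℂ) : wnorm T' a ≤ wnorm T a :=
  ENNReal.tsum_le_tsum fun p =>
    mul_le_mul_right (ENNReal.ofReal_le_ofReal (exp_mul_expo_le h p)) _

lemma omegaNorm_eq_wnorm {ε : ℝ} (hε : 0 < ε) {g : ℝ → ℝ → ℂ} {a : ℕ × ℕ → ℂ}
    (h : ∀ k l, partialZero k l g = (k.factorial : ℂ) * ((l.factorial : ℂ) * a (k, l))) :
    omegaNorm ε g = wnorm (Real.log ε) a := by
  refine tsum_congr fun p => ?_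
  rw [h p.1 p.2]
  have h1 : (0 : ℝ) < p.1.factorial := by exact_mod_cast p.1.factorial_pos
  have h2 : (0 : ℝ) < p.2.factorial := by exact_mod_cast p.2.factorial_pos
  simp only [enorm_mul]
  have h3 : ∀ n : ℕ, ‖(n : ℂ)‖ₑ = ENNReal.ofReal n := fun n => by
    rw [← ofReal_norm, Complex.norm_natCast]
  rw [h3, h3, ← ofReal_norm (a p), ← ENNReal.ofReal_mul h2.le, ← ENNReal.ofReal_mul h1.le,
    ← ENNReal.ofReal_mul (by positivity), ← ENNReal.ofReal_mul (norm_nonneg _)]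
  congr 1
  rw [← Real.rpow_def_of_pos hε]
  change _ = ‖a p‖ * ε ^ ((p.1 : ℝ) + beta * (p.2 : ℝ))
  field_simp

/-- The Taylor coefficients at the origin of a function of two variables. -/
def taylorCoeff (G : ℝ → ℝ → ℂ) (p : ℕ × ℕ) : ℂ :=
  partialZero p.1 p.2 G / ((p.1.factorial : ℂ) * (p.2.factorial : ℂ))

lemma partialZero_eq_taylorCoeff (G : ℝ → ℝ → ℂ) (k l : ℕ) :
    partialZero k l G = (k.factorial : ℂ) * ((l.factorial : ℂ) * taylorCoeff G (k, l)) := by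
  have h1 : (k.factorial : ℂ) ≠ 0 := by exact_mod_cast k.factorial_ne_zero
  have h2 : (l.factorial : ℂ) ≠ 0 := by exact_mod_cast l.factorial_ne_zero
  simp only [taylorCoeff]
  field_simp

/-- The generalised power series `∑ a (k, l) x ^ (k + β l)`, in the variable `t = log x`. -/
def expSeries (a : ℕ × ℕ → ℂ) (t : ℝ) : ℂ := ∑' p, a p * (Real.exp (t * expo p) : ℂ)

lemma doubleSeries_eq_expSeries (a : ℕ × ℕ → ℂ) {x : ℝ} (hx : 0 < x) :
    doubleSeries a x (x ^ beta) = expSeries a (Real.log x) := by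
  refine tsum_congr fun p => ?_
  rw [exp_mul_expo x hx]
  push_cast
  ring

section Unfolds

variable {f : ℝ → ℝ → ℂ} {J : Set ℝ} {ε : ℝ} {F : ℝ → ℝ → ℝ → ℂ}

lemma Unfolds.wnorm_taylorCoeff_lt_top (hε : 0 < ε) (h : Unfolds f J ε F) {η : ℝ} (hη : η ∈ J) :
    wnorm (Real.log ε) (taylorCoeff fun x₁ x₂ => F x₁ x₂ η) < ⊤ := by
  rw [← omegaNorm_eq_wnorm hε (partialZero_eq_taylorCoeff _)]
  exact h.finite η hη

lemma Unfolds.summable_taylorCoeff (hε : 0 < ε) (h : Unfolds f J ε F) {η : ℝ} (hη : η ∈ J) :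
    Summable fun p : ℕ × ℕ =>
      ‖taylorCoeff (fun x₁ x₂ => F x₁ x₂ η) p‖ * ε ^ p.1 * (ε ^ beta) ^ p.2 := by
  refine (summable_of_wnorm (h.wnorm_taylorCoeff_lt_top hε hη)).congr fun p => ?_
  rw [exp_mul_expo ε hε, mul_assoc]

/-- Near `x = 0`, an unfolded function is the sum of its generalised power series. -/
lemma Unfolds.eq_expSeries (hε : 0 < ε) (h : Unfolds f J ε F) {η : ℝ} (hη : η ∈ J) {t : ℝ}
    (ht : t < Real.log ε) :
    f (Real.exp t) η = expSeries (taylorCoeff fun x₁ x₂ => F x₁ x₂ η) t := by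
  have hx : Real.exp t < ε := by rwa [← Real.lt_log_iff_exp_lt hε]
  have hb := Real.rpow_lt_rpow (Real.exp_pos t).le hx beta_pos
  rw [h.eq η hη _ ⟨Real.exp_pos t, hx.le⟩,
    eq_doubleSeries_of_analyticOnNhd hε (Real.rpow_pos_of_pos hε beta)
      (G := fun x₁ x₂ => F x₁ x₂ η) (h.analytic η hη) (h.summable_taylorCoeff hε hη)
      (partialZero_eq_taylorCoeff _) ⟨(Real.exp_pos t).le, hx⟩
      ⟨(Real.rpow_pos_of_pos (Real.exp_pos t) beta).le, hb⟩,
    doubleSeries_eq_expSeries _ (Real.exp_pos t), Real.log_exp]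

lemma Unfolds.tendsto_wnorm_taylorCoeff (hε : 0 < ε) (h : Unfolds f J ε F) {η₀ : ℝ} (hη₀ : η₀ ∈ J) :
    Tendsto (fun η => wnorm (Real.log ε) (taylorCoeff (fun x₁ x₂ => F x₁ x₂ η)
      - taylorCoeff (fun x₁ x₂ => F x₁ x₂ η₀))) (𝓝[J] η₀) (𝓝 0) := by
  refine (h.continuous η₀ hη₀).congr' ?_
  filter_upwards [self_mem_nhdsWithin] with η hη
  refine omegaNorm_eq_wnorm hε fun k l => ?_
  have h0 : ((0 : ℝ), (0 : ℝ)) ∈ Set.Icc (0 : ℝ) ε ×ˢ Set.Icc (0 : ℝ) (ε ^ beta) :=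
    ⟨⟨le_rfl, hε.le⟩, ⟨le_rfl, (Real.rpow_pos_of_pos hε beta).le⟩⟩
  rw [partialZero_sub (G := fun x₁ x₂ => F x₁ x₂ η) (H := fun x₁ x₂ => F x₁ x₂ η₀)
    (h.analytic η hη _ h0) (h.analytic η₀ hη₀ _ h0), partialZero_eq_taylorCoeff,
    partialZero_eq_taylorCoeff]
  simp only [Pi.sub_apply]
  ring

/-- A family of generalised power series whose coefficients depend continuously on the parameter,
without pure powers of `x ^ β`, is unfolded by the corresponding double power series. The factor
`1 / 2` leaves room for analyticity up to the boundary of the rectangle. -/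
lemma unfolds_of_expSeries (hε : 0 < ε) (a : ℝ → ℕ × ℕ → ℂ)
    (hfin : ∀ η ∈ J, wnorm (Real.log ε) (a η) < ⊤)
    (hcont : ∀ η₀ ∈ J, Tendsto (fun η => wnorm (Real.log ε) (a η - a η₀)) (𝓝[J] η₀) (𝓝 0))
    (hpure : ∀ η ∈ J, ∀ l : ℕ, 1 ≤ l → a η (0, l) = 0)
    (heq : ∀ η ∈ J, ∀ t < Real.log ε, f (Real.exp t) η = expSeries (a η) t) :
    Unfolds f J (ε / 2) fun x₁ x₂ η => doubleSeries (a η) x₁ x₂ := by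
  have hε2 : ε / 2 < ε := by linarith
  have hb0 : 0 < ε ^ beta := Real.rpow_pos_of_pos hε beta
  have hb : (ε / 2) ^ beta < ε ^ beta := Real.rpow_lt_rpow (by linarith) hε2 beta_pos
  have hlog : Real.log (ε / 2) < Real.log ε := Real.log_lt_log (by linarith) hε2
  have hsum : ∀ c : ℕ × ℕ → ℂ, wnorm (Real.log ε) c < ⊤ →
      Summable fun p : ℕ × ℕ => ‖c p‖ * ε ^ p.1 * (ε ^ beta) ^ p.2 := by
    intro c hc
    refine (summable_of_wnorm hc).congr fun p => ?_
    rw [exp_mul_expo ε hε, mul_assoc]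
  have han : ∀ η ∈ J, AnalyticOnNhd ℝ (fun p : ℝ × ℝ => doubleSeries (a η) p.1 p.2)
      (Set.Icc 0 (ε / 2) ×ˢ Set.Icc 0 ((ε / 2) ^ beta)) := by
    intro η hη p hp
    refine analyticAt_doubleSeries hε hb0 (hsum _ (hfin η hη)) ?_ ?_
    · rw [abs_of_nonneg hp.1.1]; linarith [hp.1.2]
    · rw [abs_of_nonneg hp.2.1]; linarith [hp.2.2]
  have hpz : ∀ η ∈ J, ∀ k l, partialZero k l (doubleSeries (a η))
      = (k.factorial : ℂ) * ((l.factorial : ℂ) * a η (k, l)) :=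
    fun η hη => partialZero_doubleSeries hε hb0 (hsum _ (hfin η hη))
  have h0 : ((0 : ℝ), (0 : ℝ)) ∈ Set.Icc (0 : ℝ) (ε / 2) ×ˢ Set.Icc (0 : ℝ) ((ε / 2) ^ beta) :=
    ⟨⟨le_rfl, by linarith⟩, ⟨le_rfl, Real.rpow_nonneg (by linarith) beta⟩⟩
  refine ⟨?_, han, ?_, ?_, ?_⟩
  · intro η hη x hx
    have hlt : Real.log x < Real.log ε := Real.log_lt_log hx.1 (by linarith [hx.2])
    rw [doubleSeries_eq_expSeries _ hx.1, ← heq η hη _ hlt, Real.exp_log hx.1]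
  · intro η hη j hj
    change partialZero 0 j (doubleSeries (a η)) = 0
    rw [hpz η hη, hpure η hη j hj]
    simp
  · intro η hη
    change omegaNorm (ε / 2) (doubleSeries (a η)) < ⊤
    rw [omegaNorm_eq_wnorm (by linarith) (hpz η hη)]
    exact (wnorm_mono hlog.le _).trans_lt (hfin η hη)
  · intro η₀ hη₀
    refine tendsto_of_tendsto_of_tendsto_of_le_of_le' tendsto_const_nhds (hcont η₀ hη₀)
      (Eventually.of_forall fun _ => zero_le) ?_
    filter_upwards [self_mem_nhdsWithin] with η hη
    refine le_trans (le_of_eq ?_) (wnorm_mono hlog.le _)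
    refine omegaNorm_eq_wnorm (by linarith) fun k l => ?_
    rw [partialZero_sub (han η hη _ h0) (han η₀ hη₀ _ h0), hpz η hη, hpz η₀ hη₀]
    simp only [Pi.sub_apply]
    ring

end Unfolds

/-! ### The recursion for the coefficients of generalised power series -/

/-- The polynomial function of `q`. -/
def qv (z : ℝ) : ℝ := (z + 1 / 2) * z * (z ^ 2 - 3 / 2 * z - 1 / 4)

/-- The polynomial function of `r`. -/
def rv (z : ℝ) : ℝ := 2 * (z + 1) * (z + 1 / 2)

/-- Multiplication of a generalised power series by `x ^ m`, on the level of coefficients. -/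
def shift (m : ℕ) (a : ℕ × ℕ → ℂ) (p : ℕ × ℕ) : ℂ := if m ≤ p.1 then a (p.1 - m, p.2) else 0

/-- The coefficients `a` solve the recursion for the series `x ^ ρ ∑ a (k, l) x ^ (k + β l)` with
source `b`. The source is measured after division by `q`; where `q` vanishes, `q⁻¹ = 0` and the
source prescribes the free coefficient. -/
def IsCoeff (ρ η : ℝ) (b a : ℕ × ℕ → ℂ) : Prop :=
  ∀ p, a p = b p + ((qv (ρ + expo p))⁻¹ : ℝ) *
    (-shift 1 a p + (η : ℂ) ^ 2 * (rv (ρ + expo p - 2) : ℝ) * shift 2 a p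
      - (η : ℂ) ^ 4 * shift 4 a p)

/-- Auxiliary solution of a recursion that reaches back one, two and four steps. -/
def coeffSeq (s u : ℕ → ℂ) (e : ℂ) (b : ℕ → ℂ) : ℕ → ℂ
  | 0 => b 0
  | 1 => b 1 + s 1 * (-coeffSeq s u e b 0)
  | 2 => b 2 + s 2 * (-coeffSeq s u e b 1 + u 2 * coeffSeq s u e b 0)
  | 3 => b 3 + s 3 * (-coeffSeq s u e b 2 + u 3 * coeffSeq s u e b 1)
  | k + 4 => b (k + 4) + s (k + 4) * (-coeffSeq s u e b (k + 3) + u (k + 4) * coeffSeq s u e b (k + 2)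
      - e * coeffSeq s u e b k)

/-- The solution of the recursion with source `b`. -/
def coeff (ρ η : ℝ) (b : ℕ × ℕ → ℂ) (p : ℕ × ℕ) : ℂ :=
  coeffSeq (fun k => ((qv (ρ + expo (k, p.2)))⁻¹ : ℝ))
    (fun k => (η : ℂ) ^ 2 * (rv (ρ + expo (k, p.2) - 2) : ℝ)) ((η : ℂ) ^ 4)
    (fun k => b (k, p.2)) p.1

lemma isCoeff_coeff (ρ η : ℝ) (b : ℕ × ℕ → ℂ) : IsCoeff ρ η b (coeff ρ η b) := by
  rintro ⟨k, l⟩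
  match k with
  | 0 => simp [coeff, coeffSeq, shift]
  | 1 => simp [coeff, coeffSeq, shift]
  | 2 => simp [coeff, coeffSeq, shift]
  | 3 => simp [coeff, coeffSeq, shift]
  | k + 4 => simp [coeff, coeffSeq, shift]

lemma IsCoeff.sub {ρ η η₀ : ℝ} {b b₀ a a₀ : ℕ × ℕ → ℂ} (h : IsCoeff ρ η b a)
    (h₀ : IsCoeff ρ η₀ b₀ a₀) :
    IsCoeff ρ η (fun p => (b - b₀) p
      + ((η : ℂ) ^ 2 - (η₀ : ℂ) ^ 2) * (((qv (ρ + expo p))⁻¹ * rv (ρ + expo p - 2) : ℝ) *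
          shift 2 a₀ p)
      - ((η : ℂ) ^ 4 - (η₀ : ℂ) ^ 4) * (((qv (ρ + expo p))⁻¹ : ℝ) * shift 4 a₀ p)) (a - a₀) := by
  intro p
  have hs : ∀ m, shift m (a - a₀) p = shift m a p - shift m a₀ p := by
    intro m
    unfold shift
    split_ifs <;> simp
  rw [hs, hs, hs, Pi.sub_apply, h p, h₀ p]
  simp only [Pi.sub_apply]
  push_cast
  ring

lemma exists_symbol_bound {ρ : ℝ} (hρ : -1 / 2 ≤ ρ) : ∃ K : ℝ, 0 < K ∧ ∀ p : ℕ × ℕ,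
    |(qv (ρ + expo p))⁻¹| ≤ K / ((p.1 : ℝ) + 1) ^ 2 ∧
    |(qv (ρ + expo p))⁻¹ * rv (ρ + expo p - 2)| ≤ K / ((p.1 : ℝ) + 1) ^ 2 := by
  set F : ℕ × ℕ → ℝ := fun p => (|(qv (ρ + expo p))⁻¹| +
    |(qv (ρ + expo p))⁻¹ * rv (ρ + expo p - 2)|) * ((p.1 : ℝ) + 1) ^ 2 with hF
  have hF0 : ∀ p, 0 ≤ F p := fun p => by positivity
  set s : Finset (ℕ × ℕ) := Finset.range 4 ×ˢ Finset.range 8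
  have hsum : 0 ≤ ∑ p ∈ s, F p := Finset.sum_nonneg fun p _ => hF0 p
  refine ⟨32 + ∑ p ∈ s, F p, by linarith, fun p => ?_⟩
  have hk : (0 : ℝ) ≤ p.1 := Nat.cast_nonneg _
  have hl : (0 : ℝ) ≤ p.2 := Nat.cast_nonneg _
  have hk1 : (0 : ℝ) < ((p.1 : ℝ) + 1) ^ 2 := by positivity
  rw [le_div_iff₀ hk1, le_div_iff₀ hk1]
  by_cases hp : p ∈ s
  · have h1 : F p ≤ ∑ p ∈ s, F p := Finset.single_le_sum (fun p _ => hF0 p) hp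
    have h2 : |(qv (ρ + expo p))⁻¹| * ((p.1 : ℝ) + 1) ^ 2 ≤ F p := by
      simp only [hF]; gcongr; exact le_add_of_nonneg_right (abs_nonneg _)
    have h3 : |(qv (ρ + expo p))⁻¹ * rv (ρ + expo p - 2)| * ((p.1 : ℝ) + 1) ^ 2 ≤ F p := by
      simp only [hF]; gcongr; exact le_add_of_nonneg_left (abs_nonneg _)
    constructor <;> linarith
  · set σ := ρ + expo p with hσ
    have hb := beta_bounds
    have hkl : 4 ≤ p.1 ∨ 8 ≤ p.2 := by
      by_contra! h
      exact hp (by simp [s, h.1, h.2])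
    have hbl : 0 ≤ beta * (p.2 : ℝ) := by nlinarith
    have hσ3 : 3 ≤ σ := by
      rw [hσ, expo]
      rcases hkl with h | h
      · have : (4 : ℝ) ≤ p.1 := by exact_mod_cast h
        linarith
      · have : (8 : ℝ) ≤ p.2 := by exact_mod_cast h
        nlinarith
    have hσk : ((p.1 : ℝ) + 1) / 2 ≤ σ := by
      by_cases h2 : 2 ≤ p.1
      · have : (2 : ℝ) ≤ p.1 := by exact_mod_cast h2
        rw [hσ, expo]; linarith
      · have : (p.1 : ℝ) ≤ 2 := by exact_mod_cast (by omega : p.1 ≤ 2)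
        linarith
    have hq : σ ^ 4 / 4 ≤ qv σ := by
      unfold qv
      have h1 : σ ^ 2 / 4 ≤ σ ^ 2 - 3 / 2 * σ - 1 / 4 := by nlinarith
      have h2 : σ ^ 2 ≤ (σ + 1 / 2) * σ := by nlinarith
      calc σ ^ 4 / 4 = σ ^ 2 * (σ ^ 2 / 4) := by ring
        _ ≤ _ := by gcongr
    have hqpos : 0 < qv σ := lt_of_lt_of_le (by positivity) hq
    have hr0 : 0 ≤ rv (σ - 2) := by unfold rv; nlinarith
    have hr : rv (σ - 2) ≤ 2 * σ ^ 2 := by unfold rv; nlinarith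
    have hk4 : ((p.1 : ℝ) + 1) ^ 2 ≤ 4 * σ ^ 2 := by nlinarith
    rw [abs_of_pos (inv_pos.mpr hqpos), abs_of_nonneg (by positivity), mul_assoc,
      inv_mul_le_iff₀ hqpos, inv_mul_le_iff₀ hqpos]
    have h9 : 1 ≤ σ ^ 2 := by nlinarith
    have hlow : σ ^ 2 * σ ^ 2 * 8 ≤ qv σ * (32 + ∑ p ∈ s, F p) := by nlinarith
    constructor
    · nlinarith
    · calc rv (σ - 2) * ((p.1 : ℝ) + 1) ^ 2 ≤ (2 * σ ^ 2) * (4 * σ ^ 2) := by gcongr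
        _ ≤ _ := by linarith

/-- Discrete Grönwall inequality in product form. -/
lemma sum_le_prod_mul_sum {x b θ : ℕ → ℝ} (hθ : ∀ k, 0 ≤ θ k) (hb : ∀ k, 0 ≤ b k)
    (h : ∀ k, x k ≤ b k + θ k * ∑ j ∈ Finset.range k, x j) (n : ℕ) :
    ∑ k ∈ Finset.range n, x k
      ≤ (∏ k ∈ Finset.range n, (1 + θ k)) * ∑ k ∈ Finset.range n, b k := by
  induction n with
  | zero => simp
  | succ n ih =>
    rw [Finset.sum_range_succ, Finset.sum_range_succ, Finset.prod_range_succ]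
    have h1 : 1 ≤ ∏ k ∈ Finset.range n, (1 + θ k) := by
      have := Finset.prod_le_prod (s := Finset.range n) (f := fun _ => (1 : ℝ))
        (g := fun k => 1 + θ k) (fun _ _ => zero_le_one) fun k _ => by linarith [hθ k]
      simpa using this
    have h2 : b n ≤ (∏ k ∈ Finset.range n, (1 + θ k)) * (1 + θ n) * b n := by
      have : 1 ≤ (∏ k ∈ Finset.range n, (1 + θ k)) * (1 + θ n) := by nlinarith [hθ n]
      nlinarith [hb n]
    have h3 := mul_le_mul_of_nonneg_left ih (by linarith [hθ n] : 0 ≤ 1 + θ n)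
    nlinarith [h n]

/-- The solution of the recursion is bounded by its source in every weighted `ℓ¹` norm: the factors
in the recursion are summable, so that no smallness of `T` is needed. -/
lemma exists_wnorm_le {ρ : ℝ} (hρ : -1 / 2 ≤ ρ) (N T : ℝ) : ∃ C : ENNReal, C ≠ ⊤ ∧
    ∀ η : ℝ, |η| ≤ N → ∀ a b : ℕ × ℕ → ℂ, IsCoeff ρ η b a → wnorm T a ≤ C * wnorm T b := by
  obtain ⟨K, hK, hKb⟩ := exists_symbol_bound hρ
  set R := Real.exp T with hR
  have hR0 : 0 < R := Real.exp_pos T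
  set M := K * (R + N ^ 2 * R ^ 2 + N ^ 4 * R ^ 4) with hM
  have hM0 : 0 ≤ M := by positivity
  have hsq : Summable fun k : ℕ => M / ((k : ℝ) + 1) ^ 2 := by
    have h1 := (summable_nat_add_iff 1).mpr (Real.summable_one_div_nat_pow.mpr one_lt_two)
    refine (h1.mul_left M).congr fun k => ?_
    push_cast
    ring
  set C := Real.exp (∑' k : ℕ, M / ((k : ℝ) + 1) ^ 2) with hC
  refine ⟨ENNReal.ofReal C, ENNReal.ofReal_ne_top, fun η hη a b hab => ?_⟩
  have hN : 0 ≤ N := (abs_nonneg η).trans hη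
  have hη2 : ‖(η : ℂ)‖ ≤ N := by rwa [Complex.norm_real]
  have hx : ∀ l k, ‖a (k, l)‖ * R ^ k ≤ ‖b (k, l)‖ * R ^ k
      + M / ((k : ℝ) + 1) ^ 2 * ∑ j ∈ Finset.range k, ‖a (j, l)‖ * R ^ j := by
    intro l k
    set S := ∑ j ∈ Finset.range k, ‖a (j, l)‖ * R ^ j with hS
    have hS0 : 0 ≤ S := Finset.sum_nonneg fun j _ => by positivity
    have hsh : ∀ m : ℕ, 0 < m → ‖shift m a (k, l)‖ * R ^ k ≤ R ^ m * S := by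
      intro m hm
      unfold shift
      split_ifs with hmk
      · have h1 : ‖a (k - m, l)‖ * R ^ (k - m) ≤ S :=
          Finset.single_le_sum (f := fun j => ‖a (j, l)‖ * R ^ j) (fun j _ => by positivity)
            (Finset.mem_range.mpr (by simp only at hmk; omega))
        have h2 : R ^ k = R ^ (k - m) * R ^ m := by
          rw [← pow_add]; congr 1; simp only at hmk; omega
        simp only
        rw [h2]
        nlinarith [pow_pos hR0 m]
      · simp; positivity
    have hq1 := (hKb (k, l)).1
    have hq2 := (hKb (k, l)).2
    simp only at hq1 hq2
    set κ := K / ((k : ℝ) + 1) ^ 2 with hκ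
    have hκ0 : 0 ≤ κ := by positivity
    rw [hab (k, l)]
    have hexp : ∀ s u x y z : ℂ, s * (-x + (η : ℂ) ^ 2 * u * y - (η : ℂ) ^ 4 * z)
        = -(s * x) + (η : ℂ) ^ 2 * ((s * u) * y) - (η : ℂ) ^ 4 * (s * z) := by
      intros; ring
    rw [hexp, ← Complex.ofReal_mul]
    set s := (qv (ρ + expo (k, l)))⁻¹
    set u := s * rv (ρ + expo (k, l) - 2)
    have hn : ‖b (k, l) + (-((s : ℂ) * shift 1 a (k, l)) + (η : ℂ) ^ 2 * ((u : ℂ) * shift 2 a (k, l))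
        - (η : ℂ) ^ 4 * ((s : ℂ) * shift 4 a (k, l)))‖
        ≤ ‖b (k, l)‖ + (κ * ‖shift 1 a (k, l)‖ + N ^ 2 * (κ * ‖shift 2 a (k, l)‖)
          + N ^ 4 * (κ * ‖shift 4 a (k, l)‖)) := by
      refine (norm_add_le _ _).trans ?_
      gcongr
      refine (norm_sub_le _ _).trans ?_
      gcongr
      · refine (norm_add_le _ _).trans ?_
        gcongr
        · rw [norm_neg, norm_mul, Complex.norm_real, Real.norm_eq_abs]
          gcongr
        · rw [norm_mul, norm_mul, norm_pow, Complex.norm_real u, Real.norm_eq_abs]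
          gcongr
      · rw [norm_mul, norm_mul, norm_pow, Complex.norm_real s, Real.norm_eq_abs]
        gcongr
    have h1 := hsh 1 one_pos
    have h2 := hsh 2 two_pos
    have h4 := hsh 4 four_pos
    have hRk : 0 < R ^ k := pow_pos hR0 k
    calc _ ≤ (‖b (k, l)‖ + (κ * ‖shift 1 a (k, l)‖ + N ^ 2 * (κ * ‖shift 2 a (k, l)‖)
          + N ^ 4 * (κ * ‖shift 4 a (k, l)‖))) * R ^ k := by gcongr
      _ = ‖b (k, l)‖ * R ^ k + (κ * (‖shift 1 a (k, l)‖ * R ^ k)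
          + N ^ 2 * (κ * (‖shift 2 a (k, l)‖ * R ^ k))
          + N ^ 4 * (κ * (‖shift 4 a (k, l)‖ * R ^ k))) := by ring
      _ ≤ ‖b (k, l)‖ * R ^ k + (κ * (R ^ 1 * S) + N ^ 2 * (κ * (R ^ 2 * S))
          + N ^ 4 * (κ * (R ^ 4 * S))) := by gcongr
      _ = _ := by rw [hM, hκ]; ring
  have hcol : ∀ l n, ∑ k ∈ Finset.range n, ‖a (k, l)‖ * R ^ k
      ≤ C * ∑ k ∈ Finset.range n, ‖b (k, l)‖ * R ^ k := by
    intro l n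
    refine (sum_le_prod_mul_sum (fun k => by positivity) (fun k => by positivity) (hx l) n).trans ?_
    have h0 : 0 ≤ ∑ k ∈ Finset.range n, ‖b (k, l)‖ * R ^ k :=
      Finset.sum_nonneg fun j _ => by positivity
    refine mul_le_mul_of_nonneg_right ?_ h0
    calc ∏ k ∈ Finset.range n, (1 + M / ((k : ℝ) + 1) ^ 2)
        ≤ ∏ k ∈ Finset.range n, Real.exp (M / ((k : ℝ) + 1) ^ 2) := by
          refine Finset.prod_le_prod (fun k _ => by positivity) fun k _ => ?_
          rw [add_comm]
          exact Real.add_one_le_exp _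
      _ = Real.exp (∑ k ∈ Finset.range n, M / ((k : ℝ) + 1) ^ 2) := (Real.exp_sum _ _).symm
      _ ≤ C := Real.exp_le_exp.mpr (hsq.sum_le_tsum _ fun k _ => by positivity)
  have hconv : ∀ c : ℕ × ℕ → ℂ, wnorm T c = ∑' l : ℕ, ENNReal.ofReal (Real.exp (T * (beta * l))) *
      ∑' k : ℕ, ENNReal.ofReal (‖c (k, l)‖ * R ^ k) := by
    intro c
    rw [wnorm, ENNReal.tsum_prod', ENNReal.tsum_comm]
    refine tsum_congr fun l => ?_
    rw [← ENNReal.tsum_mul_left]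
    refine tsum_congr fun k => ?_
    rw [← ofReal_norm, ← ENNReal.ofReal_mul (norm_nonneg _), ← ENNReal.ofReal_mul (Real.exp_pos _).le]
    congr 1
    have : Real.exp (T * expo (k, l)) = R ^ k * Real.exp (T * (beta * l)) := by
      rw [hR, ← Real.exp_nat_mul, ← Real.exp_add, expo]
      congr 1
      ring
    rw [this]
    ring
  rw [hconv, hconv, ← ENNReal.tsum_mul_left]
  refine ENNReal.tsum_le_tsum fun l => ?_
  rw [mul_left_comm (ENNReal.ofReal C)]
  refine mul_le_mul' le_rfl ?_
  refine ENNReal.tsum_le_of_sum_range_le fun n => ?_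
  have hnn : ∀ (c : ℕ × ℕ → ℂ) (k : ℕ), 0 ≤ ‖c (k, l)‖ * R ^ k := fun c k => by positivity
  rw [← ENNReal.ofReal_sum_of_nonneg fun k _ => hnn a k]
  refine (ENNReal.ofReal_le_ofReal (hcol l n)).trans ?_
  rw [ENNReal.ofReal_mul (Real.exp_pos _).le, ENNReal.ofReal_sum_of_nonneg fun k _ => hnn b k]
  gcongr
  exact ENNReal.sum_le_tsum _

lemma wnorm_add_le (T : ℝ) (a b : ℕ × ℕ → ℂ) : wnorm T (fun p => a p + b p) ≤ wnorm T a + wnorm T b := by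
  unfold wnorm
  rw [← ENNReal.tsum_add]
  refine ENNReal.tsum_le_tsum fun p => ?_
  rw [← add_mul]
  gcongr
  exact enorm_add_le _ _

lemma wnorm_const_mul (T : ℝ) (c : ℂ) (a : ℕ × ℕ → ℂ) :
    wnorm T (fun p => c * a p) = ‖c‖ₑ * wnorm T a := by
  unfold wnorm
  rw [← ENNReal.tsum_mul_left]
  refine tsum_congr fun p => ?_
  rw [enorm_mul, mul_assoc]

lemma wnorm_neg (T : ℝ) (a : ℕ × ℕ → ℂ) : wnorm T (fun p => -a p) = wnorm T a := by
  simp [wnorm]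

lemma wnorm_mul_le (T : ℝ) {K : ℝ} {c : ℕ × ℕ → ℂ} (hc : ∀ p, ‖c p‖ ≤ K) (a : ℕ × ℕ → ℂ) :
    wnorm T (fun p => c p * a p) ≤ ENNReal.ofReal K * wnorm T a := by
  unfold wnorm
  rw [← ENNReal.tsum_mul_left]
  refine ENNReal.tsum_le_tsum fun p => ?_
  rw [enorm_mul, mul_assoc]
  gcongr
  rw [← ofReal_norm]
  exact ENNReal.ofReal_le_ofReal (hc p)

/-- The index map `(k, l) ↦ (k + m, l)`. -/
def shiftIdx (m : ℕ) (p : ℕ × ℕ) : ℕ × ℕ := (p.1 + m, p.2)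

lemma shiftIdx_injective (m : ℕ) : Function.Injective (shiftIdx m) := by
  rintro ⟨a, b⟩ ⟨c, d⟩ h
  simp only [shiftIdx, Prod.mk.injEq] at h ⊢
  omega

lemma shift_shiftIdx (m : ℕ) (a : ℕ × ℕ → ℂ) (p : ℕ × ℕ) : shift m a (shiftIdx m p) = a p := by
  simp [shift, shiftIdx]

lemma shift_eq_zero_of_notMem {m : ℕ} {a : ℕ × ℕ → ℂ} {p : ℕ × ℕ}
    (hp : p ∉ Set.range (shiftIdx m)) : shift m a p = 0 := by
  unfold shift
  rw [if_neg]
  intro h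
  exact hp ⟨(p.1 - m, p.2), by simp [shiftIdx, h]⟩

lemma expo_shiftIdx (m : ℕ) (p : ℕ × ℕ) : expo (shiftIdx m p) = expo p + m := by
  simp only [expo, shiftIdx]
  push_cast
  ring

lemma wnorm_shift (T : ℝ) (m : ℕ) (a : ℕ × ℕ → ℂ) :
    wnorm T (shift m a) = ENNReal.ofReal (Real.exp (T * m)) * wnorm T a := by
  unfold wnorm
  rw [← ENNReal.tsum_mul_left, ← (shiftIdx_injective m).tsum_eq]
  · refine tsum_congr fun p => ?_
    rw [shift_shiftIdx, expo_shiftIdx, mul_add, Real.exp_add, ENNReal.ofReal_mul (Real.exp_pos _).le]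
    ring
  · intro p hp
    by_contra h
    exact hp (by simp [shift_eq_zero_of_notMem h])

/-- The solution of the recursion depends continuously on the parameter and on the source. -/
lemma tendsto_wnorm_coeff {Λ : Type*} {l : Filter Λ} {ρ : ℝ} (hρ : -1 / 2 ≤ ρ) {T : ℝ} {e : Λ → ℝ}
    {η₀ : ℝ} (he : Tendsto e l (𝓝 η₀)) {b a : Λ → ℕ × ℕ → ℂ} {b₀ a₀ : ℕ × ℕ → ℂ}
    (ha : ∀ x, IsCoeff ρ (e x) (b x) (a x)) (ha₀ : IsCoeff ρ η₀ b₀ a₀) (hb₀ : wnorm T b₀ < ⊤)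
    (hb : Tendsto (fun x => wnorm T (b x - b₀)) l (𝓝 0)) :
    Tendsto (fun x => wnorm T (a x - a₀)) l (𝓝 0) := by
  obtain ⟨K, hK, hKb⟩ := exists_symbol_bound hρ
  obtain ⟨C, hC, hCb⟩ := exists_wnorm_le hρ (|η₀| + 1) T
  have hK' : ∀ p : ℕ × ℕ, K / ((p.1 : ℝ) + 1) ^ 2 ≤ K := by
    intro p
    refine div_le_self hK.le ?_
    have : (0 : ℝ) ≤ p.1 := Nat.cast_nonneg _
    nlinarith
  have ha₀' : wnorm T a₀ ≠ ⊤ := by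
    refine ne_top_of_le_ne_top (ENNReal.mul_ne_top hC hb₀.ne) (hCb η₀ (by linarith) _ _ ha₀)
  set D : ℕ → ENNReal := fun m => ENNReal.ofReal K * (ENNReal.ofReal (Real.exp (T * m)) * wnorm T a₀)
  have hD : ∀ m, D m ≠ ⊤ := fun m =>
    ENNReal.mul_ne_top ENNReal.ofReal_ne_top (ENNReal.mul_ne_top ENNReal.ofReal_ne_top ha₀')
  have hlim : Tendsto (fun x => C * (wnorm T (b x - b₀)
      + ‖((e x : ℂ) ^ 2 - (η₀ : ℂ) ^ 2)‖ₑ * D 2 + ‖((e x : ℂ) ^ 4 - (η₀ : ℂ) ^ 4)‖ₑ * D 4)) l (𝓝 0) := by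
    have hpow : ∀ n : ℕ, Tendsto (fun x => ‖((e x : ℂ) ^ n - (η₀ : ℂ) ^ n)‖ₑ) l (𝓝 0) := by
      intro n
      have h1 : Tendsto (fun x => ((e x : ℂ) ^ n - (η₀ : ℂ) ^ n)) l (𝓝 0) := by
        have h2 : Tendsto (fun x => (e x : ℂ)) l (𝓝 (η₀ : ℂ)) :=
          (Complex.continuous_ofReal.tendsto _).comp he
        simpa using (h2.pow n).sub_const ((η₀ : ℂ) ^ n)
      simpa using h1.enorm
    have h2 := ENNReal.Tendsto.mul_const (hpow 2) (Or.inr (hD 2))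
    have h4 := ENNReal.Tendsto.mul_const (hpow 4) (Or.inr (hD 4))
    have := ENNReal.Tendsto.const_mul ((hb.add h2).add h4) (Or.inr hC)
    simpa using this
  refine tendsto_of_tendsto_of_tendsto_of_le_of_le' tendsto_const_nhds hlim
    (Eventually.of_forall fun _ => zero_le) ?_
  have hη : ∀ᶠ x in l, |e x| ≤ |η₀| + 1 := by
    have := (continuous_abs.tendsto η₀).comp he
    filter_upwards [this.eventually_lt_const (lt_add_one |η₀|)] with x hx using hx.le
  filter_upwards [hη] with x hx
  refine (hCb (e x) hx _ _ ((ha x).sub ha₀)).trans ?_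
  gcongr
  simp only [sub_eq_add_neg (_ + _)]
  refine (wnorm_add_le _ _ _).trans ?_
  gcongr
  · refine (wnorm_add_le _ _ _).trans ?_
    gcongr
    · rw [wnorm_const_mul]
      gcongr
      refine (wnorm_mul_le T (fun p => ?_) _).trans (by rw [wnorm_shift])
      rw [Complex.norm_real]
      exact (hKb p).2.trans (hK' p)
  · rw [wnorm_neg, wnorm_const_mul]
    gcongr
    refine (wnorm_mul_le T (fun p => ?_) _).trans (by rw [wnorm_shift])
    rw [Complex.norm_real]
    exact (hKb p).1.trans (hK' p)

/-! ### Generalised power series as functions of `t = log x` -/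

/-- The `j`-th derivative in `t = log x` of the series `∑ a (k, l) x ^ (ρ + k + β l)`. -/
def expD (ρ : ℝ) (a : ℕ × ℕ → ℂ) (j : ℕ) (t : ℝ) : ℂ :=
  ∑' p, a p * ((ρ + expo p) ^ j * Real.exp (t * (ρ + expo p)) : ℝ)

lemma exists_expD_bound (ρ : ℝ) (j : ℕ) {t₀ t₁ T : ℝ} (h1 : t₁ < T) :
    ∃ C : ℝ, 0 ≤ C ∧ ∀ t ∈ Set.Icc t₀ t₁, ∀ p : ℕ × ℕ,
      |(ρ + expo p) ^ j * Real.exp (t * (ρ + expo p))| ≤ C * Real.exp (T * expo p) := by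
  set d := T - t₁ with hd
  have hd0 : 0 < d := by rw [hd]; linarith
  refine ⟨(j.factorial / d ^ j * Real.exp (d * |ρ|)) * Real.exp ((|t₀| + |t₁|) * |ρ|), by positivity,
    fun t ht p => ?_⟩
  have hE := expo_nonneg p
  set E := expo p
  have hσ : |ρ + E| ≤ E + |ρ| := by
    refine (abs_add_le _ _).trans ?_
    rw [abs_of_nonneg hE]; linarith
  have hpow : (E + |ρ|) ^ j ≤ j.factorial / d ^ j * Real.exp (d * (E + |ρ|)) := by
    have h3 := Real.pow_div_factorial_le_exp (d * (E + |ρ|)) (by positivity) j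
    have h4 : (0 : ℝ) < j.factorial := by exact_mod_cast j.factorial_pos
    rw [div_le_iff₀ h4, mul_pow] at h3
    rw [div_mul_eq_mul_div, le_div_iff₀ (by positivity)]
    linarith
  have hexp : Real.exp (t * (ρ + E)) ≤ Real.exp ((|t₀| + |t₁|) * |ρ|) * Real.exp (t₁ * E) := by
    rw [← Real.exp_add, Real.exp_le_exp]
    have h5 : t * E ≤ t₁ * E := mul_le_mul_of_nonneg_right ht.2 hE
    have h6 : |t| ≤ |t₀| + |t₁| := by
      rw [abs_le]
      have := neg_abs_le t₀
      have := le_abs_self t₁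
      have := abs_nonneg t₀
      have := abs_nonneg t₁
      constructor <;> linarith [ht.1, ht.2]
    have h7 : t * ρ ≤ |t| * |ρ| := by rw [← abs_mul]; exact le_abs_self _
    nlinarith [abs_nonneg ρ]
  rw [abs_mul, abs_pow, abs_of_pos (Real.exp_pos _)]
  calc |ρ + E| ^ j * Real.exp (t * (ρ + E))
      ≤ (j.factorial / d ^ j * Real.exp (d * (E + |ρ|))) *
        (Real.exp ((|t₀| + |t₁|) * |ρ|) * Real.exp (t₁ * E)) := by
        gcongr
        exact (pow_le_pow_left₀ (abs_nonneg _) hσ j).trans hpow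
    _ = _ := by
        rw [show T * E = d * E + t₁ * E by rw [hd]; ring, mul_add d, Real.exp_add, Real.exp_add]
        ring

lemma exists_norm_expD_le (ρ : ℝ) (j : ℕ) {t₀ t₁ T : ℝ} (h1 : t₁ < T) :
    ∃ C : ℝ, 0 ≤ C ∧ ∀ a : ℕ × ℕ → ℂ, wnorm T a < ⊤ → ∀ t ∈ Set.Icc t₀ t₁,
      (Summable fun p => a p * ((ρ + expo p) ^ j * Real.exp (t * (ρ + expo p)) : ℝ)) ∧
      ‖expD ρ a j t‖ ≤ C * (wnorm T a).toReal := by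
  obtain ⟨C, hC, hCb⟩ := exists_expD_bound ρ j (t₀ := t₀) h1
  refine ⟨C, hC, fun a ha t ht => ?_⟩
  have hs := summable_of_wnorm ha
  have hle : ∀ p, ‖a p * ((ρ + expo p) ^ j * Real.exp (t * (ρ + expo p)) : ℝ)‖
      ≤ C * (‖a p‖ * Real.exp (T * expo p)) := by
    intro p
    rw [norm_mul, Complex.norm_real, Real.norm_eq_abs]
    have := mul_le_mul_of_nonneg_left (hCb t ht p) (norm_nonneg (a p))
    linarith
  refine ⟨Summable.of_norm_bounded (hs.mul_left C) hle, ?_⟩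
  rw [toReal_wnorm, ← tsum_mul_left]
  exact tsum_of_norm_bounded (hs.mul_left C).hasSum hle

lemma hasSum_expD (ρ : ℝ) (j : ℕ) {t T : ℝ} (ht : t < T) {a : ℕ × ℕ → ℂ} (ha : wnorm T a < ⊤) :
    HasSum (fun p => a p * ((ρ + expo p) ^ j * Real.exp (t * (ρ + expo p)) : ℝ)) (expD ρ a j t) := by
  obtain ⟨C, -, h⟩ := exists_norm_expD_le ρ j (t₀ := t) ht
  exact (h a ha t ⟨le_rfl, le_rfl⟩).1.hasSum

lemma hasDerivAt_expD (ρ : ℝ) (j : ℕ) {t T : ℝ} (ht : t < T) {a : ℕ × ℕ → ℂ} (ha : wnorm T a < ⊤) :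
    HasDerivAt (expD ρ a j) (expD ρ a (j + 1) t) t := by
  have h1 : (t + T) / 2 < T := by linarith
  obtain ⟨C, hC, hCb⟩ := exists_expD_bound ρ (j + 1) (t₀ := t - 1) h1
  have hmem : t ∈ Set.Ioo (t - 1) ((t + T) / 2) := ⟨by linarith, by linarith⟩
  refine hasDerivAt_tsum_of_isPreconnected ((summable_of_wnorm ha).mul_left C)
    (isOpen_Ioo (a := t - 1) (b := (t + T) / 2)) isPreconnected_Ioo
    (g := fun p t => a p * ((ρ + expo p) ^ j * Real.exp (t * (ρ + expo p)) : ℝ))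
    (g' := fun p t => a p * ((ρ + expo p) ^ (j + 1) * Real.exp (t * (ρ + expo p)) : ℝ)) ?_ ?_ hmem
    (hasSum_expD ρ j ht ha).summable hmem
  · intro p y _
    refine HasDerivAt.const_mul _ (HasDerivAt.ofReal_comp ?_)
    have h2 : HasDerivAt (fun y => y * (ρ + expo p)) (ρ + expo p) y := hasDerivAt_mul_const _
    exact (h2.exp.const_mul ((ρ + expo p) ^ j)).congr_deriv (by ring)
  · intro p y hy
    rw [norm_mul, Complex.norm_real, Real.norm_eq_abs]
    have := mul_le_mul_of_nonneg_left (hCb y ⟨hy.1.le, hy.2.le⟩ p) (norm_nonneg (a p))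
    linarith

lemma hasSum_of_eq {ι : Type*} {f g : ι → ℂ} {s : ℂ} (h : HasSum f s) (hfg : ∀ p, g p = f p) :
    HasSum g s := by
  rwa [funext hfg]

lemma expD_sub (ρ : ℝ) (j : ℕ) {t T : ℝ} (ht : t < T) {a b : ℕ × ℕ → ℂ} (ha : wnorm T a < ⊤)
    (hb : wnorm T b < ⊤) : expD ρ (a - b) j t = expD ρ a j t - expD ρ b j t := by
  refine HasSum.tsum_eq ?_
  refine hasSum_of_eq ((hasSum_expD ρ j ht ha).sub (hasSum_expD ρ j ht hb)) fun p => ?_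
  simp only [Pi.sub_apply]
  ring

/-- Joint continuity in the coefficients and in the variable. -/
lemma tendsto_expD {Λ : Type*} {l : Filter Λ} (ρ : ℝ) (j : ℕ) {t₀ T : ℝ} (ht : t₀ < T)
    {a : Λ → ℕ × ℕ → ℂ} {a₀ : ℕ × ℕ → ℂ} (ha₀ : wnorm T a₀ < ⊤)
    (h : Tendsto (fun x => wnorm T (a x - a₀)) l (𝓝 0)) :
    Tendsto (fun z : Λ × ℝ => expD ρ (a z.1) j z.2) (l ×ˢ 𝓝 t₀) (𝓝 (expD ρ a₀ j t₀)) := by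
  obtain ⟨C, hC, hCb⟩ := exists_norm_expD_le ρ j (t₀ := t₀ - 1) (show (t₀ + T) / 2 < T by linarith)
  have hcont : Tendsto (fun z : Λ × ℝ => expD ρ a₀ j z.2) (l ×ˢ 𝓝 t₀) (𝓝 (expD ρ a₀ j t₀)) :=
    (hasDerivAt_expD ρ j ht ha₀).continuousAt.tendsto.comp tendsto_snd
  have hzero : Tendsto (fun z : Λ × ℝ => expD ρ (a z.1) j z.2 - expD ρ a₀ j z.2) (l ×ˢ 𝓝 t₀)
      (𝓝 0) := by
    have h1 : Tendsto (fun z : Λ × ℝ => C * (wnorm T (a z.1 - a₀)).toReal) (l ×ˢ 𝓝 t₀) (𝓝 0) := by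
      have h2 := (ENNReal.tendsto_toReal ENNReal.zero_ne_top).comp h
      simpa using (h2.comp tendsto_fst).const_mul C
    refine squeeze_zero_norm' ?_ h1
    have h3 : ∀ᶠ x in l, wnorm T (a x - a₀) < ⊤ := h.eventually_lt_const (by simp)
    have h4 : ∀ᶠ t in 𝓝 t₀, t ∈ Set.Icc (t₀ - 1) ((t₀ + T) / 2) :=
      Icc_mem_nhds (by linarith) (by linarith)
    filter_upwards [h3.prod_mk h4] with z hz
    have h5 : wnorm T (a z.1) < ⊤ := by
      have h6 := wnorm_add_le T (a z.1 - a₀) a₀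
      simp only [Pi.sub_apply, sub_add_cancel] at h6
      exact h6.trans_lt (ENNReal.add_lt_top.mpr ⟨hz.1, ha₀⟩)
    rw [← expD_sub ρ j (by linarith [hz.2.2] : z.2 < T) h5 ha₀]
    exact (hCb _ hz.1 _ hz.2).2
  simpa using hzero.add hcont

/-- The leading behaviour of a generalised power series at `x = 0`. -/
lemma tendsto_expD_atBot (ρ τ : ℝ) (j : ℕ) {T : ℝ} {a : ℕ × ℕ → ℂ} (ha : wnorm T a < ⊤)
    (hτ : ∀ p, a p ≠ 0 → τ ≤ ρ + expo p) :
    Tendsto (fun t => (Real.exp (-(τ * t)) : ℂ) * expD ρ a j t) atBot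
      (𝓝 (∑' p, if ρ + expo p = τ then a p * ((τ ^ j : ℝ) : ℂ) else 0)) := by
  obtain ⟨C, hC, hCb⟩ := exists_expD_bound ρ j (t₀ := T - 1) (show T - 1 < T by linarith)
  have heq : ∀ t, (Real.exp (-(τ * t)) : ℂ) * expD ρ a j t
      = ∑' p, a p * ((ρ + expo p) ^ j * Real.exp (t * (ρ + expo p - τ)) : ℝ) := by
    intro t
    rw [expD, ← tsum_mul_left]
    refine tsum_congr fun p => ?_
    rw [show t * (ρ + expo p - τ) = t * (ρ + expo p) + -(τ * t) by ring, Real.exp_add]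
    push_cast
    ring
  simp_rw [heq]
  refine tendsto_tsum_of_dominated_convergence
    (bound := fun p => Real.exp (-(τ * (T - 1))) * (C * (‖a p‖ * Real.exp (T * expo p)))) ?_ ?_ ?_
  · exact ((summable_of_wnorm ha).mul_left C).mul_left _
  · intro p
    split_ifs with hp
    · simp [hp]
    · by_cases h0 : a p = 0
      · simp [h0]
      · have hpos : 0 < ρ + expo p - τ := sub_pos.mpr (lt_of_le_of_ne (hτ p h0) (Ne.symm hp))
        have h1 : Tendsto (fun t : ℝ => (ρ + expo p) ^ j * Real.exp (t * (ρ + expo p - τ))) atBot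
            (𝓝 0) := by
          have := Real.tendsto_exp_atBot.comp (tendsto_id.atBot_mul_const hpos)
          simpa using this.const_mul ((ρ + expo p) ^ j)
        have h2 := (Complex.continuous_ofReal.tendsto 0).comp h1
        simpa using h2.const_mul (a p)
  · filter_upwards [eventually_le_atBot (T - 1)] with t ht p
    by_cases h0 : a p = 0
    · simp [h0]
    · rw [norm_mul, Complex.norm_real, Real.norm_eq_abs]
      have hpos : 0 ≤ ρ + expo p - τ := sub_nonneg.mpr (hτ p h0)
      have h1 := hCb (T - 1) ⟨le_rfl, le_rfl⟩ p
      rw [abs_mul, abs_of_pos (Real.exp_pos _)] at h1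
      have h2 : Real.exp (t * (ρ + expo p - τ))
          ≤ Real.exp (-(τ * (T - 1))) * Real.exp ((T - 1) * (ρ + expo p)) := by
        rw [← Real.exp_add, Real.exp_le_exp]
        nlinarith
      rw [abs_mul, abs_of_pos (Real.exp_pos _)]
      calc ‖a p‖ * (|(ρ + expo p) ^ j| * Real.exp (t * (ρ + expo p - τ)))
          ≤ ‖a p‖ * (|(ρ + expo p) ^ j| * (Real.exp (-(τ * (T - 1)))
            * Real.exp ((T - 1) * (ρ + expo p)))) := by gcongr
        _ = ‖a p‖ * Real.exp (-(τ * (T - 1))) * (|(ρ + expo p) ^ j| *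
            Real.exp ((T - 1) * (ρ + expo p))) := by ring
        _ ≤ ‖a p‖ * Real.exp (-(τ * (T - 1))) * (C * Real.exp (T * expo p)) := by gcongr
        _ = _ := by ring

/-! ### The equation as a first-order system -/

/-- The expression for `D⁴ v` given by the homogeneous equation, in terms of
`u = (v, D v, D² v, D³ v)` at `x = e ^ t`. -/
def vf (η t : ℝ) (u : Fin 4 → ℂ) : ℂ :=
  u 3 + u 2 + u 1 / 8 - Real.exp t * u 0
    + (η : ℂ) ^ 2 * Real.exp (2 * t) * (2 * u 2 + 3 * u 1 + u 0)
    - (η : ℂ) ^ 4 * Real.exp (4 * t) * u 0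

/-- `U` solves on `s` the first-order system, in the variable `t = log x`, that is equivalent to the
resolvent equation with right-hand side `g`. -/
def IsSol (η : ℝ) (g : ℝ → ℂ) (s : Set ℝ) (U : ℝ → Fin 4 → ℂ) : Prop :=
  ∀ t ∈ s, HasDerivAt U ![U t 1, U t 2, U t 3, vf η t (U t) + g t] t

lemma isSol_iff {η : ℝ} {g : ℝ → ℂ} {s : Set ℝ} {U : ℝ → Fin 4 → ℂ} :
    IsSol η g s U ↔ ∀ t ∈ s, HasDerivAt (fun t => U t 0) (U t 1) t ∧
      HasDerivAt (fun t => U t 1) (U t 2) t ∧ HasDerivAt (fun t => U t 2) (U t 3) t ∧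
      HasDerivAt (fun t => U t 3) (vf η t (U t) + g t) t := by
  simp only [IsSol, hasDerivAt_pi, Fin.forall_fin_succ]
  simp

/-- The state `(v, D v, D² v, D³ v)` of a generalised power series. -/
def expState (ρ : ℝ) (a : ℕ × ℕ → ℂ) (t : ℝ) (i : Fin 4) : ℂ := expD ρ a i t

lemma hasSum_shift {m : ℕ} {a w : ℕ × ℕ → ℂ} {s : ℂ}
    (h : HasSum (fun p => a p * w (shiftIdx m p)) s) : HasSum (fun p => shift m a p * w p) s := by
  rw [← (shiftIdx_injective m).hasSum_iff]
  · refine hasSum_of_eq h fun p => ?_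
    simp only [Function.comp, shift_shiftIdx]
  · intro p hp
    rw [shift_eq_zero_of_notMem hp, zero_mul]

lemma exp_shift (t σ : ℝ) (m : ℕ) :
    (Real.exp (t * (σ + m)) : ℂ) = Real.exp (m * t) * Real.exp (t * σ) := by
  rw [← Complex.ofReal_mul, ← Real.exp_add]
  congr 2
  ring

lemma isSol_expState {ρ η T : ℝ} {a b : ℕ × ℕ → ℂ} (hab : IsCoeff ρ η b a)
    (ha : wnorm T a < ⊤)
    (hcons : ∀ p, qv (ρ + expo p) = 0 → shift 1 a p = 0 ∧ shift 2 a p = 0 ∧ shift 4 a p = 0) :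
    IsSol η (fun t => ∑' p, b p * (qv (ρ + expo p) * Real.exp (t * (ρ + expo p)) : ℝ)) (Set.Iio T)
      (expState ρ a) := by
  rw [isSol_iff]
  intro t ht
  have hd : ∀ j, HasDerivAt (expD ρ a j) (expD ρ a (j + 1) t) t := fun j => hasDerivAt_expD ρ j ht ha
  refine ⟨hd 0, hd 1, hd 2, ?_⟩
  suffices h : vf η t (expState ρ a t)
      + ∑' p, b p * (qv (ρ + expo p) * Real.exp (t * (ρ + expo p)) : ℝ) = expD ρ a 4 t by
    rw [h]; exact hd 3
  have hs : ∀ j, HasSum (fun p => a p * ((ρ + expo p) ^ j * Real.exp (t * (ρ + expo p)) : ℝ))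
      (expD ρ a j t) := fun j => hasSum_expD ρ j ht ha
  have hq := (((hs 4).sub (hs 3)).sub (hs 2)).sub ((hs 1).div_const 8)
  have h1 : HasSum (fun p => shift 1 a p * (Real.exp (t * (ρ + expo p)) : ℂ))
      (Real.exp t * expD ρ a 0 t) := by
    refine hasSum_shift ?_
    refine hasSum_of_eq ((hs 0).mul_left (Real.exp t : ℂ)) fun p => ?_
    rw [expo_shiftIdx, ← add_assoc, exp_shift]
    push_cast
    ring_nf
  have h4 : HasSum (fun p => shift 4 a p * (Real.exp (t * (ρ + expo p)) : ℂ))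
      (Real.exp (4 * t) * expD ρ a 0 t) := by
    refine hasSum_shift ?_
    refine hasSum_of_eq ((hs 0).mul_left (Real.exp (4 * t) : ℂ)) fun p => ?_
    rw [expo_shiftIdx, ← add_assoc, exp_shift]
    push_cast
    ring
  have h2 : HasSum (fun p => shift 2 a p *
      ((rv (ρ + expo p - 2) : ℂ) * (Real.exp (t * (ρ + expo p)) : ℂ)))
      (Real.exp (2 * t) * (2 * expD ρ a 2 t + 3 * expD ρ a 1 t + expD ρ a 0 t)) := by
    refine hasSum_shift (w := fun p =>
      ((rv (ρ + expo p - 2) : ℂ) * (Real.exp (t * (ρ + expo p)) : ℂ))) ?_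
    refine hasSum_of_eq (((((hs 2).mul_left 2).add ((hs 1).mul_left 3)).add (hs 0)).mul_left
      (Real.exp (2 * t) : ℂ)) fun p => ?_
    rw [expo_shiftIdx, ← add_assoc, exp_shift, rv]
    push_cast
    ring
  have hall := ((hq.add h1).sub (h2.mul_left ((η : ℂ) ^ 2))).add (h4.mul_left ((η : ℂ) ^ 4))
  have hb := hasSum_of_eq (g := fun p => b p * (qv (ρ + expo p) * Real.exp (t * (ρ + expo p)) : ℝ))
    hall fun p => by
    have hp := hab p
    by_cases h0 : qv (ρ + expo p) = 0
    · obtain ⟨e1, e2, e4⟩ := hcons p h0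
      rw [e1, e2, e4, h0]
      have h0' : ((ρ : ℂ) + expo p) ^ 4 - ((ρ : ℂ) + expo p) ^ 3 - ((ρ : ℂ) + expo p) ^ 2
          - ((ρ : ℂ) + expo p) / 8 = 0 := by
        have : (qv (ρ + expo p) : ℂ) = 0 := by rw [h0]; simp
        rw [← this, qv]
        push_cast
        ring
      push_cast
      linear_combination (-(a p) * Complex.exp (t * ((ρ : ℂ) + expo p))) * h0'
    · have hbp : b p * (qv (ρ + expo p) : ℂ) = a p * qv (ρ + expo p) + shift 1 a p
          - (η : ℂ) ^ 2 * (rv (ρ + expo p - 2) : ℝ) * shift 2 a p + (η : ℂ) ^ 4 * shift 4 a p := by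
        have h0' : (qv (ρ + expo p) : ℂ) ≠ 0 := by exact_mod_cast h0
        rw [hp]
        push_cast
        field_simp
        ring
      rw [Complex.ofReal_mul, ← mul_assoc, hbp, qv]
      push_cast
      ring
  rw [hb.tsum_eq]
  simp only [vf, expState, Fin.isValue, Fin.val_zero, Fin.val_one, Fin.val_two]
  rw [show ((3 : Fin 4) : ℕ) = 3 from rfl]
  ring

lemma IsCoeff.eq_zero {ρ η : ℝ} {b a : ℕ × ℕ → ℂ} (h : IsCoeff ρ η b a) {p₀ : ℕ × ℕ}
    (hb : ∀ p : ℕ × ℕ, (p.2 ≠ p₀.2 ∨ p.1 < p₀.1) → b p = 0) :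
    ∀ p : ℕ × ℕ, (p.2 ≠ p₀.2 ∨ p.1 < p₀.1) → a p = 0 := by
  rintro ⟨k, l⟩ hp
  induction k using Nat.strong_induction_on with
  | _ k ih =>
    have hs : ∀ m, 0 < m → shift m a (k, l) = 0 := by
      intro m hm
      unfold shift
      split_ifs with hmk
      · simp only at hmk hp ⊢
        exact ih (k - m) (by omega) (by simp only; omega)
      · rfl
    rw [h (k, l), hb _ hp, hs 1 one_pos, hs 2 two_pos, hs 4 four_pos]
    simp

lemma IsCoeff.wnorm_lt_top {ρ η T : ℝ} {b a : ℕ × ℕ → ℂ} (hρ : -1 / 2 ≤ ρ) (h : IsCoeff ρ η b a)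
    (hb : wnorm T b < ⊤) : wnorm T a < ⊤ := by
  obtain ⟨C, hC, hCb⟩ := exists_wnorm_le hρ |η| T
  exact (hCb η le_rfl a b h).trans_lt (ENNReal.mul_lt_top hC.lt_top hb)

lemma wnorm_single (T : ℝ) (p₀ : ℕ × ℕ) (c : ℂ) :
    wnorm T (Pi.single p₀ c) = ‖c‖ₑ * ENNReal.ofReal (Real.exp (T * expo p₀)) := by
  unfold wnorm
  rw [tsum_eq_single p₀]
  · simp
  · intro p hp
    simp [hp]

lemma qv_eq_zero {z : ℝ} (h : qv z = 0) : z = -1 / 2 ∨ z = 1 / 2 - beta ∨ z = 0 ∨ z = 1 + beta := by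
  have h1 : qv z = (z + 1 / 2) * z * ((z + beta - 1 / 2) * (z - beta - 1)) := by
    unfold qv
    linear_combination ((z + 1 / 2) * z) * beta_sq
  rw [h1] at h
  rcases mul_eq_zero.mp h with h | h
  · rcases mul_eq_zero.mp h with h | h
    · left; linarith
    · right; right; left; exact h
  · rcases mul_eq_zero.mp h with h | h
    · right; left; linarith
    · right; right; right; linarith

lemma qv_lead_eq_zero : qv (-1 / 2) = 0 ∧ qv (1 / 2 - beta) = 0 ∧ qv 0 = 0 ∧ qv (1 + beta) = 0 := by
  refine ⟨by norm_num [qv], ?_, by norm_num [qv], ?_⟩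
  · unfold qv; linear_combination ((1 / 2 - beta + 1 / 2) * (1 / 2 - beta)) * beta_sq
  · unfold qv; linear_combination ((1 + beta + 1 / 2) * (1 + beta)) * beta_sq

/-! ### The fundamental system of the homogeneous equation -/

/-- The indicial exponents, i.e. the zeros of `q`. -/
def lead : Fin 4 → ℝ := ![-1 / 2, 1 / 2 - beta, 0, 1 + beta]

/-- The offset `ρ` in the exponents `ρ + k + β l` of the fundamental solutions. The fourth solution
is expanded in the same powers as the third one, with `(1, 1)` as its first index. -/
def base : Fin 4 → ℝ := ![-1 / 2, 1 / 2 - beta, 0, 0]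

/-- The index of the leading coefficient of the fundamental solutions. -/
def srcIdx : Fin 4 → ℕ × ℕ := ![(0, 0), (0, 0), (0, 0), (1, 1)]

/-- The coefficients of the `i`-th fundamental solution. -/
def phiCoeff (i : Fin 4) (η : ℝ) : ℕ × ℕ → ℂ := coeff (base i) η (Pi.single (srcIdx i) 1)

/-- The state of the `i`-th fundamental solution, which behaves like `x ^ lead i` at `x = 0`. -/
def phi (i : Fin 4) (η t : ℝ) : Fin 4 → ℂ := expState (base i) (phiCoeff i η) t

lemma base_ge (i : Fin 4) : -1 / 2 ≤ base i := by
  have := beta_bounds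
  fin_cases i <;> simp [base] <;> linarith

lemma base_add_expo_srcIdx (i : Fin 4) : base i + expo (srcIdx i) = lead i := by
  fin_cases i <;> simp [base, lead, srcIdx, expo]

lemma qv_lead (i : Fin 4) : qv (lead i) = 0 := by
  obtain ⟨h0, h1, h2, h3⟩ := qv_lead_eq_zero
  fin_cases i
  · exact h0
  · exact h1
  · exact h2
  · exact h3

lemma qv_base_ne_zero (i : Fin 4) {p : ℕ × ℕ} (h2 : p.2 = (srcIdx i).2)
    (h1 : (srcIdx i).1 < p.1) : qv (base i + expo p) ≠ 0 := by
  obtain ⟨k, l⟩ := p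
  have hb := beta_bounds
  intro h
  have h' := qv_eq_zero h
  fin_cases i <;> simp [base, srcIdx, expo] at h1 h2 h' <;> subst h2 <;> simp at h'
  · have hk1 : (1 : ℝ) ≤ k := by exact_mod_cast h1
    rcases (by omega : k ≤ 2 ∨ 3 ≤ k) with hk | hk
    · have : (k : ℝ) ≤ 2 := by exact_mod_cast hk
      rcases h' with h' | h' | h' | h' <;> linarith
    · have : (3 : ℝ) ≤ k := by exact_mod_cast hk
      rcases h' with h' | h' | h' | h' <;> linarith
  · have hk1 : (1 : ℝ) ≤ k := by exact_mod_cast h1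
    rcases (by omega : k ≤ 1 ∨ 2 ≤ k) with hk | hk
    · have : (k : ℝ) ≤ 1 := by exact_mod_cast hk
      rcases h' with h' | h' | h' | h' <;> linarith
    · have : (2 : ℝ) ≤ k := by exact_mod_cast hk
      rcases h' with h' | h' | h' | h' <;> linarith
  · have hk1 : (1 : ℝ) ≤ k := by exact_mod_cast h1
    rcases (by omega : k ≤ 1 ∨ 2 ≤ k) with hk | hk
    · have : (k : ℝ) ≤ 1 := by exact_mod_cast hk
      rcases h' with h' | h' | h' | h' <;> linarith
    · have : (2 : ℝ) ≤ k := by exact_mod_cast hk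
      rcases h' with h' | h' | h' | h' <;> linarith
  · have hk1 : (2 : ℝ) ≤ k := by exact_mod_cast h1
    rcases h' with h' | h' | h' | h' <;> linarith

lemma isCoeff_phiCoeff (i : Fin 4) (η : ℝ) :
    IsCoeff (base i) η (Pi.single (srcIdx i) 1) (phiCoeff i η) := isCoeff_coeff _ _ _

lemma wnorm_single_lt_top (T : ℝ) (p₀ : ℕ × ℕ) (c : ℂ) : wnorm T (Pi.single p₀ c) < ⊤ := by
  rw [wnorm_single]
  exact ENNReal.mul_lt_top enorm_lt_top ENNReal.ofReal_lt_top

lemma wnorm_phiCoeff_lt_top (i : Fin 4) (η T : ℝ) : wnorm T (phiCoeff i η) < ⊤ :=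
  (isCoeff_phiCoeff i η).wnorm_lt_top (base_ge i) (wnorm_single_lt_top _ _ _)

lemma phiCoeff_eq_zero (i : Fin 4) (η : ℝ) {p : ℕ × ℕ}
    (hp : p.2 ≠ (srcIdx i).2 ∨ p.1 < (srcIdx i).1) : phiCoeff i η p = 0 := by
  refine (isCoeff_phiCoeff i η).eq_zero (p₀ := srcIdx i) (fun p hp => ?_) p hp
  refine Pi.single_eq_of_ne ?_ _
  rintro rfl
  simp at hp

lemma shift_phiCoeff_eq_zero (i : Fin 4) (η : ℝ) {p : ℕ × ℕ} {m : ℕ} (hm : 0 < m)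
    (hp : p.2 ≠ (srcIdx i).2 ∨ p.1 ≤ (srcIdx i).1) : shift m (phiCoeff i η) p = 0 := by
  unfold shift
  split_ifs with h
  · refine phiCoeff_eq_zero i η ?_
    simp only
    omega
  · rfl

lemma phiCoeff_srcIdx (i : Fin 4) (η : ℝ) : phiCoeff i η (srcIdx i) = 1 := by
  have hs : ∀ m, 0 < m → shift m (phiCoeff i η) (srcIdx i) = 0 := fun m hm =>
    shift_phiCoeff_eq_zero i η hm (Or.inr le_rfl)
  rw [isCoeff_phiCoeff i η (srcIdx i), hs 1 one_pos, hs 2 two_pos, hs 4 four_pos]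
  simp

lemma isSol_phi (i : Fin 4) (η : ℝ) : IsSol η 0 Set.univ (phi i η) := by
  intro t _
  have h := isSol_expState (T := t + 1) (isCoeff_phiCoeff i η) (wnorm_phiCoeff_lt_top i η _)
    (fun p hp => by
      have h0 : p.2 ≠ (srcIdx i).2 ∨ p.1 ≤ (srcIdx i).1 := by
        by_contra! h
        exact qv_base_ne_zero i h.1 h.2 hp
      exact ⟨shift_phiCoeff_eq_zero i η one_pos h0, shift_phiCoeff_eq_zero i η two_pos h0,
        shift_phiCoeff_eq_zero i η four_pos h0⟩) t (by simp)
  have hz : ∑' p, (Pi.single (srcIdx i) 1 : ℕ × ℕ → ℂ) p *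
      (qv (base i + expo p) * Real.exp (t * (base i + expo p)) : ℝ) = 0 := by
    rw [tsum_eq_single (srcIdx i)]
    · rw [base_add_expo_srcIdx, qv_lead]; simp
    · intro p hp
      simp [hp]
  simp only [hz] at h
  exact h

lemma continuous_phi (i : Fin 4) : Continuous fun z : ℝ × ℝ => phi i z.1 z.2 := by
  refine continuous_pi fun j => ?_
  rw [continuous_iff_continuousAt]
  rintro ⟨η, t⟩
  rw [ContinuousAt, nhds_prod_eq]
  refine tendsto_expD (base i) j (T := t + 1) (lt_add_one t) (wnorm_phiCoeff_lt_top i η _) ?_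
  refine tendsto_wnorm_coeff (base_ge i) tendsto_id (fun x => isCoeff_phiCoeff i x)
    (isCoeff_phiCoeff i η) (wnorm_single_lt_top _ _ _) ?_
  simp [wnorm]

lemma tendsto_phi_atBot (i j : Fin 4) (η : ℝ) :
    Tendsto (fun t => (Real.exp (-(lead i * t)) : ℂ) * phi i η t j) atBot
      (𝓝 ((lead i ^ (j : ℕ) : ℝ) : ℂ)) := by
  have hsup : ∀ p, phiCoeff i η p ≠ 0 → p.2 = (srcIdx i).2 ∧ (srcIdx i).1 ≤ p.1 := by
    intro p hp
    by_contra h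
    exact hp (phiCoeff_eq_zero i η (by omega))
  have h := tendsto_expD_atBot (base i) (lead i) j (wnorm_phiCoeff_lt_top i η 0) fun p hp => by
    obtain ⟨h2, h1⟩ := hsup p hp
    have h1' : ((srcIdx i).1 : ℝ) ≤ p.1 := by exact_mod_cast h1
    rw [← base_add_expo_srcIdx, expo, expo, h2]
    linarith
  suffices hsum : (∑' p, if base i + expo p = lead i then
      phiCoeff i η p * ((lead i ^ (j : ℕ) : ℝ) : ℂ) else 0) = ((lead i ^ (j : ℕ) : ℝ) : ℂ) by
    rw [hsum] at h
    exact h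
  rw [tsum_eq_single (srcIdx i), if_pos (base_add_expo_srcIdx i), phiCoeff_srcIdx, one_mul]
  intro p hp
  split_ifs with he
  · by_cases h0 : phiCoeff i η p = 0
    · simp [h0]
    · obtain ⟨h2, h1⟩ := hsup p h0
      exfalso
      apply hp
      rw [← base_add_expo_srcIdx, expo, expo, h2] at he
      have : p.1 = (srcIdx i).1 := by
        have : (p.1 : ℝ) = (srcIdx i).1 := by linarith
        exact_mod_cast this
      exact Prod.ext this h2
  · rfl

/-! ### Solutions of the inhomogeneous equation near `x = 0` -/

/-- The source of the recursion for the right-hand side `∑ c (k, l) x ^ (k + β l)` and the free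
coefficients `A` and `B` of `1` and `x ^ (1 + β)`. -/
def innerSource (c : ℕ × ℕ → ℂ) (A B : ℂ) (p : ℕ × ℕ) : ℂ :=
  ((qv (expo p))⁻¹ : ℝ) * c p + ((Pi.single (0, 0) A : ℕ × ℕ → ℂ) p
    + (Pi.single (1, 1) B : ℕ × ℕ → ℂ) p)

/-- The coefficients of the solution near `x = 0` with free coefficients `A` and `B`. -/
def innerCoeff (η : ℝ) (c : ℕ × ℕ → ℂ) (A B : ℂ) : ℕ × ℕ → ℂ := coeff 0 η (innerSource c A B)

lemma isCoeff_innerCoeff (η : ℝ) (c : ℕ × ℕ → ℂ) (A B : ℂ) :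
    IsCoeff 0 η (innerSource c A B) (innerCoeff η c A B) := isCoeff_coeff _ _ _

lemma qv_expo_eq_zero {p : ℕ × ℕ} (h : qv (expo p) = 0) : p = (0, 0) ∨ p = (1, 1) := by
  obtain ⟨k, l⟩ := p
  have hb := beta_bounds
  have hE := expo_nonneg (k, l)
  have h' : expo (k, l) = 0 ∨ expo (k, l) = 1 + beta := by
    rcases qv_eq_zero h with h | h | h | h
    · linarith
    · linarith
    · exact Or.inl h
    · exact Or.inr h
  simp only [expo] at h'
  have hk0 : (0 : ℝ) ≤ k := Nat.cast_nonneg k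
  have hl0 : (0 : ℝ) ≤ l := Nat.cast_nonneg l
  rcases h' with h' | h'
  · left
    have hk : (k : ℝ) = 0 := by nlinarith
    have hl : (l : ℝ) = 0 := by nlinarith
    simp only [Nat.cast_eq_zero] at hk hl
    simp [hk, hl]
  · right
    rcases (by omega : l = 0 ∨ l = 1 ∨ l = 2 ∨ 3 ≤ l) with hl | hl | hl | hl
    · subst hl
      simp at h'
      exfalso
      rcases (by omega : k ≤ 1 ∨ 2 ≤ k) with hk | hk
      · have : (k : ℝ) ≤ 1 := by exact_mod_cast hk
        linarith
      · have : (2 : ℝ) ≤ k := by exact_mod_cast hk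
        linarith
    · subst hl
      have : (k : ℝ) = 1 := by push_cast at h'; linarith
      have : k = 1 := by exact_mod_cast this
      simp [this]
    · subst hl
      exfalso
      push_cast at h'
      rcases (by omega : k ≤ 0 ∨ 1 ≤ k) with hk | hk
      · have : (k : ℝ) ≤ 0 := by exact_mod_cast hk
        linarith
      · have : (1 : ℝ) ≤ k := by exact_mod_cast hk
        linarith
    · exfalso
      have : (3 : ℝ) ≤ l := by exact_mod_cast hl
      nlinarith

lemma wnorm_innerSource_le (T : ℝ) : ∃ K : ℝ, ∀ (c : ℕ × ℕ → ℂ) (A B : ℂ),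
    wnorm T (innerSource c A B) ≤ ENNReal.ofReal K * wnorm T c + (‖A‖ₑ
      + ‖B‖ₑ * ENNReal.ofReal (Real.exp (T * expo (1, 1)))) := by
  obtain ⟨K, hK, hKb⟩ := exists_symbol_bound (ρ := 0) (by norm_num)
  refine ⟨K, fun c A B => ?_⟩
  refine (wnorm_add_le _ _ _).trans ?_
  gcongr
  · refine wnorm_mul_le T (fun p => ?_) c
    rw [Complex.norm_real]
    have h1 := (hKb p).1
    rw [zero_add] at h1
    refine h1.trans (div_le_self hK.le ?_)
    have : (0 : ℝ) ≤ p.1 := Nat.cast_nonneg _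
    nlinarith
  · refine (wnorm_add_le _ _ _).trans ?_
    gcongr
    · rw [wnorm_single]; simp [expo]
    · rw [wnorm_single]

lemma wnorm_innerSource_lt_top {T : ℝ} {c : ℕ × ℕ → ℂ} (hc : wnorm T c < ⊤) (A B : ℂ) :
    wnorm T (innerSource c A B) < ⊤ := by
  obtain ⟨K, h⟩ := wnorm_innerSource_le T
  exact (h c A B).trans_lt (ENNReal.add_lt_top.mpr ⟨ENNReal.mul_lt_top ENNReal.ofReal_lt_top hc,
    ENNReal.add_lt_top.mpr ⟨enorm_lt_top, ENNReal.mul_lt_top enorm_lt_top ENNReal.ofReal_lt_top⟩⟩)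

lemma wnorm_innerCoeff_lt_top {T : ℝ} {c : ℕ × ℕ → ℂ} (hc : wnorm T c < ⊤) (η : ℝ) (A B : ℂ) :
    wnorm T (innerCoeff η c A B) < ⊤ :=
  (isCoeff_innerCoeff η c A B).wnorm_lt_top (by norm_num) (wnorm_innerSource_lt_top hc A B)

lemma tendsto_wnorm_innerCoeff {Λ : Type*} {l : Filter Λ} {T : ℝ} {e : Λ → ℝ} {η₀ : ℝ}
    (he : Tendsto e l (𝓝 η₀)) {c : Λ → ℕ × ℕ → ℂ} {c₀ : ℕ × ℕ → ℂ} (hc₀ : wnorm T c₀ < ⊤)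
    (hc : Tendsto (fun x => wnorm T (c x - c₀)) l (𝓝 0)) {A B : Λ → ℂ} {A₀ B₀ : ℂ}
    (hA : Tendsto A l (𝓝 A₀)) (hB : Tendsto B l (𝓝 B₀)) :
    Tendsto (fun x => wnorm T (innerCoeff (e x) (c x) (A x) (B x) - innerCoeff η₀ c₀ A₀ B₀)) l
      (𝓝 0) := by
  refine tendsto_wnorm_coeff (by norm_num) he (fun x => isCoeff_innerCoeff _ _ _ _)
    (isCoeff_innerCoeff _ _ _ _) (wnorm_innerSource_lt_top hc₀ _ _) ?_
  obtain ⟨K, h⟩ := wnorm_innerSource_le T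
  have hsub : ∀ x, innerSource (c x) (A x) (B x) - innerSource c₀ A₀ B₀
      = innerSource (c x - c₀) (A x - A₀) (B x - B₀) := by
    intro x
    funext p
    simp only [innerSource, Pi.sub_apply, Pi.single_sub]
    ring
  have h1 : Tendsto (fun x => ENNReal.ofReal K * wnorm T (c x - c₀) + (‖A x - A₀‖ₑ
      + ‖B x - B₀‖ₑ * ENNReal.ofReal (Real.exp (T * expo (1, 1))))) l (𝓝 0) := by
    have hA' : Tendsto (fun x => ‖A x - A₀‖ₑ) l (𝓝 0) := by
      simpa using (hA.sub_const A₀).enorm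
    have hB' : Tendsto (fun x => ‖B x - B₀‖ₑ) l (𝓝 0) := by
      simpa using (hB.sub_const B₀).enorm
    have h2 := ENNReal.Tendsto.const_mul hc (a := ENNReal.ofReal K) (Or.inr ENNReal.ofReal_ne_top)
    have h3 := ENNReal.Tendsto.mul_const hB'
      (b := ENNReal.ofReal (Real.exp (T * expo (1, 1)))) (Or.inr ENNReal.ofReal_ne_top)
    simpa using h2.add (hA'.add h3)
  refine tendsto_of_tendsto_of_tendsto_of_le_of_le tendsto_const_nhds h1 (fun _ => zero_le)
    fun x => ?_
  simp only [hsub]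
  exact h _ _ _

lemma innerSource_zero_left {c : ℕ × ℕ → ℂ} (h0 : ∀ l, c (0, l) = 0) (A B : ℂ) {l : ℕ}
    (hl : 1 ≤ l) : innerSource c A B (0, l) = 0 := by
  simp [innerSource, h0, show l ≠ 0 by omega]

/-- The solution near `x = 0` contains no pure powers of `x ^ β`. -/
lemma innerCoeff_zero_left {c : ℕ × ℕ → ℂ} (h0 : ∀ l, c (0, l) = 0) (η : ℝ) (A B : ℂ) {l : ℕ}
    (hl : 1 ≤ l) : innerCoeff η c A B (0, l) = 0 := by
  rw [isCoeff_innerCoeff η c A B (0, l), innerSource_zero_left h0 A B hl]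
  simp [shift]

/-- The right-hand side of the recursion vanishes at the resonant indices `(0, 0)` and `(1, 1)`, so
that no logarithms are needed: `c` vanishes there, and without pure powers of `x ^ β` the lower
coefficients do not contribute at `(1, 1)`. -/
lemma isSol_innerCoeff {c : ℕ × ℕ → ℂ} (h0 : ∀ l, c (0, l) = 0) (h1 : c (1, 1) = 0) {T : ℝ}
    (hc : wnorm T c < ⊤) (η : ℝ) (A B : ℂ) :
    IsSol η (expSeries c) (Set.Iio T) (expState 0 (innerCoeff η c A B)) := by
  have h := isSol_expState (isCoeff_innerCoeff η c A B) (wnorm_innerCoeff_lt_top hc η A B)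
    fun p hp => by
      rw [zero_add] at hp
      rcases qv_expo_eq_zero hp with rfl | rfl
      · simp [shift]
      · simp [shift, innerCoeff_zero_left h0 η A B le_rfl]
  have hg : (fun t => ∑' p, innerSource c A B p * (qv (0 + expo p) *
      Real.exp (t * (0 + expo p)) : ℝ)) = expSeries c := by
    funext t
    refine tsum_congr fun p => ?_
    rw [zero_add, Complex.ofReal_mul, ← mul_assoc]
    congr 1
    by_cases hp : qv (expo p) = 0
    · rw [hp]
      rcases qv_expo_eq_zero hp with rfl | rfl
      · simp [h0]
      · simp [h1]
    · have hp0 : p ≠ (0, 0) := by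
        rintro rfl
        exact hp (by simpa [expo] using qv_lead_eq_zero.2.2.1)
      have hp1 : p ≠ (1, 1) := by
        rintro rfl
        exact hp (by simpa [expo] using qv_lead_eq_zero.2.2.2)
      have hp' : (qv (expo p) : ℂ) ≠ 0 := by exact_mod_cast hp
      rw [innerSource, Pi.single_eq_of_ne hp0, Pi.single_eq_of_ne hp1]
      push_cast
      field_simp
      ring
  rw [hg] at h
  exact h

lemma IsCoeff.unique {ρ η : ℝ} {b a a' : ℕ × ℕ → ℂ} (h : IsCoeff ρ η b a) (h' : IsCoeff ρ η b a') :
    a = a' := by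
  have hd := h.sub h'
  funext p
  have := hd.eq_zero (p₀ := (p.1 + 1, p.2)) (fun q _ => by simp) p (Or.inr (by simp))
  exact sub_eq_zero.mp this

lemma innerCoeff_eq (η : ℝ) (c : ℕ × ℕ → ℂ) (A B : ℂ) :
    innerCoeff η c A B = fun p => innerCoeff η c 0 0 p + A * phiCoeff 2 η p + B * phiCoeff 3 η p := by
  refine (isCoeff_innerCoeff η c A B).unique fun p => ?_
  have hs : ∀ m, shift m (fun p => innerCoeff η c 0 0 p + A * phiCoeff 2 η p + B * phiCoeff 3 η p) p
      = shift m (innerCoeff η c 0 0) p + A * shift m (phiCoeff 2 η) p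
        + B * shift m (phiCoeff 3 η) p := by
    intro m
    unfold shift
    split_ifs <;> simp
  have e2 := isCoeff_phiCoeff 2 η p
  have e3 := isCoeff_phiCoeff 3 η p
  simp only [base, srcIdx, Fin.isValue, Matrix.cons_val] at e2 e3
  rw [hs, hs, hs, e2, e3, isCoeff_innerCoeff η c 0 0 p]
  simp only [innerSource, Pi.single_apply]
  split_ifs <;> ring

lemma expState_innerCoeff {c : ℕ × ℕ → ℂ} {T : ℝ} (hc : wnorm T c < ⊤) (η : ℝ) (A B : ℂ) {t : ℝ}
    (ht : t < T) : expState 0 (innerCoeff η c A B) t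
      = expState 0 (innerCoeff η c 0 0) t + A • phi 2 η t + B • phi 3 η t := by
  funext j
  have h := hasSum_expD 0 j ht (wnorm_innerCoeff_lt_top hc η 0 0)
  have h2 := (hasSum_expD 0 j ht (wnorm_phiCoeff_lt_top 2 η T)).mul_left A
  have h3 := (hasSum_expD 0 j ht (wnorm_phiCoeff_lt_top 3 η T)).mul_left B
  refine (hasSum_of_eq ((h.add h2).add h3) fun p => ?_).tsum_eq
  rw [innerCoeff_eq]
  ring

/-! ### Linear structure, uniqueness and variation of constants -/

section System

variable {η : ℝ} {g h : ℝ → ℂ} {s : Set ℝ} {U V : ℝ → Fin 4 → ℂ}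

lemma vf_add (η t : ℝ) (u w : Fin 4 → ℂ) : vf η t (u + w) = vf η t u + vf η t w := by
  simp only [vf, Pi.add_apply]; ring

lemma vf_smul (η t : ℝ) (c : ℂ) (u : Fin 4 → ℂ) : vf η t (c • u) = c * vf η t u := by
  simp only [vf, Pi.smul_apply, smul_eq_mul]; ring

lemma IsSol.mono {s' : Set ℝ} (hU : IsSol η g s U) (h : s' ⊆ s) : IsSol η g s' U :=
  fun t ht => hU t (h ht)

lemma IsSol.congr (hU : IsSol η g s U) (hgh : ∀ t ∈ s, g t = h t) : IsSol η h s U := by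
  intro t ht
  rw [← hgh t ht]
  exact hU t ht

lemma IsSol.add (hU : IsSol η g s U) (hV : IsSol η h s V) : IsSol η (g + h) s (U + V) := by
  intro t ht
  refine ((hU t ht).add (hV t ht)).congr_deriv ?_
  funext i
  fin_cases i <;> simp [vf_add]
  ring

lemma IsSol.smul (c : ℂ) (hU : IsSol η g s U) : IsSol η (c • g) s (c • U) := by
  intro t ht
  refine ((hU t ht).const_smul c).congr_deriv ?_
  funext i
  fin_cases i <;> simp [vf_smul]
  ring

lemma IsSol.sub (hU : IsSol η g s U) (hV : IsSol η h s V) : IsSol η (g - h) s (U - V) := by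
  have := hU.add (hV.smul (-1))
  simpa [sub_eq_add_neg] using this

lemma IsSol.continuousOn (hU : IsSol η g s U) : ContinuousOn U s :=
  fun t ht => (hU t ht).continuousAt.continuousWithinAt

lemma exists_lipschitz (η b : ℝ) (g : ℝ → ℂ) : ∃ K : NNReal, ∀ t ≤ b, LipschitzWith K
    fun u : Fin 4 → ℂ => (![u 1, u 2, u 3, vf η t u + g t] : Fin 4 → ℂ) := by
  refine ⟨(⟨3 + Real.exp b + η ^ 2 * Real.exp (2 * b) * 6 + η ^ 4 * Real.exp (4 * b),
    by positivity⟩ : NNReal), fun t ht => LipschitzWith.of_dist_le_mul fun u w => ?_⟩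
  have hc : ∀ i, ‖u i - w i‖ ≤ dist u w := fun i => by
    rw [← dist_eq_norm]; exact dist_le_pi_dist u w i
  have hd := dist_nonneg (x := u) (y := w)
  set d := dist u w
  have hK : 3 ≤ 3 + Real.exp b + η ^ 2 * Real.exp (2 * b) * 6 + η ^ 4 * Real.exp (4 * b) := by
    have h1 : 0 ≤ Real.exp b + η ^ 2 * Real.exp (2 * b) * 6 + η ^ 4 * Real.exp (4 * b) := by
      positivity
    linarith
  have he1 : Real.exp t ≤ Real.exp b := Real.exp_le_exp.mpr ht
  have he2 : Real.exp (2 * t) ≤ Real.exp (2 * b) := Real.exp_le_exp.mpr (by linarith)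
  have he4 : Real.exp (4 * t) ≤ Real.exp (4 * b) := Real.exp_le_exp.mpr (by linarith)
  have hlow : ∀ i, ‖u i - w i‖
      ≤ (3 + Real.exp b + η ^ 2 * Real.exp (2 * b) * 6 + η ^ 4 * Real.exp (4 * b)) * d := by
    intro i
    have := hc i
    nlinarith
  change _ ≤ (3 + Real.exp b + η ^ 2 * Real.exp (2 * b) * 6 + η ^ 4 * Real.exp (4 * b)) * d
  rw [dist_pi_le_iff (by positivity)]
  have h3 : ‖vf η t u + g t - (vf η t w + g t)‖
      ≤ (3 + Real.exp b + η ^ 2 * Real.exp (2 * b) * 6 + η ^ 4 * Real.exp (4 * b)) * d := by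
    have heq : vf η t u + g t - (vf η t w + g t) = (u 3 - w 3) + (u 2 - w 2) + (u 1 - w 1) / 8
        - Real.exp t * (u 0 - w 0)
        + ((η ^ 2 * Real.exp (2 * t) : ℝ) : ℂ) * (2 * (u 2 - w 2) + 3 * (u 1 - w 1) + (u 0 - w 0))
        - ((η ^ 4 * Real.exp (4 * t) : ℝ) : ℂ) * (u 0 - w 0) := by
      simp only [vf]; push_cast; ring
    rw [heq]
    have hb1 : ‖(u 1 - w 1) / 8‖ ≤ d := by
      rw [norm_div]; norm_num
      linarith [hc 1]
    have hb2 : ‖(Real.exp t : ℂ) * (u 0 - w 0)‖ ≤ Real.exp b * d := by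
      rw [norm_mul, Complex.norm_real, Real.norm_eq_abs, abs_of_pos (Real.exp_pos _)]
      exact mul_le_mul he1 (hc 0) (norm_nonneg _) (Real.exp_pos _).le
    have hb3 : ‖((η ^ 2 * Real.exp (2 * t) : ℝ) : ℂ) *
        (2 * (u 2 - w 2) + 3 * (u 1 - w 1) + (u 0 - w 0))‖ ≤ η ^ 2 * Real.exp (2 * b) * (6 * d) := by
      rw [norm_mul, Complex.norm_real, Real.norm_eq_abs, abs_of_nonneg (by positivity)]
      refine mul_le_mul (by gcongr) ?_ (norm_nonneg _) (by positivity)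
      refine (norm_add_le _ _).trans ?_
      refine (add_le_add_left (norm_add_le _ _) _).trans ?_
      rw [norm_mul, norm_mul]
      norm_num
      linarith [hc 0, hc 1, hc 2]
    have hb4 : ‖((η ^ 4 * Real.exp (4 * t) : ℝ) : ℂ) * (u 0 - w 0)‖
        ≤ η ^ 4 * Real.exp (4 * b) * d := by
      rw [norm_mul, Complex.norm_real, Real.norm_eq_abs, abs_of_nonneg (by positivity)]
      exact mul_le_mul (by gcongr) (hc 0) (norm_nonneg _) (by positivity)
    have n1 := norm_sub_le ((u 3 - w 3) + (u 2 - w 2) + (u 1 - w 1) / 8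
        - Real.exp t * (u 0 - w 0)
        + ((η ^ 2 * Real.exp (2 * t) : ℝ) : ℂ) * (2 * (u 2 - w 2) + 3 * (u 1 - w 1) + (u 0 - w 0)))
        (((η ^ 4 * Real.exp (4 * t) : ℝ) : ℂ) * (u 0 - w 0))
    have n2 := norm_add_le ((u 3 - w 3) + (u 2 - w 2) + (u 1 - w 1) / 8
        - Real.exp t * (u 0 - w 0))
        (((η ^ 2 * Real.exp (2 * t) : ℝ) : ℂ) * (2 * (u 2 - w 2) + 3 * (u 1 - w 1) + (u 0 - w 0)))
    have n3 := norm_sub_le ((u 3 - w 3) + (u 2 - w 2) + (u 1 - w 1) / 8)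
        (Real.exp t * (u 0 - w 0))
    have n4 := norm_add_le ((u 3 - w 3) + (u 2 - w 2)) ((u 1 - w 1) / 8)
    have n5 := norm_add_le (u 3 - w 3) (u 2 - w 2)
    linarith [hc 3, hc 2]
  intro i
  fin_cases i
  · simpa [dist_eq_norm] using hlow 1
  · simpa [dist_eq_norm] using hlow 2
  · simpa [dist_eq_norm] using hlow 3
  · simpa [dist_eq_norm] using h3

/-- Solutions that agree at one point of an interval agree on it. -/
lemma IsSol.eqOn (hs : s.OrdConnected) (hU : IsSol η g s U) (hV : IsSol η g s V) {t₀ : ℝ}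
    (ht₀ : t₀ ∈ s) (h : U t₀ = V t₀) : Set.EqOn U V s := by
  intro t ht
  rcases le_total t₀ t with hle | hle
  · have hsub : Set.Icc t₀ t ⊆ s := hs.out ht₀ ht
    obtain ⟨K, hK⟩ := exists_lipschitz η t g
    exact ODE_solution_unique_of_mem_Icc_right
      (v := fun t (u : Fin 4 → ℂ) => (![u 1, u 2, u 3, vf η t u + g t] : Fin 4 → ℂ))
      (s := fun _ => Set.univ) (fun x hx => (hK x hx.2.le).lipschitzOnWith)
      (hU.continuousOn.mono hsub)
      (fun x hx => (hU x (hsub ⟨hx.1, hx.2.le⟩)).hasDerivWithinAt) (fun _ _ => trivial)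
      (hV.continuousOn.mono hsub)
      (fun x hx => (hV x (hsub ⟨hx.1, hx.2.le⟩)).hasDerivWithinAt) (fun _ _ => trivial) h
      ⟨hle, le_rfl⟩
  · have hsub : Set.Icc t t₀ ⊆ s := hs.out ht ht₀
    obtain ⟨K, hK⟩ := exists_lipschitz η t₀ g
    exact ODE_solution_unique_of_mem_Icc_left
      (v := fun t (u : Fin 4 → ℂ) => (![u 1, u 2, u 3, vf η t u + g t] : Fin 4 → ℂ))
      (s := fun _ => Set.univ) (fun x hx => (hK x hx.2).lipschitzOnWith)
      (hU.continuousOn.mono hsub)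
      (fun x hx => (hU x (hsub ⟨hx.1.le, hx.2⟩)).hasDerivWithinAt) (fun _ _ => trivial)
      (hV.continuousOn.mono hsub)
      (fun x hx => (hV x (hsub ⟨hx.1.le, hx.2⟩)).hasDerivWithinAt) (fun _ _ => trivial) h
      ⟨le_rfl, hle⟩

end System

/-- The linear combination of the fundamental solutions with coefficients `c`. -/
def comb (c : Fin 4 → ℂ) (η t : ℝ) : Fin 4 → ℂ := ∑ i, c i • phi i η t

lemma isSol_comb (c : Fin 4 → ℂ) (η : ℝ) : IsSol η 0 Set.univ (comb c η) := by
  have h : ∀ i, IsSol η 0 Set.univ (c i • phi i η) := fun i => by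
    simpa using (isSol_phi i η).smul (c i)
  have h4 := (((h 0).add (h 1)).add (h 2)).add (h 3)
  have : comb c η = c 0 • phi 0 η + c 1 • phi 1 η + c 2 • phi 2 η + c 3 • phi 3 η := by
    funext t
    simp [comb, Fin.sum_univ_four]
  rw [this]
  simpa using h4

lemma lead_strictMono : StrictMono lead := by
  have := beta_bounds
  rw [Fin.strictMono_iff_lt_succ]
  intro i
  fin_cases i <;> simp [lead] <;> linarith

/-- The leading behaviour at `x = 0` of a combination of fundamental solutions. -/
lemma tendsto_comb_atBot (c : Fin 4 → ℂ) (η : ℝ) (i : Fin 4) (hc : ∀ k < i, c k = 0) (j : Fin 4) :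
    Tendsto (fun t => (Real.exp (-(lead i * t)) : ℂ) * comb c η t j) atBot
      (𝓝 (c i * ((lead i ^ (j : ℕ) : ℝ) : ℂ))) := by
  have hk : ∀ k, Tendsto (fun t => (Real.exp (-(lead i * t)) : ℂ) * (c k * phi k η t j)) atBot
      (𝓝 (if k = i then c i * ((lead i ^ (j : ℕ) : ℝ) : ℂ) else 0)) := by
    intro k
    rcases lt_trichotomy k i with h | h | h
    · rw [if_neg h.ne, hc k h]
      simp
    · rw [if_pos h, h]
      refine ((tendsto_phi_atBot i j η).const_mul (c i)).congr fun t => ?_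
      ring
    · rw [if_neg h.ne']
      have h1 := (tendsto_phi_atBot k j η).const_mul (c k)
      have hpos : 0 < lead k - lead i := sub_pos.mpr (lead_strictMono h)
      have h2 : Tendsto (fun t : ℝ => ((Real.exp (t * (lead k - lead i)) : ℝ) : ℂ)) atBot (𝓝 0) := by
        have := Real.tendsto_exp_atBot.comp (tendsto_id.atBot_mul_const hpos)
        have := (Complex.continuous_ofReal.tendsto 0).comp this
        rw [Complex.ofReal_zero] at this
        exact this
      have h3 := h2.mul h1
      rw [zero_mul] at h3
      refine h3.congr fun t => ?_
      rw [show -(lead i * t) = t * (lead k - lead i) + -(lead k * t) by ring, Real.exp_add]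
      push_cast
      ring
  have hsum := tendsto_finsetSum Finset.univ fun k _ => hk k
  simp only [Finset.sum_ite_eq', Finset.mem_univ, if_true] at hsum
  refine hsum.congr fun t => ?_
  rw [← Finset.mul_sum]
  simp [comb]

lemma eq_zero_of_comb_eq_zero {c : Fin 4 → ℂ} {η : ℝ} (h : ∀ t, comb c η t = 0) : c = 0 := by
  have key : ∀ i, (∀ k < i, c k = 0) → c i = 0 := by
    intro i hi
    have h1 := tendsto_comb_atBot c η i hi 0
    simp only [h, Pi.zero_apply, mul_zero] at h1
    simpa using tendsto_nhds_unique h1 tendsto_const_nhds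
  funext i
  induction i using WellFoundedLT.induction with
  | ind i ih => exact key i ih

/-- The fundamental matrix, whose columns are the fundamental solutions. -/
def Phi (η t : ℝ) : Matrix (Fin 4) (Fin 4) ℂ := Matrix.of fun j i => phi i η t j

lemma Phi_mulVec (η t : ℝ) (c : Fin 4 → ℂ) : (Phi η t).mulVec c = comb c η t := by
  funext j
  simp [Matrix.mulVec, dotProduct, Phi, comb, mul_comm]

lemma det_Phi_ne_zero (η t : ℝ) : (Phi η t).det ≠ 0 := by
  intro h
  obtain ⟨c, hc, hc0⟩ := Matrix.exists_mulVec_eq_zero_iff.mpr h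
  rw [Phi_mulVec] at hc0
  have ht := Set.mem_univ t
  have hz : IsSol η 0 Set.univ (0 : ℝ → Fin 4 → ℂ) := by
    simpa using (isSol_comb c η).smul 0
  refine hc (eq_zero_of_comb_eq_zero (η := η) fun t' => ?_)
  exact IsSol.eqOn Set.ordConnected_univ (isSol_comb c η) hz ht hc0 (Set.mem_univ t')

/-- The coordinates of a state in the fundamental system. -/
def coords (η t : ℝ) (u : Fin 4 → ℂ) : Fin 4 → ℂ := (Phi η t)⁻¹.mulVec u

lemma comb_coords (η t : ℝ) (u : Fin 4 → ℂ) : comb (coords η t u) η t = u := by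
  rw [← Phi_mulVec, coords, Matrix.mulVec_mulVec, Matrix.mul_nonsing_inv _
    (isUnit_iff_ne_zero.mpr (det_Phi_ne_zero η t)), Matrix.one_mulVec]

lemma coords_comb (c : Fin 4 → ℂ) (η t : ℝ) : coords η t (comb c η t) = c := by
  rw [← Phi_mulVec, coords, Matrix.mulVec_mulVec, Matrix.nonsing_inv_mul _
    (isUnit_iff_ne_zero.mpr (det_Phi_ne_zero η t)), Matrix.one_mulVec]

lemma continuous_Phi : Continuous fun z : ℝ × ℝ => Phi z.1 z.2 :=
  continuous_matrix fun i j => (continuous_apply i).comp (continuous_phi j)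

lemma continuous_Phi_inv : Continuous fun z : ℝ × ℝ => (Phi z.1 z.2)⁻¹ := by
  simp only [Matrix.inv_def, Ring.inverse_eq_inv']
  exact (continuous_Phi.matrix_det.inv₀ fun z => det_Phi_ne_zero z.1 z.2).smul
    continuous_Phi.matrix_adjugate

lemma continuous_comb : Continuous fun z : (Fin 4 → ℂ) × ℝ × ℝ => comb z.1 z.2.1 z.2.2 := by
  simp only [← Phi_mulVec]
  exact (continuous_Phi.comp continuous_snd).matrix_mulVec continuous_fst

lemma continuous_coords : Continuous fun z : (Fin 4 → ℂ) × ℝ × ℝ => coords z.2.1 z.2.2 z.1 :=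
  (continuous_Phi_inv.comp continuous_snd).matrix_mulVec continuous_fst

lemma comb_add (c d : Fin 4 → ℂ) (η t : ℝ) : comb (c + d) η t = comb c η t + comb d η t := by
  simp only [← Phi_mulVec, Matrix.mulVec_add]

lemma comb_smul (a : ℂ) (c : Fin 4 → ℂ) (η t : ℝ) : comb (a • c) η t = a • comb c η t := by
  simp only [← Phi_mulVec, Matrix.mulVec_smul]

/-- A solution of the homogeneous equation is a combination of the fundamental solutions. -/
lemma IsSol.eq_comb {η : ℝ} {U : ℝ → Fin 4 → ℂ} (hU : IsSol η 0 Set.univ U) (t₀ : ℝ) :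
    U = comb (coords η t₀ (U t₀)) η := by
  funext t
  exact IsSol.eqOn Set.ordConnected_univ hU (isSol_comb _ η) (Set.mem_univ t₀)
    (comb_coords η t₀ (U t₀)).symm (Set.mem_univ t)

/-- The solution with vanishing state at `t = 0`, by variation of constants. -/
def varConst (η : ℝ) (g : ℝ → ℂ) (t : ℝ) : Fin 4 → ℂ :=
  comb (fun i => ∫ s in (0 : ℝ)..t, coords η s ![0, 0, 0, g s] i) η t

lemma continuous_coords_forcing {X : Type*} [TopologicalSpace X] {e s : X → ℝ} {g : X → ℂ}
    (he : Continuous e) (hs : Continuous s) (hg : Continuous g) (i : Fin 4) :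
    Continuous fun x => coords (e x) (s x) ![0, 0, 0, g x] i := by
  have h1 : Continuous fun x => (![0, 0, 0, g x] : Fin 4 → ℂ) := by
    refine continuous_pi fun j => ?_
    fin_cases j <;> simp [continuous_const, hg]
  have h2 : Continuous fun x => coords (e x) (s x) ![0, 0, 0, g x] :=
    Continuous.comp (g := fun z : (Fin 4 → ℂ) × ℝ × ℝ => coords z.2.1 z.2.2 z.1)
      (f := fun x => ((![0, 0, 0, g x] : Fin 4 → ℂ), e x, s x)) continuous_coords
      (h1.prodMk (he.prodMk hs))
  exact continuous_pi_iff.mp h2 i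

lemma isSol_varConst (η : ℝ) {g : ℝ → ℂ} (hg : Continuous g) : IsSol η g Set.univ (varConst η g) := by
  intro t _
  have hcont : ∀ i, Continuous fun s => coords η s ![0, 0, 0, g s] i :=
    continuous_coords_forcing continuous_const continuous_id hg
  have hc : ∀ i, HasDerivAt (fun t => ∫ s in (0 : ℝ)..t, coords η s ![0, 0, 0, g s] i)
      (coords η t ![0, 0, 0, g t] i) t := fun i =>
    intervalIntegral.integral_hasDerivAt_right ((hcont i).intervalIntegrable _ _)
      (hcont i).stronglyMeasurable.stronglyMeasurableAtFilter (hcont i).continuousAt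
  set c : ℝ → Fin 4 → ℂ := fun t i => ∫ s in (0 : ℝ)..t, coords η s ![0, 0, 0, g s] i with hcdef
  have hsum : HasDerivAt (fun t => ∑ i, c t i • phi i η t)
      (∑ i, (c t i • (![phi i η t 1, phi i η t 2, phi i η t 3, vf η t (phi i η t)] : Fin 4 → ℂ)
        + (coords η t ![0, 0, 0, g t] i) • phi i η t)) t := by
    refine HasDerivAt.fun_sum fun i _ => ?_
    have h2 := isSol_phi i η t (Set.mem_univ t)
    simp only [Pi.zero_apply, add_zero] at h2
    exact (hc i).smul h2
  refine hsum.congr_deriv ?_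
  rw [Finset.sum_add_distrib]
  have h1 : ∑ i, (coords η t ![0, 0, 0, g t] i) • phi i η t = ![0, 0, 0, g t] :=
    comb_coords η t _
  have h4 : varConst η g t = ∑ i, c t i • phi i η t := rfl
  have h2 : ∑ i, c t i • (![phi i η t 1, phi i η t 2, phi i η t 3, vf η t (phi i η t)] : Fin 4 → ℂ)
      = ![varConst η g t 1, varConst η g t 2, varConst η g t 3, vf η t (varConst η g t)] := by
    rw [h4]
    generalize c t = d
    simp only [Fin.sum_univ_four, vf_add, vf_smul]
    funext j
    fin_cases j <;> simp
  rw [h1, h2]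
  funext j
  fin_cases j <;> simp

lemma continuous_varConst {Λ : Type*} [TopologicalSpace Λ] {e : Λ → ℝ} (he : Continuous e)
    {g : Λ → ℝ → ℂ} (hg : Continuous fun z : Λ × ℝ => g z.1 z.2) :
    Continuous fun z : Λ × ℝ => varConst (e z.1) (g z.1) z.2 := by
  have h1 : ∀ i : Fin 4, Continuous fun z : Λ × ℝ =>
      ∫ s in (0 : ℝ)..z.2, coords (e z.1) s ![0, 0, 0, g z.1 s] i := by
    intro i
    refine intervalIntegral.continuous_parametric_intervalIntegral_of_continuous
      (f := fun (z : Λ × ℝ) s => coords (e z.1) s ![0, 0, 0, g z.1 s] i) ?_ continuous_snd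
    exact continuous_coords_forcing (X := (Λ × ℝ) × ℝ) (e := fun w => e w.1.1) (s := fun w => w.2)
      (g := fun w => g w.1.1 w.2) (he.comp (continuous_fst.comp continuous_fst)) continuous_snd
      (hg.comp ((continuous_fst.comp continuous_fst).prodMk continuous_snd)) i
  exact continuous_comb.comp ((continuous_pi h1).prodMk
    ((he.comp continuous_fst).prodMk continuous_snd))

/-! ### The energy argument for uniqueness -/

open MeasureTheory in
/-- Testing the homogeneous equation with `v dx / x` shows that a solution without the singular
exponents at `x = 0` and with decay at infinity vanishes. The quantity `E` below is the sum of the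
boundary terms: it is nonincreasing, its limit at `x = 0` is nonpositive, and at infinity it is the
sum of the derivative of an integrable function and of an integrable function. -/
lemma eq_zero_of_energy {η a : ℝ} {a₀ a₁ a₂ a₃ : ℝ → ℝ}
    (h₀ : ∀ t, HasDerivAt a₀ (a₁ t) t) (h₁ : ∀ t, HasDerivAt a₁ (a₂ t) t)
    (h₂ : ∀ t, HasDerivAt a₂ (a₃ t) t)
    (h₃ : ∀ t, HasDerivAt a₃ (a₃ t + a₂ t + a₁ t / 8 - Real.exp t * a₀ t
      + η ^ 2 * Real.exp (2 * t) * (2 * a₂ t + 3 * a₁ t + a₀ t)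
      - η ^ 4 * Real.exp (4 * t) * a₀ t) t)
    (l₀ : Tendsto a₀ atBot (𝓝 a)) (l₁ : Tendsto a₁ atBot (𝓝 0)) (l₂ : Tendsto a₂ atBot (𝓝 0))
    (l₃ : Tendsto a₃ atBot (𝓝 0))
    (hint : IntegrableOn (fun t => Real.exp (2 * t) * (a₀ t ^ 2 + a₁ t ^ 2 + a₂ t ^ 2)) (Set.Ioi 0))
    (t : ℝ) : a₀ t = 0 := by
  set E : ℝ → ℝ := fun t => a₀ t * a₃ t - a₁ t * a₂ t - a₀ t * a₂ t + a₁ t ^ 2 / 2 - a₀ t * a₁ t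
    - a₀ t ^ 2 / 16 - η ^ 2 * (Real.exp (2 * t) * (2 * (a₀ t * a₁ t) + 3 / 2 * a₀ t ^ 2)) with hE
  set Q : ℝ → ℝ := fun t => a₂ t ^ 2 + a₁ t ^ 2 + Real.exp t * a₀ t ^ 2
    + 2 * η ^ 2 * Real.exp (2 * t) * (a₁ t + a₀ t) ^ 2 + η ^ 4 * Real.exp (4 * t) * a₀ t ^ 2 with hQ
  have hQ0 : ∀ t, 0 ≤ Q t := fun t => by positivity
  have hexp : ∀ t : ℝ, HasDerivAt (fun t => Real.exp (2 * t)) (Real.exp (2 * t) * 2) t := fun t => by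
    simpa using ((hasDerivAt_id t).const_mul 2).exp
  have hE' : ∀ t, HasDerivAt E (-Q t) t := by
    intro t
    have d := ((((((h₀ t).mul (h₃ t)).sub ((h₁ t).mul (h₂ t))).sub ((h₀ t).mul (h₂ t))).add
      (((h₁ t).pow 2).div_const 2)).sub ((h₀ t).mul (h₁ t))).sub (((h₀ t).pow 2).div_const 16)
    have d2 := (((hexp t).mul ((((h₀ t).mul (h₁ t)).const_mul 2).add
      (((h₀ t).pow 2).const_mul (3 / 2)))).const_mul (η ^ 2))
    refine (d.sub d2).congr_deriv ?_
    simp only [hQ, Pi.mul_apply, Pi.pow_apply, Pi.add_apply]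
    push_cast
    ring
  have hanti : Antitone E := antitone_of_hasDerivAt_nonpos hE' fun t => neg_nonpos.mpr (hQ0 t)
  have hlim : Tendsto E atBot (𝓝 (-(a ^ 2) / 16)) := by
    have he : Tendsto (fun t : ℝ => Real.exp (2 * t)) atBot (𝓝 0) :=
      Real.tendsto_exp_atBot.comp (tendsto_id.const_mul_atBot two_pos)
    have d := ((((((l₀.mul l₃).sub (l₁.mul l₂)).sub (l₀.mul l₂)).add ((l₁.pow 2).div_const 2)).sub
      (l₀.mul l₁)).sub ((l₀.pow 2).div_const 16)).sub
      ((he.mul (((l₀.mul l₁).const_mul 2).add ((l₀.pow 2).const_mul (3 / 2)))).const_mul (η ^ 2))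
    convert d using 2
    ring
  have hE0 : ∀ t, E t ≤ 0 := by
    intro t
    have h1 : E t ≤ -(a ^ 2) / 16 := by
      refine ge_of_tendsto hlim ?_
      filter_upwards [eventually_le_atBot t] with s hs using hanti hs
    nlinarith [sq_nonneg a]
  by_contra hne
  -- otherwise `E` is constant, hence `Q` vanishes
  obtain ⟨t₂, ht₂⟩ : ∃ t₂, E t₂ < 0 := by
    by_contra! hall
    have hzero : E = fun _ => 0 := funext fun s => le_antisymm (hE0 s) (hall s)
    have h4 := (hE' t).unique (by rw [hzero]; exact hasDerivAt_const t 0)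
    have h5 : 0 < Real.exp t * a₀ t ^ 2 := by positivity
    have h6 : Real.exp t * a₀ t ^ 2 ≤ Q t := by
      simp only [hQ]
      have : 0 ≤ 2 * η ^ 2 * Real.exp (2 * t) * (a₁ t + a₀ t) ^ 2
        + η ^ 4 * Real.exp (4 * t) * a₀ t ^ 2 := by positivity
      nlinarith [sq_nonneg (a₁ t), sq_nonneg (a₂ t)]
    linarith
  set c := -E t₂ with hc
  have hc0 : 0 < c := by rw [hc]; linarith
  set t₃ := max t₂ 0
  set W : ℝ → ℝ := fun t => Real.exp (2 * t) * (a₀ t ^ 2 + a₁ t ^ 2 + a₂ t ^ 2) with hW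
  have hW0 : ∀ t, 0 ≤ W t := fun t => by positivity
  have c₀ : Continuous a₀ := continuous_iff_continuousAt.mpr fun t => (h₀ t).continuousAt
  have c₁ : Continuous a₁ := continuous_iff_continuousAt.mpr fun t => (h₁ t).continuousAt
  have c₂ : Continuous a₂ := continuous_iff_continuousAt.mpr fun t => (h₂ t).continuousAt
  have hWc : Continuous W := by fun_prop
  set C := 4 + 4 * η ^ 2 with hC
  set G : ℝ → ℝ := fun t => a₀ t * a₂ t with hG
  have hsumW : ∀ t, 0 ≤ t → a₀ t ^ 2 + a₁ t ^ 2 + a₂ t ^ 2 ≤ W t := by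
    intro t ht
    have h1 : 1 ≤ Real.exp (2 * t) := Real.one_le_exp (by linarith)
    simp only [hW]
    nlinarith [sq_nonneg (a₀ t), sq_nonneg (a₁ t), sq_nonneg (a₂ t)]
  have hG' : ∀ t, HasDerivAt G (a₁ t * a₂ t + a₀ t * a₃ t) t := fun t => (h₀ t).mul (h₂ t)
  have hGle : ∀ t, t₃ ≤ t → a₁ t * a₂ t + a₀ t * a₃ t ≤ -c + C * W t := by
    intro t ht
    have h1 : E t ≤ -c := by
      rw [hc, neg_neg]
      exact hanti ((le_max_left _ _).trans ht)
    have h2 := hsumW t ((le_max_right _ _).trans ht)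
    have h3 : a₁ t * a₂ t + a₀ t * a₃ t = E t + (2 * (a₁ t * a₂ t) + a₀ t * a₂ t - a₁ t ^ 2 / 2
        + a₀ t * a₁ t + a₀ t ^ 2 / 16)
        + η ^ 2 * (Real.exp (2 * t) * (2 * (a₀ t * a₁ t) + 3 / 2 * a₀ t ^ 2)) := by
      simp only [hE]; ring
    have h4 : 2 * (a₁ t * a₂ t) + a₀ t * a₂ t - a₁ t ^ 2 / 2
        + a₀ t * a₁ t + a₀ t ^ 2 / 16 ≤ 4 * (a₀ t ^ 2 + a₁ t ^ 2 + a₂ t ^ 2) := by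
      nlinarith [sq_nonneg (a₁ t - a₂ t), sq_nonneg (a₀ t - a₂ t), sq_nonneg (a₀ t - a₁ t)]
    have h5 : Real.exp (2 * t) * (2 * (a₀ t * a₁ t) + 3 / 2 * a₀ t ^ 2) ≤ 4 * W t := by
      have h7 : 2 * (a₀ t * a₁ t) + 3 / 2 * a₀ t ^ 2 ≤ 4 * (a₀ t ^ 2 + a₁ t ^ 2 + a₂ t ^ 2) := by
        nlinarith [sq_nonneg (a₀ t - a₁ t), sq_nonneg (a₂ t), sq_nonneg (a₀ t), sq_nonneg (a₁ t)]
      have h8 := mul_le_mul_of_nonneg_left h7 (Real.exp_pos (2 * t)).le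
      simp only [hW]
      linarith
    have h6 := mul_le_mul_of_nonneg_left h5 (sq_nonneg η)
    rw [h3, hC]
    nlinarith
  set K : ℝ → ℝ := fun t => G t + c * t - C * ∫ s in t₃..t, W s with hK
  have hK' : ∀ t, HasDerivAt K (a₁ t * a₂ t + a₀ t * a₃ t + c - C * W t) t := by
    intro t
    have h1 := intervalIntegral.integral_hasDerivAt_right (hWc.intervalIntegrable t₃ t)
      hWc.stronglyMeasurable.stronglyMeasurableAtFilter hWc.continuousAt
    have h2 : HasDerivAt (fun t => c * t) c t := by simpa using (hasDerivAt_id t).const_mul c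
    exact ((hG' t).add h2).sub (h1.const_mul C)
  have hKanti : AntitoneOn K (Set.Ici t₃) := by
    refine antitoneOn_of_deriv_nonpos (convex_Ici t₃)
      (fun t _ => (hK' t).continuousAt.continuousWithinAt)
      (fun t _ => (hK' t).differentiableAt.differentiableWithinAt) fun t ht => ?_
    rw [interior_Ici] at ht
    rw [(hK' t).deriv]
    linarith [hGle t (le_of_lt ht)]
  have hint3 : IntegrableOn W (Set.Ioi t₃) :=
    hint.mono_set (Set.Ioi_subset_Ioi (le_max_right _ _))
  set I := ∫ s in Set.Ioi t₃, W s
  have hI : ∀ t, t₃ ≤ t → ∫ s in t₃..t, W s ≤ I := by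
    intro t ht
    rw [intervalIntegral.integral_of_le ht]
    exact setIntegral_mono_set hint3 (Eventually.of_forall hW0) Set.Ioc_subset_Ioi_self.eventuallyLE
  have hC0 : 0 ≤ C := by positivity
  have hGbound : ∀ t, t₃ ≤ t → G t ≤ K t₃ - c * t + C * I := by
    intro t ht
    have h1 := hKanti (Set.self_mem_Ici) ht ht
    have h2 := mul_le_mul_of_nonneg_left (hI t ht) hC0
    simp only [hK] at h1 ⊢
    linarith
  set t₄ := max t₃ ((K t₃ + C * I + 1) / c)
  have hW1 : ∀ t ∈ Set.Ioi t₄, 1 ≤ W t := by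
    intro t ht
    have h1 : t₃ ≤ t := (le_max_left _ _).trans (le_of_lt ht)
    have h2 : (K t₃ + C * I + 1) / c ≤ t := (le_max_right _ _).trans (le_of_lt ht)
    rw [div_le_iff₀ hc0] at h2
    have h3 := hGbound t h1
    have h4 := hsumW t ((le_max_right _ _).trans h1)
    simp only [hG] at h3
    nlinarith [sq_nonneg (a₀ t + a₂ t), sq_nonneg (a₁ t)]
  have hconst : IntegrableOn (fun _ : ℝ => (1 : ℝ)) (Set.Ioi t₄) := by
    refine Integrable.mono' (hint3.mono_set (Set.Ioi_subset_Ioi (le_max_left _ _)))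
      aestronglyMeasurable_const ?_
    filter_upwards [ae_restrict_mem measurableSet_Ioi] with s hs
    simpa using hW1 s hs
  rw [integrableOn_const_iff] at hconst
  simp at hconst

open MeasureTheory in
/-- A combination of the two regular fundamental solutions that decays at infinity is trivial. -/
lemma comb_eq_zero_of_decay {c : Fin 4 → ℂ} {η : ℝ} (h0 : c 0 = 0) (h1 : c 1 = 0)
    (hint : IntegrableOn (fun t => Real.exp (2 * t) * (‖comb c η t 0‖ ^ 2 + ‖comb c η t 1‖ ^ 2
      + ‖comb c η t 2‖ ^ 2)) (Set.Ioi 0)) : c = 0 := by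
  have hsol := isSol_iff.mp (isSol_comb c η)
  have hlim : ∀ j : Fin 4, Tendsto (fun t => comb c η t j) atBot
      (𝓝 (c 2 * (((0 : ℝ) ^ (j : ℕ) : ℝ) : ℂ))) := by
    intro j
    have h := tendsto_comb_atBot c η 2 (fun k hk => by fin_cases k <;> simp_all) j
    simpa [lead] using h
  have hcontj : ∀ j : Fin 4, Continuous fun t => comb c η t j := fun j =>
    (continuous_apply j).comp (continuous_iff_continuousAt.mpr fun t =>
      (isSol_comb c η t trivial).continuousAt)
  -- the real and the imaginary part are treated alike
  have key : ∀ L : ℂ →L[ℝ] ℝ, (∀ z, |L z| ≤ ‖z‖) → (∀ t, L (comb c η t 0) = 0) := by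
    intro L hL
    have hd : ∀ j k : Fin 4, (∀ t, HasDerivAt (fun t => comb c η t j) (comb c η t k) t) →
        ∀ t, HasDerivAt (fun t => L (comb c η t j)) (L (comb c η t k)) t :=
      fun j k h t => L.hasFDerivAt.comp_hasDerivAt t (h t)
    have hr : ∀ (x : ℝ) (z : ℂ), L ((x : ℂ) * z) = x * L z := by
      intro x z
      rw [← Complex.real_smul, map_smul, smul_eq_mul]
    have hl : ∀ j : Fin 4, Tendsto (fun t => L (comb c η t j)) atBot
      (𝓝 (L (c 2 * (((0 : ℝ) ^ (j : ℕ) : ℝ) : ℂ)))) := fun j =>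
        (L.continuous.tendsto _).comp (hlim j)
    refine eq_zero_of_energy (η := η) (a := L (c 2)) (hd 0 1 fun t => (hsol t trivial).1)
      (hd 1 2 fun t => (hsol t trivial).2.1) (hd 2 3 fun t => (hsol t trivial).2.2.1) ?_
      (by simpa using hl 0) (by simpa using hl 1) (by simpa using hl 2) (by simpa using hl 3) ?_
    · intro t
      refine (L.hasFDerivAt.comp_hasDerivAt t (hsol t trivial).2.2.2).congr_deriv ?_
      have : vf η t (comb c η t) + (0 : ℝ → ℂ) t = comb c η t 3 + comb c η t 2
          + ((1 / 8 : ℝ) : ℂ) * comb c η t 1 - ((Real.exp t : ℝ) : ℂ) * comb c η t 0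
          + ((η ^ 2 * Real.exp (2 * t) : ℝ) : ℂ) * (((2 : ℝ) : ℂ) * comb c η t 2
            + ((3 : ℝ) : ℂ) * comb c η t 1 + comb c η t 0)
          - ((η ^ 4 * Real.exp (4 * t) : ℝ) : ℂ) * comb c η t 0 := by
        simp only [vf, Pi.zero_apply]
        push_cast
        ring
      rw [this]
      simp only [map_add, map_sub, hr]
      ring
    · refine Integrable.mono' hint ?_ ?_
      · have := fun j => L.continuous.comp (hcontj j)
        simp only [Function.comp_def] at this
        have h0 := this 0
        have h1 := this 1
        have h2 := this 2
        exact Continuous.aestronglyMeasurable (by fun_prop)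
      · refine Eventually.of_forall fun t => ?_
        rw [Real.norm_eq_abs, abs_of_nonneg (by positivity)]
        have hs : ∀ z, L z ^ 2 ≤ ‖z‖ ^ 2 := fun z => by
          rw [← sq_abs (L z)]
          exact pow_le_pow_left₀ (abs_nonneg _) (hL z) 2
        exact mul_le_mul_of_nonneg_left (add_le_add (add_le_add (hs _) (hs _)) (hs _))
          (Real.exp_pos _).le
  have hzero : ∀ t, comb c η t 0 = 0 := by
    intro t
    refine Complex.ext ?_ ?_
    · exact key Complex.reCLM Complex.abs_re_le_norm t
    · exact key Complex.imCLM Complex.abs_im_le_norm t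
  -- all further components vanish as well, since they are derivatives
  have hz1 : ∀ t, comb c η t 1 = 0 := fun t =>
    (hsol t trivial).1.unique (by simp only [hzero]; exact hasDerivAt_const t 0)
  have hz2 : ∀ t, comb c η t 2 = 0 := fun t =>
    (hsol t trivial).2.1.unique (by simp only [hz1]; exact hasDerivAt_const t 0)
  have hz3 : ∀ t, comb c η t 3 = 0 := fun t =>
    (hsol t trivial).2.2.1.unique (by simp only [hz2]; exact hasDerivAt_const t 0)
  refine eq_zero_of_comb_eq_zero (η := η) fun t => ?_
  funext j
  fin_cases j
  · exact hzero t
  · exact hz1 t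
  · exact hz2 t
  · exact hz3 t

open MeasureTheory in
/-- A function that behaves like `L x ^ τ` at `x = 0` with `τ ≤ -δ` is not square integrable with
respect to `x ^ (2 δ) dx / x` unless `L = 0`. -/
lemma eq_zero_of_lintegral_lt_top {f : ℝ → ℂ} {τ δ : ℝ} {L : ℂ} (hτ : τ + δ ≤ 0)
    (h : Tendsto (fun t => (Real.exp (-(τ * t)) : ℂ) * f t) atBot (𝓝 L))
    (hint : ∫⁻ t in Set.Iio (0 : ℝ), ENNReal.ofReal (Real.exp (2 * δ * t) * ‖f t‖ ^ 2) < ⊤) :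
    L = 0 := by
  by_contra hL
  have hL0 : 0 < ‖L‖ := norm_pos_iff.mpr hL
  have hev := h.norm.eventually_const_lt (show ‖L‖ / 2 < ‖L‖ by linarith)
  obtain ⟨T, hT⟩ := eventually_atBot.mp (hev.and (eventually_le_atBot (-1)))
  have hge : ∀ t ∈ Set.Iic T, ENNReal.ofReal (‖L‖ ^ 2 / 4)
      ≤ ENNReal.ofReal (Real.exp (2 * δ * t) * ‖f t‖ ^ 2) := by
    intro t ht
    obtain ⟨h1, h2⟩ := hT t ht
    refine ENNReal.ofReal_le_ofReal ?_
    rw [norm_mul, Complex.norm_real, Real.norm_eq_abs, abs_of_pos (Real.exp_pos _)] at h1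
    have h3 : (‖L‖ / 2) ^ 2 ≤ (Real.exp (-(τ * t)) * ‖f t‖) ^ 2 :=
      pow_le_pow_left₀ (by positivity) h1.le 2
    have h4 : Real.exp (-(τ * t)) ^ 2 ≤ Real.exp (2 * δ * t) := by
      rw [← Real.exp_nat_mul, Real.exp_le_exp]
      push_cast
      nlinarith
    rw [mul_pow] at h3
    have h5 := mul_le_mul_of_nonneg_right h4 (sq_nonneg ‖f t‖)
    linarith
  have hsub : Set.Iic T ⊆ Set.Iio 0 := by
    intro t ht
    have := (hT t ht).2
    simp only [Set.mem_Iio]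
    linarith
  have h1 : ∫⁻ _ in Set.Iic T, ENNReal.ofReal (‖L‖ ^ 2 / 4)
      ≤ ∫⁻ t in Set.Iio (0 : ℝ), ENNReal.ofReal (Real.exp (2 * δ * t) * ‖f t‖ ^ 2) :=
    (setLIntegral_mono' measurableSet_Iic hge).trans (lintegral_mono_set hsub)
  have h2 := h1.trans_lt hint
  rw [setLIntegral_const, Real.volume_Iic, ENNReal.mul_top] at h2
  · exact lt_irrefl _ h2
  · rw [Ne, ENNReal.ofReal_eq_zero, not_le]
    positivity

open MeasureTheory in
/-- Square integrability at `x = 0` excludes the two singular fundamental solutions. -/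
lemma comb_singular_eq_zero {c : Fin 4 → ℂ} {η δ : ℝ} (hδ : δ < 1 / 10)
    (hint : ∫⁻ t in Set.Iio (0 : ℝ), ENNReal.ofReal (Real.exp (2 * δ * t) * ‖comb c η t 0‖ ^ 2) < ⊤) :
    c 0 = 0 ∧ c 1 = 0 := by
  have hb := beta_bounds
  have h0 : c 0 = 0 := by
    have h := tendsto_comb_atBot c η 0 (fun k hk => absurd hk (by simp)) 0
    have := eq_zero_of_lintegral_lt_top (δ := δ) (by simp [lead]; linarith) h hint
    simpa using this
  have h1 : c 1 = 0 := by
    have h := tendsto_comb_atBot c η 1 (fun k hk => by fin_cases k <;> simp_all) 0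
    have := eq_zero_of_lintegral_lt_top (δ := δ) (by simp [lead]; linarith) h hint
    simpa using this
  exact ⟨h0, h1⟩

/-! ### Decaying solutions of small perturbations of a constant-coefficient equation -/

section Outer

open MeasureTheory
open scoped BoundedContinuousFunction

lemma norm_cexp_ofReal_mul (μ : ℂ) (s : ℝ) : ‖Complex.exp (μ * s)‖ = Real.exp (μ.re * s) := by
  rw [Complex.norm_exp]
  simp

lemma integrableOn_exp_mul_bounded {μ : ℂ} (hμ : 0 < μ.re) (G : ℝ →ᵇ ℂ) (y : ℝ) :
    IntegrableOn (fun s : ℝ => Complex.exp (-μ * s) * G s) (Set.Ioi y) := by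
  have h1 : IntegrableOn (fun s : ℝ => Real.exp (-μ.re * s) * ‖G‖) (Set.Ioi y) :=
    (integrableOn_exp_mul_Ioi (by linarith) y).mul_const _
  refine Integrable.mono' h1 (Continuous.aestronglyMeasurable (by fun_prop)) ?_
  refine Eventually.of_forall fun s => ?_
  rw [norm_mul, norm_cexp_ofReal_mul]
  exact mul_le_mul_of_nonneg_left (G.norm_coe_le_norm s) (Real.exp_pos _).le

/-- The bounded solution of `W' = μ W + G` for `0 < Re μ`. -/
def tailFun (μ : ℂ) (G : ℝ →ᵇ ℂ) (y : ℝ) : ℂ :=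
  -Complex.exp (μ * y) * ∫ s in Set.Ioi y, Complex.exp (-μ * s) * G s

lemma hasDerivAt_cexp_mul (μ : ℂ) (y : ℝ) :
    HasDerivAt (fun y : ℝ => Complex.exp (μ * y)) (μ * Complex.exp (μ * y)) y := by
  have h1 : HasDerivAt (fun y : ℝ => μ * (y : ℂ)) μ y := by
    simpa using (Complex.ofRealCLM.hasDerivAt (x := y)).const_mul μ
  exact h1.cexp.congr_deriv (mul_comm _ _)

lemma hasDerivAt_tailFun {μ : ℂ} (hμ : 0 < μ.re) (G : ℝ →ᵇ ℂ) (y : ℝ) :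
    HasDerivAt (tailFun μ G) (μ * tailFun μ G y + G y) y := by
  have hc : Continuous fun s : ℝ => Complex.exp (-μ * s) * G s := by fun_prop
  have h1 : (fun y : ℝ => ∫ s in Set.Ioi y, Complex.exp (-μ * s) * G s) = fun y : ℝ =>
      (∫ s in Set.Ioi (0 : ℝ), Complex.exp (-μ * s) * G s) - ∫ s in (0 : ℝ)..y, Complex.exp (-μ * s) * G s := by
    funext y
    rw [← intervalIntegral.integral_interval_add_Ioi (integrableOn_exp_mul_bounded hμ G 0)
      (integrableOn_exp_mul_bounded hμ G y), add_sub_cancel_left]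
  have h2 : HasDerivAt (fun y : ℝ => ∫ s in Set.Ioi y, Complex.exp (-μ * s) * G s)
      (-(Complex.exp (-μ * y) * G y)) y := by
    rw [h1]
    exact (intervalIntegral.integral_hasDerivAt_right (hc.intervalIntegrable _ _)
      hc.stronglyMeasurable.stronglyMeasurableAtFilter hc.continuousAt).const_sub _
  refine ((hasDerivAt_cexp_mul μ y).neg.mul h2).congr_deriv ?_
  have h3 : Complex.exp (μ * y) * Complex.exp (-μ * y) = 1 := by
    rw [← Complex.exp_add]; simp
  simp only [tailFun, Pi.neg_apply]
  linear_combination (G y) * h3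

lemma norm_tailFun_le {μ : ℂ} (hμ : 0 < μ.re) (G : ℝ →ᵇ ℂ) (y : ℝ) :
    ‖tailFun μ G y‖ ≤ 1 / μ.re * ‖G‖ := by
  have h1 : ‖∫ s in Set.Ioi y, Complex.exp (-μ * s) * G s‖
      ≤ ∫ s in Set.Ioi y, Real.exp (-μ.re * s) * ‖G‖ := by
    refine norm_integral_le_of_norm_le ((integrableOn_exp_mul_Ioi (by linarith) y).mul_const _)
      (Eventually.of_forall fun s => ?_)
    rw [norm_mul, norm_cexp_ofReal_mul]
    exact mul_le_mul_of_nonneg_left (G.norm_coe_le_norm s) (Real.exp_pos _).le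
  rw [integral_mul_const, integral_exp_mul_Ioi (by linarith)] at h1
  rw [tailFun, norm_mul, norm_neg, norm_cexp_ofReal_mul]
  have h2 := mul_le_mul_of_nonneg_left h1 (Real.exp_pos (μ.re * y)).le
  refine h2.trans (le_of_eq ?_)
  rw [neg_mul]
  have h3 : Real.exp (μ.re * y) * Real.exp (-(μ.re * y)) = 1 := by
    rw [← Real.exp_add]; simp
  field_simp
  linear_combination ‖G‖ * h3

/-- The solution operator of `W' = μ W + G` in the bounded continuous functions. -/
def tailOp (μ : ℂ) (hμ : 0 < μ.re) : (ℝ →ᵇ ℂ) →L[ℂ] (ℝ →ᵇ ℂ) :=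
  LinearMap.mkContinuous
    { toFun := fun G => BoundedContinuousFunction.ofNormedAddCommGroup (tailFun μ G)
        (continuous_iff_continuousAt.mpr fun y => (hasDerivAt_tailFun hμ G y).continuousAt)
        (1 / μ.re * ‖G‖) (norm_tailFun_le hμ G)
      map_add' := fun G H => by
        ext y
        simp only [BoundedContinuousFunction.coe_ofNormedAddCommGroup,
          BoundedContinuousFunction.coe_add, Pi.add_apply, tailFun, mul_add]
        rw [integral_add (integrableOn_exp_mul_bounded hμ G y) (integrableOn_exp_mul_bounded hμ H y)]
        ring
      map_smul' := fun c G => by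
        ext y
        simp only [BoundedContinuousFunction.coe_ofNormedAddCommGroup,
          BoundedContinuousFunction.coe_smul, tailFun, smul_eq_mul, RingHom.id_apply]
        rw [show (fun s : ℝ => Complex.exp (-μ * s) * (c * G s))
          = fun s : ℝ => c * (Complex.exp (-μ * s) * G s) by funext s; ring, integral_const_mul]
        ring }
    (1 / μ.re) fun G => by
      rw [BoundedContinuousFunction.norm_le (by positivity)]
      exact norm_tailFun_le hμ G

lemma norm_tailOp_le (μ : ℂ) (hμ : 0 < μ.re) : ‖tailOp μ hμ‖ ≤ 1 / μ.re :=
  LinearMap.mkContinuous_norm_le _ (by positivity) _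

lemma hasDerivAt_tailOp (μ : ℂ) (hμ : 0 < μ.re) (G : ℝ →ᵇ ℂ) (y : ℝ) :
    HasDerivAt (tailOp μ hμ G) (μ * tailOp μ hμ G y + G y) y :=
  hasDerivAt_tailFun hμ G y

/-- The solution of `W' = -μ W + G` on `(X, ∞)` that vanishes at `X`, extended by `0`. -/
def headFun (μ : ℂ) (X : ℝ) (G : ℝ →ᵇ ℂ) (y : ℝ) : ℂ :=
  Complex.exp (-μ * (max y X : ℝ)) * ∫ s in X..max y X, Complex.exp (μ * s) * G s

lemma hasDerivAt_headFun_aux (μ : ℂ) (X : ℝ) (G : ℝ →ᵇ ℂ) (y : ℝ) :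
    HasDerivAt (fun y : ℝ => Complex.exp (-μ * y) * ∫ s in X..y, Complex.exp (μ * s) * G s)
      (-μ * (Complex.exp (-μ * y) * ∫ s in X..y, Complex.exp (μ * s) * G s) + G y) y := by
  have hc : Continuous fun s : ℝ => Complex.exp (μ * s) * G s := by fun_prop
  refine ((hasDerivAt_cexp_mul (-μ) y).mul (intervalIntegral.integral_hasDerivAt_right
    (hc.intervalIntegrable X y) hc.stronglyMeasurable.stronglyMeasurableAtFilter
    hc.continuousAt)).congr_deriv ?_
  have h3 : Complex.exp (-μ * y) * Complex.exp (μ * y) = 1 := by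
    rw [← Complex.exp_add]; simp
  linear_combination (G y) * h3

lemma continuous_headFun (μ : ℂ) (X : ℝ) (G : ℝ →ᵇ ℂ) : Continuous (headFun μ X G) :=
  (continuous_iff_continuousAt.mpr fun y =>
    (hasDerivAt_headFun_aux μ X G y).continuousAt).comp (continuous_id.max continuous_const)

lemma norm_headFun_le {μ : ℂ} (hμ : 0 < μ.re) (X : ℝ) (G : ℝ →ᵇ ℂ) (y : ℝ) :
    ‖headFun μ X G y‖ ≤ 1 / μ.re * ‖G‖ := by
  set Y := max y X
  have hY : X ≤ Y := le_max_right _ _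
  have hd : ∀ s : ℝ, HasDerivAt (fun s : ℝ => Real.exp (μ.re * s) / μ.re * ‖G‖)
      (Real.exp (μ.re * s) * ‖G‖) s := by
    intro s
    have h1 : HasDerivAt (fun s : ℝ => μ.re * s) μ.re s := by
      simpa using (hasDerivAt_id s).const_mul μ.re
    refine ((h1.exp.div_const μ.re).mul_const ‖G‖).congr_deriv ?_
    field_simp
  have hci : Continuous fun s : ℝ => Real.exp (μ.re * s) * ‖G‖ := by fun_prop
  have h1 : ‖∫ s in X..Y, Complex.exp (μ * s) * G s‖ ≤ ∫ s in X..Y, Real.exp (μ.re * s) * ‖G‖ := by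
    refine intervalIntegral.norm_integral_le_of_norm_le hY (Eventually.of_forall fun s _ => ?_)
      (hci.intervalIntegrable _ _)
    rw [norm_mul, norm_cexp_ofReal_mul]
    exact mul_le_mul_of_nonneg_left (G.norm_coe_le_norm s) (Real.exp_pos _).le
  rw [intervalIntegral.integral_eq_sub_of_hasDerivAt (fun s _ => hd s)
    (hci.intervalIntegrable _ _)] at h1
  have h2 : 0 ≤ Real.exp (μ.re * X) / μ.re * ‖G‖ := by positivity
  have h4 : ‖headFun μ X G y‖
      = Real.exp (-μ.re * Y) * ‖∫ s in X..Y, Complex.exp (μ * s) * G s‖ := by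
    rw [headFun, norm_mul, norm_cexp_ofReal_mul, Complex.neg_re]
  rw [h4]
  refine (mul_le_mul_of_nonneg_left (h1.trans (sub_le_self _ h2)) (Real.exp_pos _).le).trans
    (le_of_eq ?_)
  rw [neg_mul]
  have h3 : Real.exp (-(μ.re * Y)) * Real.exp (μ.re * Y) = 1 := by
    rw [← Real.exp_add]; simp
  field_simp
  linear_combination ‖G‖ * h3

/-- The solution operator of `W' = -μ W + G`, `W X = 0`, in the bounded continuous functions. -/
def headOp (μ : ℂ) (hμ : 0 < μ.re) (X : ℝ) : (ℝ →ᵇ ℂ) →L[ℂ] (ℝ →ᵇ ℂ) :=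
  LinearMap.mkContinuous
    { toFun := fun G => BoundedContinuousFunction.ofNormedAddCommGroup (headFun μ X G)
        (continuous_headFun μ X G) (1 / μ.re * ‖G‖) (norm_headFun_le hμ X G)
      map_add' := fun G H => by
        ext y
        have hc : ∀ G : ℝ →ᵇ ℂ, Continuous fun s : ℝ => Complex.exp (μ * s) * G s := fun G => by
          fun_prop
        simp only [BoundedContinuousFunction.coe_ofNormedAddCommGroup,
          BoundedContinuousFunction.coe_add, Pi.add_apply, headFun, mul_add]
        rw [intervalIntegral.integral_add ((hc G).intervalIntegrable _ _)
          ((hc H).intervalIntegrable _ _)]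
        ring
      map_smul' := fun c G => by
        ext y
        simp only [BoundedContinuousFunction.coe_ofNormedAddCommGroup,
          BoundedContinuousFunction.coe_smul, headFun, smul_eq_mul, RingHom.id_apply]
        rw [show (fun s : ℝ => Complex.exp (μ * s) * (c * G s))
          = fun s : ℝ => c * (Complex.exp (μ * s) * G s) by funext s; ring,
          intervalIntegral.integral_const_mul]
        ring }
    (1 / μ.re) fun G => by
      rw [BoundedContinuousFunction.norm_le (by positivity)]
      exact norm_headFun_le hμ X G

lemma norm_headOp_le (μ : ℂ) (hμ : 0 < μ.re) (X : ℝ) : ‖headOp μ hμ X‖ ≤ 1 / μ.re :=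
  LinearMap.mkContinuous_norm_le _ (by positivity) _

lemma headOp_self (μ : ℂ) (hμ : 0 < μ.re) (X : ℝ) (G : ℝ →ᵇ ℂ) : headOp μ hμ X G X = 0 := by
  change headFun μ X G X = 0
  simp [headFun]

lemma eventually_max_eq {X y : ℝ} (hy : X < y) : ∀ᶠ z in 𝓝 y, max z X = z := by
  filter_upwards [lt_mem_nhds hy] with z hz
  exact max_eq_left hz.le

lemma hasDerivAt_headOp (μ : ℂ) (hμ : 0 < μ.re) (X : ℝ) (G : ℝ →ᵇ ℂ) {y : ℝ} (hy : X < y) :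
    HasDerivAt (headOp μ hμ X G) (-μ * headOp μ hμ X G y + G y) y := by
  have h1 : (headOp μ hμ X G : ℝ → ℂ) =ᶠ[𝓝 y]
      fun y : ℝ => Complex.exp (-μ * y) * ∫ s in X..y, Complex.exp (μ * s) * G s := by
    filter_upwards [eventually_max_eq hy] with z hz
    change headFun μ X G z = _
    rw [headFun, hz]
  rw [h1.eq_of_nhds]
  exact (hasDerivAt_headFun_aux μ X G y).congr_of_eventuallyEq h1

/-- The solution of `W' = -μ W` on `(X, ∞)` with `W X = 1`, extended by `1`. -/
def headExp (μ : ℂ) (hμ : 0 < μ.re) (X : ℝ) : ℝ →ᵇ ℂ :=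
  BoundedContinuousFunction.ofNormedAddCommGroup
    (fun y => Complex.exp (-μ * (max y X - X : ℝ))) (by fun_prop) 1 fun y => by
      rw [norm_cexp_ofReal_mul, Real.exp_le_one_iff, Complex.neg_re, neg_mul, neg_nonpos]
      exact mul_nonneg hμ.le (sub_nonneg.mpr (le_max_right _ _))

lemma headExp_self (μ : ℂ) (hμ : 0 < μ.re) (X : ℝ) : headExp μ hμ X X = 1 := by
  simp [headExp]

lemma hasDerivAt_headExp (μ : ℂ) (hμ : 0 < μ.re) (X : ℝ) {y : ℝ} (hy : X < y) :
    HasDerivAt (headExp μ hμ X) (-μ * headExp μ hμ X y) y := by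
  have h1 : (headExp μ hμ X : ℝ → ℂ) =ᶠ[𝓝 y]
      fun y : ℝ => Complex.exp (μ * X) * Complex.exp (-μ * y) := by
    filter_upwards [eventually_max_eq hy] with z hz
    change Complex.exp (-μ * (max z X - X : ℝ)) = _
    rw [hz, ← Complex.exp_add]
    congr 1
    push_cast
    ring
  rw [h1.eq_of_nhds]
  refine (((hasDerivAt_cexp_mul (-μ) y).const_mul _).congr_of_eventuallyEq h1).congr_deriv ?_
  ring

/-- Let `D j` be the bounded functions `e ^ (ν y) v^(j)`. This relation says that, for `y > X`,
`v'''' = (λ₁² + λ₂²) v'' - λ₁² λ₂² v - ∑ p j v^(j) + e ^ (-ν y) F`. -/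
def OuterRel (l₁ l₂ : ℂ) (ν X : ℝ) (p : Fin 4 → ℝ →ᵇ ℂ) (F : ℝ →ᵇ ℂ) (D : Fin 4 → ℝ →ᵇ ℂ) : Prop :=
  ∀ y, X < y → HasDerivAt (D 0) (ν * D 0 y + D 1 y) y ∧ HasDerivAt (D 1) (ν * D 1 y + D 2 y) y ∧
    HasDerivAt (D 2) (ν * D 2 y + D 3 y) y ∧
    HasDerivAt (D 3) (ν * D 3 y + ((l₁ ^ 2 + l₂ ^ 2) * D 2 y - l₁ ^ 2 * l₂ ^ 2 * D 0 y
      - (p 0 y * D 0 y + p 1 y * D 1 y + p 2 y * D 2 y + p 3 y * D 3 y) + F y)) y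

/-- The derivatives of `v` in terms of the partial factorisations of
`(D - λ₂) (D - λ₁) (D + λ₂) (D + λ₁) v`. -/
def unfactor {E : Type*} [AddCommGroup E] [Module ℂ E] (l₁ l₂ : ℂ) (W : Fin 4 → E) : Fin 4 → E :=
  ![W 0, W 1 - l₁ • W 0, W 2 - (l₁ + l₂) • W 1 + l₁ ^ 2 • W 0,
    W 3 - l₂ • W 2 + (l₁ ^ 2 + l₁ * l₂ + l₂ ^ 2) • W 1 - l₁ ^ 3 • W 0]

lemma outerRel_unfactor {l₁ l₂ : ℂ} {ν X : ℝ} {p : Fin 4 → ℝ →ᵇ ℂ} {F G : ℝ →ᵇ ℂ}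
    {W : Fin 4 → ℝ →ᵇ ℂ}
    (h0 : ∀ y, X < y → HasDerivAt (W 0) (-(l₁ - ν) * W 0 y + W 1 y) y)
    (h1 : ∀ y, X < y → HasDerivAt (W 1) (-(l₂ - ν) * W 1 y + W 2 y) y)
    (h2 : ∀ y, X < y → HasDerivAt (W 2) ((l₁ + ν) * W 2 y + W 3 y) y)
    (h3 : ∀ y, X < y → HasDerivAt (W 3) ((l₂ + ν) * W 3 y + G y) y)
    (hG : G + ∑ j, p j * unfactor l₁ l₂ W j = F) :
    OuterRel l₁ l₂ ν X p F (unfactor l₁ l₂ W) := by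
  intro y hy
  have hG' := DFunLike.congr_fun hG y
  simp only [Fin.sum_univ_four, BoundedContinuousFunction.coe_add, Pi.add_apply,
    BoundedContinuousFunction.coe_mul, Pi.mul_apply] at hG'
  set D := unfactor l₁ l₂ W with hD
  have e0 : D 0 = W 0 := rfl
  have e1 : D 1 = W 1 - l₁ • W 0 := rfl
  have e2 : D 2 = W 2 - (l₁ + l₂) • W 1 + l₁ ^ 2 • W 0 := rfl
  have e3 : D 3 = W 3 - l₂ • W 2 + (l₁ ^ 2 + l₁ * l₂ + l₂ ^ 2) • W 1 - l₁ ^ 3 • W 0 := rfl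
  replace h0 := h0 y hy
  replace h1 := h1 y hy
  replace h2 := h2 y hy
  replace h3 := h3 y hy
  refine ⟨?_, ?_, ?_, ?_⟩
  · rw [e0, e1]
    refine h0.congr_deriv ?_
    simp only [BoundedContinuousFunction.coe_sub, BoundedContinuousFunction.coe_smul, Pi.sub_apply,
      smul_eq_mul]
    ring
  · rw [e1, e2]
    refine (h1.sub (h0.const_mul l₁)).congr_deriv ?_
    simp only [BoundedContinuousFunction.coe_sub, BoundedContinuousFunction.coe_smul, Pi.sub_apply,
      BoundedContinuousFunction.coe_add, Pi.add_apply, smul_eq_mul]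
    ring
  · rw [e2, e3]
    refine ((h2.sub (h1.const_mul (l₁ + l₂))).add (h0.const_mul (l₁ ^ 2))).congr_deriv ?_
    simp only [BoundedContinuousFunction.coe_sub, BoundedContinuousFunction.coe_smul, Pi.sub_apply,
      BoundedContinuousFunction.coe_add, Pi.add_apply, smul_eq_mul]
    ring
  · have h4 := ((h3.sub (h2.const_mul l₂)).add
      (h1.const_mul (l₁ ^ 2 + l₁ * l₂ + l₂ ^ 2))).sub (h0.const_mul (l₁ ^ 3))
    refine (h4.congr_of_eventuallyEq (f₁ := D 3) (Eventually.of_forall fun z => ?_)).congr_deriv ?_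
    · rw [e3]
      rfl
    rw [← hG', e3, e2, e1, e0]
    simp only [BoundedContinuousFunction.coe_sub, BoundedContinuousFunction.coe_smul, Pi.sub_apply,
      BoundedContinuousFunction.coe_add, Pi.add_apply, smul_eq_mul]
    ring

lemma norm_unfactor_le {E : Type*} [NormedAddCommGroup E] [NormedSpace ℂ E] (l₁ l₂ : ℂ)
    {W : Fin 4 → E} {B : ℝ} (hW : ∀ j, ‖W j‖ ≤ B) (j : Fin 4) :
    ‖unfactor l₁ l₂ W j‖ ≤ (2 + 2 * (‖l₁‖ + ‖l₂‖ + 1) ^ 3) * B := by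
  have hB : 0 ≤ B := (norm_nonneg _).trans (hW 0)
  have hs : ∀ (a : ℂ) (i : Fin 4), ‖a • W i‖ ≤ ‖a‖ * B := fun a i => by
    rw [norm_smul]
    exact mul_le_mul_of_nonneg_left (hW i) (norm_nonneg _)
  have ha := norm_nonneg l₁
  have hb := norm_nonneg l₂
  have n3 : ‖l₁ ^ 2 + l₁ * l₂ + l₂ ^ 2‖ ≤ ‖l₁‖ ^ 2 + ‖l₁‖ * ‖l₂‖ + ‖l₂‖ ^ 2 := by
    refine (norm_add_le _ _).trans ?_
    have := norm_add_le (l₁ ^ 2) (l₁ * l₂)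
    rw [norm_pow, norm_mul] at this
    rw [norm_pow]
    linarith
  have n2 := norm_add_le l₁ l₂
  set a := ‖l₁‖
  set b := ‖l₂‖
  have k0 : 0 ≤ (a + b + 1) ^ 3 := by positivity
  fin_cases j
  · change ‖W 0‖ ≤ _
    have := hW 0
    nlinarith
  · change ‖W 1 - l₁ • W 0‖ ≤ _
    have h1 := norm_sub_le (W 1) (l₁ • W 0)
    have h2 : 1 + a ≤ 2 + 2 * (a + b + 1) ^ 3 := by
      nlinarith [mul_nonneg ha hb, mul_nonneg (mul_nonneg ha hb) hb, mul_nonneg (mul_nonneg ha hb) ha,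
        pow_nonneg ha 3, pow_nonneg hb 3, sq_nonneg a, sq_nonneg b]
    have h3 := mul_le_mul_of_nonneg_right h2 hB
    linarith [hW 1, hs l₁ 0]
  · change ‖W 2 - (l₁ + l₂) • W 1 + l₁ ^ 2 • W 0‖ ≤ _
    have h1 := norm_add_le (W 2 - (l₁ + l₂) • W 1) (l₁ ^ 2 • W 0)
    have h1' := norm_sub_le (W 2) ((l₁ + l₂) • W 1)
    have h2 : 1 + (a + b) + a ^ 2 ≤ 2 + 2 * (a + b + 1) ^ 3 := by
      nlinarith [mul_nonneg ha hb, mul_nonneg (mul_nonneg ha hb) hb, mul_nonneg (mul_nonneg ha hb) ha,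
        pow_nonneg ha 3, pow_nonneg hb 3, sq_nonneg a, sq_nonneg b]
    have h3 := mul_le_mul_of_nonneg_right h2 hB
    have h4 := hs (l₁ ^ 2) 0
    rw [norm_pow] at h4
    have h5 := mul_le_mul_of_nonneg_right n2 hB
    linarith [hW 2, hs (l₁ + l₂) 1]
  · change ‖W 3 - l₂ • W 2 + (l₁ ^ 2 + l₁ * l₂ + l₂ ^ 2) • W 1 - l₁ ^ 3 • W 0‖ ≤ _
    have h1 := norm_sub_le (W 3 - l₂ • W 2 + (l₁ ^ 2 + l₁ * l₂ + l₂ ^ 2) • W 1) (l₁ ^ 3 • W 0)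
    have h1' := norm_add_le (W 3 - l₂ • W 2) ((l₁ ^ 2 + l₁ * l₂ + l₂ ^ 2) • W 1)
    have h1'' := norm_sub_le (W 3) (l₂ • W 2)
    have h2 : 1 + b + (a ^ 2 + a * b + b ^ 2) + a ^ 3 ≤ 2 + 2 * (a + b + 1) ^ 3 := by
      nlinarith [mul_nonneg ha hb, mul_nonneg (mul_nonneg ha hb) hb, mul_nonneg (mul_nonneg ha hb) ha,
        pow_nonneg ha 3, pow_nonneg hb 3, sq_nonneg a, sq_nonneg b]
    have h3 := mul_le_mul_of_nonneg_right h2 hB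
    have h4 := hs (l₁ ^ 3) 0
    rw [norm_pow] at h4
    have h5 := mul_le_mul_of_nonneg_right n3 hB
    linarith [hW 3, hs l₂ 2, hs (l₁ ^ 2 + l₁ * l₂ + l₂ ^ 2) 1]

lemma unfactor_apply {E : Type*} [NormedAddCommGroup E] [NormedSpace ℂ E] (l₁ l₂ : ℂ)
    (A : Fin 4 → E →L[ℂ] E) (h : Fin 4 → E) (G : E) (j : Fin 4) :
    unfactor l₁ l₂ A j G + unfactor l₁ l₂ h j = unfactor l₁ l₂ (fun i => A i G + h i) j := by
  fin_cases j <;> simp [unfactor] <;> module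

/-- A small perturbation of the identity is solved for by the Neumann series, and the solution
depends continuously on the perturbation. -/
lemma exists_neumann {E : Type*} [NormedCommRing E] [NormedAlgebra ℂ E] [CompleteSpace E]
    {K : Fin 4 → E →L[ℂ] E} {C : ℝ} (hC : 0 < C) (hK : ∀ j, ‖K j‖ ≤ C) (h : Fin 4 → E)
    {ι : Type*} {l : Filter ι} {x₀ : ι} {p : ι → Fin 4 → E}
    (hp : ∀ j, Tendsto (fun x => p x j) l (𝓝 (p x₀ j))) (hpδ : ∀ j, ‖p x₀ j‖ ≤ 1 / (8 * C))
    {F : ι → E} (hF : Tendsto F l (𝓝 (F x₀))) :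
    ∃ G : ι → E, Tendsto G l (𝓝 (G x₀)) ∧ ∀ᶠ x in l, G x + ∑ j, p x j * (K j (G x) + h j) = F x := by
  set M : ι → E →L[ℂ] E := fun x => ∑ j, ContinuousLinearMap.mul ℂ E (p x j) * K j with hM
  have hMap : ∀ x G, M x G = ∑ j, p x j * K j G := by
    intro x G
    simp [hM]
  have hMt : Tendsto M l (𝓝 (M x₀)) := by
    refine tendsto_finsetSum _ fun j _ => ?_
    exact (((ContinuousLinearMap.mul ℂ E).continuous.tendsto _).comp (hp j)).mul
      tendsto_const_nhds
  have hMn : ‖M x₀‖ < 1 := by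
    have h1 : ∀ j, ‖ContinuousLinearMap.mul ℂ E (p x₀ j) * K j‖ ≤ 1 / 8 := by
      intro j
      refine (norm_mul_le _ _).trans ?_
      have h2 := (ContinuousLinearMap.opNorm_mul_apply_le ℂ E (p x₀ j)).trans (hpδ j)
      refine (mul_le_mul h2 (hK j) (norm_nonneg _) (by positivity)).trans (le_of_eq ?_)
      field_simp
    refine (norm_sum_le _ _).trans_lt ?_
    rw [Fin.sum_univ_four]
    linarith [h1 0, h1 1, h1 2, h1 3]
  have hunit : IsUnit (1 + M x₀) := by
    have := isUnit_one_sub_of_norm_lt_one (x := -M x₀) (by rwa [norm_neg])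
    simpa using this
  have hMt1 : Tendsto (fun x => 1 + M x) l (𝓝 (1 + M x₀)) := hMt.const_add 1
  have hev : ∀ᶠ x in l, IsUnit (1 + M x) := hMt1.eventually (Units.isOpen.mem_nhds hunit)
  have hinv : Tendsto (fun x => Ring.inverse (1 + M x)) l (𝓝 (Ring.inverse (1 + M x₀))) := by
    obtain ⟨u, hu⟩ := hunit
    have := NormedRing.inverse_continuousAt u
    rw [hu] at this
    exact this.tendsto.comp hMt1
  have hsrc : Tendsto (fun x => F x - ∑ j, p x j * h j) l (𝓝 (F x₀ - ∑ j, p x₀ j * h j)) :=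
    hF.sub (tendsto_finsetSum _ fun j _ => (hp j).mul tendsto_const_nhds)
  refine ⟨fun x => Ring.inverse (1 + M x) (F x - ∑ j, p x j * h j), ?_, ?_⟩
  · have hcont : Continuous fun z : (E →L[ℂ] E) × E => z.1 z.2 :=
      isBoundedBilinearMap_apply.continuous
    exact (hcont.tendsto _).comp (hinv.prodMk_nhds hsrc)
  · filter_upwards [hev] with x hx
    have h1 : (1 + M x) (Ring.inverse (1 + M x) (F x - ∑ j, p x j * h j))
        = F x - ∑ j, p x j * h j :=
      DFunLike.congr_fun (Ring.mul_inverse_cancel _ hx) (F x - ∑ j, p x j * h j)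
    rw [add_apply, one_apply_eq_self, hMap] at h1
    simp only [mul_add, Finset.sum_add_distrib]
    rw [← add_assoc, h1, sub_add_cancel]

/-- The solution operators of the triangular first-order system that results from the factorisation
of the constant-coefficient operator. -/
def factorOp {l₁ l₂ : ℂ} {ν : ℝ} (p₁ : 0 < (l₁ - ν).re) (p₂ : 0 < (l₂ - ν).re)
    (p₃ : 0 < (l₁ + ν).re) (p₄ : 0 < (l₂ + ν).re) (X : ℝ) : Fin 4 → (ℝ →ᵇ ℂ) →L[ℂ] (ℝ →ᵇ ℂ) :=
  ![headOp _ p₁ X * (headOp _ p₂ X * (tailOp _ p₃ * tailOp _ p₄)),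
    headOp _ p₂ X * (tailOp _ p₃ * tailOp _ p₄), tailOp _ p₃ * tailOp _ p₄, tailOp _ p₄]

/-- The decaying solutions of the triangular system without forcing. -/
def factorHom {l₁ l₂ : ℂ} {ν : ℝ} (p₁ : 0 < (l₁ - ν).re) (p₂ : 0 < (l₂ - ν).re) (X : ℝ)
    (c₁ c₂ : ℂ) : Fin 4 → ℝ →ᵇ ℂ :=
  ![headOp _ p₁ X (c₂ • headExp _ p₂ X) + c₁ • headExp _ p₁ X, c₂ • headExp _ p₂ X, 0, 0]

section Factor

variable {l₁ l₂ : ℂ} {ν : ℝ} (p₁ : 0 < (l₁ - ν).re) (p₂ : 0 < (l₂ - ν).re)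
    (p₃ : 0 < (l₁ + ν).re) (p₄ : 0 < (l₂ + ν).re) (X : ℝ) (c₁ c₂ : ℂ) (G : ℝ →ᵇ ℂ)

lemma exists_norm_factorOp_le : ∃ R : ℝ, 0 < R ∧ ∀ X j, ‖factorOp p₁ p₂ p₃ p₄ X j‖ ≤ R := by
  set R : ℝ := 1 + 1 / (l₁ - ν).re + 1 / (l₂ - ν).re + 1 / (l₁ + ν).re + 1 / (l₂ + ν).re with hR
  have q1 : 0 < 1 / (l₁ - ν).re := by positivity
  have q2 : 0 < 1 / (l₂ - ν).re := by positivity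
  have q3 : 0 < 1 / (l₁ + ν).re := by positivity
  have q4 : 0 < 1 / (l₂ + ν).re := by positivity
  have hR1 : 1 ≤ R := by rw [hR]; linarith
  have n1 : ∀ X, ‖headOp _ p₁ X‖ ≤ R := fun X => (norm_headOp_le _ _ _).trans (by rw [hR]; linarith)
  have n2 : ∀ X, ‖headOp _ p₂ X‖ ≤ R := fun X => (norm_headOp_le _ _ _).trans (by rw [hR]; linarith)
  have n3 : ‖tailOp _ p₃‖ ≤ R := (norm_tailOp_le _ _).trans (by rw [hR]; linarith)
  have n4 : ‖tailOp _ p₄‖ ≤ R := (norm_tailOp_le _ _).trans (by rw [hR]; linarith)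
  have m2 : ‖tailOp _ p₃ * tailOp _ p₄‖ ≤ R ^ 2 := by
    refine (norm_mul_le _ _).trans ?_
    rw [pow_two]
    exact mul_le_mul n3 n4 (norm_nonneg _) (by linarith)
  have m1 : ∀ X, ‖headOp _ p₂ X * (tailOp _ p₃ * tailOp _ p₄)‖ ≤ R ^ 3 := by
    intro X
    refine (norm_mul_le _ _).trans ?_
    rw [pow_succ']
    exact mul_le_mul (n2 X) m2 (norm_nonneg _) (by linarith)
  have m0 : ∀ X, ‖headOp _ p₁ X * (headOp _ p₂ X * (tailOp _ p₃ * tailOp _ p₄))‖ ≤ R ^ 4 := by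
    intro X
    refine (norm_mul_le _ _).trans ?_
    rw [pow_succ']
    exact mul_le_mul (n1 X) (m1 X) (norm_nonneg _) (by linarith)
  refine ⟨R ^ 4, by positivity, fun X j => ?_⟩
  fin_cases j
  · exact m0 X
  · exact (m1 X).trans (pow_le_pow_right₀ hR1 (by norm_num))
  · exact m2.trans (pow_le_pow_right₀ hR1 (by norm_num))
  · exact n4.trans (by simpa using pow_le_pow_right₀ hR1 (show 1 ≤ 4 by norm_num))

/-- The solution of the triangular system. -/
def factorSol (j : Fin 4) : ℝ →ᵇ ℂ := factorOp p₁ p₂ p₃ p₄ X j G + factorHom p₁ p₂ X c₁ c₂ j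

lemma factorSol_zero : factorSol p₁ p₂ p₃ p₄ X c₁ c₂ G 0
    = headOp _ p₁ X (factorSol p₁ p₂ p₃ p₄ X c₁ c₂ G 1) + c₁ • headExp _ p₁ X := by
  simp only [factorSol, factorOp, factorHom, Matrix.cons_val_zero, Matrix.cons_val_one, map_add]
  exact (add_assoc _ _ _).symm

lemma factorSol_one : factorSol p₁ p₂ p₃ p₄ X c₁ c₂ G 1
    = headOp _ p₂ X (factorSol p₁ p₂ p₃ p₄ X c₁ c₂ G 2) + c₂ • headExp _ p₂ X := by
  simp [factorSol, factorOp, factorHom]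

lemma factorSol_two : factorSol p₁ p₂ p₃ p₄ X c₁ c₂ G 2
    = tailOp _ p₃ (factorSol p₁ p₂ p₃ p₄ X c₁ c₂ G 3) := by
  simp [factorSol, factorOp, factorHom]

lemma factorSol_three : factorSol p₁ p₂ p₃ p₄ X c₁ c₂ G 3 = tailOp _ p₄ G := by
  simp [factorSol, factorOp, factorHom]

lemma outerRel_factorSol {p : Fin 4 → ℝ →ᵇ ℂ} {F : ℝ →ᵇ ℂ}
    (hG : G + ∑ j, p j * unfactor l₁ l₂ (factorSol p₁ p₂ p₃ p₄ X c₁ c₂ G) j = F) :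
    OuterRel l₁ l₂ ν X p F (unfactor l₁ l₂ (factorSol p₁ p₂ p₃ p₄ X c₁ c₂ G)) := by
  refine outerRel_unfactor (fun y hy => ?_) (fun y hy => ?_) (fun y hy => ?_) (fun y hy => ?_) hG
  · have d1 := hasDerivAt_headOp _ p₁ X (factorSol p₁ p₂ p₃ p₄ X c₁ c₂ G 1) hy
    have d2 := (hasDerivAt_headExp _ p₁ X hy).const_mul c₁
    rw [factorSol_zero]
    refine (d1.add d2).congr_deriv ?_
    simp only [BoundedContinuousFunction.coe_smul, BoundedContinuousFunction.coe_add,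
      Pi.add_apply, smul_eq_mul]
    ring
  · have d1 := hasDerivAt_headOp _ p₂ X (factorSol p₁ p₂ p₃ p₄ X c₁ c₂ G 2) hy
    have d2 := (hasDerivAt_headExp _ p₂ X hy).const_mul c₂
    rw [factorSol_one]
    refine (d1.add d2).congr_deriv ?_
    simp only [BoundedContinuousFunction.coe_smul, BoundedContinuousFunction.coe_add,
      Pi.add_apply, smul_eq_mul]
    ring
  · rw [factorSol_two]
    exact hasDerivAt_tailOp _ p₃ _ y
  · rw [factorSol_three]
    exact hasDerivAt_tailOp _ p₄ _ y

lemma factorSol_zero_self : factorSol p₁ p₂ p₃ p₄ X c₁ c₂ G 0 X = c₁ := by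
  rw [factorSol_zero, BoundedContinuousFunction.add_apply, headOp_self,
    BoundedContinuousFunction.smul_apply, headExp_self]
  simp

lemma factorSol_one_self : factorSol p₁ p₂ p₃ p₄ X c₁ c₂ G 1 X = c₂ := by
  rw [factorSol_one, BoundedContinuousFunction.add_apply, headOp_self,
    BoundedContinuousFunction.smul_apply, headExp_self]
  simp

end Factor

/-- Decaying solutions of the perturbed equation, for prescribed values of `v` and of `v' + λ₁ v` at
`X`, depending continuously on the perturbation and the forcing. The admissible size `δ` of the
perturbation does not depend on `X`. -/
lemma exists_outerRel (l₁ l₂ : ℂ) {ν : ℝ} (hν : 0 ≤ ν) (h₁ : ν < l₁.re) (h₂ : ν < l₂.re) :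
    ∃ δ : ℝ, 0 < δ ∧ ∀ (X : ℝ) {ι : Type} (l : Filter ι) (x₀ : ι),
      ∀ p : ι → Fin 4 → ℝ →ᵇ ℂ, (∀ j, Tendsto (fun x => p x j) l (𝓝 (p x₀ j))) →
      (∀ j, ‖p x₀ j‖ ≤ δ) → ∀ F : ι → ℝ →ᵇ ℂ, Tendsto F l (𝓝 (F x₀)) → ∀ c₁ c₂ : ℂ,
      ∃ D : ι → Fin 4 → ℝ →ᵇ ℂ, (∀ j, Tendsto (fun x => D x j) l (𝓝 (D x₀ j))) ∧
        (∀ᶠ x in l, OuterRel l₁ l₂ ν X (p x) (F x) (D x)) ∧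
        D x₀ 0 X = c₁ ∧ D x₀ 1 X + l₁ * D x₀ 0 X = c₂ := by
  have p1 : 0 < (l₁ - ν).re := by simp [h₁]
  have p2 : 0 < (l₂ - ν).re := by simp [h₂]
  have p3 : 0 < (l₁ + ν).re := by simp; linarith
  have p4 : 0 < (l₂ + ν).re := by simp; linarith
  obtain ⟨R, hR, hRb⟩ := exists_norm_factorOp_le p1 p2 p3 p4
  set C : ℝ := (2 + 2 * (‖l₁‖ + ‖l₂‖ + 1) ^ 3) * R with hC
  have hC0 : 0 < C := by positivity
  refine ⟨1 / (8 * C), by positivity, fun X ι l x₀ p hp hpδ F hF c₁ c₂ => ?_⟩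
  obtain ⟨G, hGt, hGe⟩ := exists_neumann (K := unfactor l₁ l₂ (factorOp p1 p2 p3 p4 X)) hC0
    (norm_unfactor_le l₁ l₂ (hRb X)) (unfactor l₁ l₂ (factorHom p1 p2 X c₁ c₂)) hp hpδ hF
  have hD : ∀ x j, unfactor l₁ l₂ (factorOp p1 p2 p3 p4 X) j (G x)
      + unfactor l₁ l₂ (factorHom p1 p2 X c₁ c₂) j
      = unfactor l₁ l₂ (factorSol p1 p2 p3 p4 X c₁ c₂ (G x)) j := fun x j =>
    unfactor_apply l₁ l₂ _ _ (G x) j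
  refine ⟨fun x => unfactor l₁ l₂ (factorSol p1 p2 p3 p4 X c₁ c₂ (G x)), fun j => ?_, ?_, ?_, ?_⟩
  · simp only [← hD]
    exact (((unfactor l₁ l₂ (factorOp p1 p2 p3 p4 X) j).continuous.tendsto _).comp hGt).add_const _
  · filter_upwards [hGe] with x hx
    simp only [hD] at hx
    exact outerRel_factorSol p1 p2 p3 p4 X c₁ c₂ (G x) hx
  · exact factorSol_zero_self p1 p2 p3 p4 X c₁ c₂ (G x₀)
  · have e0 : unfactor l₁ l₂ (factorSol p1 p2 p3 p4 X c₁ c₂ (G x₀)) 0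
        = factorSol p1 p2 p3 p4 X c₁ c₂ (G x₀) 0 := rfl
    have e1 : unfactor l₁ l₂ (factorSol p1 p2 p3 p4 X c₁ c₂ (G x₀)) 1
        = factorSol p1 p2 p3 p4 X c₁ c₂ (G x₀) 1
          - l₁ • factorSol p1 p2 p3 p4 X c₁ c₂ (G x₀) 0 := rfl
    simp only [e0, e1, BoundedContinuousFunction.sub_apply, BoundedContinuousFunction.smul_apply,
      factorSol_zero_self, factorSol_one_self, smul_eq_mul, sub_add_cancel]

end Outer

/-! ### Decaying solutions of the resolvent equation near infinity -/

/-- For `η` near `η₀`, the functions `z 1 η`, `z 2 η` are solutions on `(T, ∞)` of the homogeneous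
equation and `z 0 η` is a solution with right-hand side `g η`. All three are `O(wt)` at infinity,
they depend continuously on `η` at `η₀` with respect to the weight `wt`, and `z 1 η₀`, `z 2 η₀` are
linearly independent. -/
structure DecayingBasis (l : Filter ℝ) (η₀ : ℝ) (g : ℝ → ℝ → ℂ) (wt : ℝ → ℝ) (T : ℝ)
    (z : Fin 3 → ℝ → ℝ → Fin 4 → ℂ) : Prop where
  isSol : ∀ᶠ η in l, IsSol η (g η) (Set.Ioi T) (z 0 η) ∧ IsSol η 0 (Set.Ioi T) (z 1 η) ∧
    IsSol η 0 (Set.Ioi T) (z 2 η)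
  bound : ∃ C : ℝ, ∀ i, ∀ t, T < t → ‖z i η₀ t‖ ≤ C * wt t
  tendsto : ∀ i, ∀ e : ℝ, 0 < e → ∀ᶠ η in l, ∀ t, T < t → ‖z i η t - z i η₀ t‖ ≤ e * wt t
  indep : ∀ s₁ s₂ : ℂ, (∀ t, T < t → s₁ • z 1 η₀ t + s₂ • z 2 η₀ t = 0) → s₁ = 0 ∧ s₂ = 0

section Outer

open scoped BoundedContinuousFunction

/-- The state `(v, D v, D² v, D³ v)` at `x = y ^ (1 / κ)`, in terms of the derivatives of `v` with
respect to `y`. -/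
def stateOf (κ y : ℝ) (d : Fin 4 → ℂ) : Fin 4 → ℂ :=
  ![d 0, κ * (y * d 1), κ ^ 2 * (y ^ 2 * d 2 + y * d 1),
    κ ^ 3 * (y ^ 3 * d 3 + 3 * y ^ 2 * d 2 + y * d 1)]

lemma stateOf_sub (κ y : ℝ) (d e : Fin 4 → ℂ) :
    stateOf κ y (d - e) = stateOf κ y d - stateOf κ y e := by
  funext j
  fin_cases j <;> simp [stateOf] <;> ring

lemma norm_stateOf_le {κ y B : ℝ} (hκ : 0 ≤ κ) (hy : 0 ≤ y) {d : Fin 4 → ℂ} (hd : ∀ j, ‖d j‖ ≤ B) :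
    ‖stateOf κ y d‖ ≤ 5 * (1 + κ) ^ 3 * (1 + y) ^ 3 * B := by
  have hB : 0 ≤ B := (norm_nonneg _).trans (hd 0)
  have k1 : κ ≤ (1 + κ) ^ 3 := by nlinarith [pow_nonneg hκ 2, pow_nonneg hκ 3]
  have k2 : κ ^ 2 ≤ (1 + κ) ^ 3 := by nlinarith [pow_nonneg hκ 2, pow_nonneg hκ 3]
  have k3 : κ ^ 3 ≤ (1 + κ) ^ 3 := pow_le_pow_left₀ hκ (by linarith) 3
  have k0 : 1 ≤ (1 + κ) ^ 3 := one_le_pow₀ (by linarith)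
  have y0 : 1 ≤ (1 + y) ^ 3 := one_le_pow₀ (by linarith)
  have y1 : y ≤ (1 + y) ^ 3 := by nlinarith [pow_nonneg hy 2, pow_nonneg hy 3]
  have y2 : y ^ 2 ≤ (1 + y) ^ 3 := by nlinarith [pow_nonneg hy 2, pow_nonneg hy 3]
  have y3 : y ^ 3 ≤ (1 + y) ^ 3 := pow_le_pow_left₀ hy (by linarith) 3
  set Y := (1 + y) ^ 3
  set Q := (1 + κ) ^ 3
  have b1 : ‖(y : ℂ) * d 1‖ ≤ Y * B := by
    rw [norm_mul, Complex.norm_real, Real.norm_eq_abs, abs_of_nonneg hy]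
    exact mul_le_mul y1 (hd 1) (norm_nonneg _) (by linarith)
  have b2 : ‖(y : ℂ) ^ 2 * d 2‖ ≤ Y * B := by
    rw [norm_mul, norm_pow, Complex.norm_real, Real.norm_eq_abs, abs_of_nonneg hy]
    exact mul_le_mul y2 (hd 2) (norm_nonneg _) (by linarith)
  have b3 : ‖(y : ℂ) ^ 3 * d 3‖ ≤ Y * B := by
    rw [norm_mul, norm_pow, Complex.norm_real, Real.norm_eq_abs, abs_of_nonneg hy]
    exact mul_le_mul y3 (hd 3) (norm_nonneg _) (by linarith)
  have hYB : 0 ≤ Y * B := mul_nonneg (by linarith) hB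
  have hκn : ∀ n, ‖(κ : ℂ) ^ n‖ = κ ^ n := fun n => by
    rw [norm_pow, Complex.norm_real, Real.norm_eq_abs, abs_of_nonneg hκ]
  rw [pi_norm_le_iff_of_nonneg (by positivity)]
  intro j
  have hfin : ∀ (c : ℝ) (w : ℂ), c ≤ Q → ‖w‖ ≤ 5 * (Y * B) → c * ‖w‖ ≤ 5 * Q * Y * B := by
    intro c w hc hw
    have := mul_le_mul hc hw (norm_nonneg _) (by linarith)
    linarith
  fin_cases j
  · have := hfin 1 (d 0) k0 ((hd 0).trans (by nlinarith))
    simpa [stateOf] using this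
  · have := hfin κ (y * d 1) k1 (by linarith)
    change ‖(κ : ℂ) * (y * d 1)‖ ≤ _
    rw [norm_mul, Complex.norm_real, Real.norm_eq_abs, abs_of_nonneg hκ]
    exact this
  · change ‖(κ : ℂ) ^ 2 * (y ^ 2 * d 2 + y * d 1)‖ ≤ _
    rw [norm_mul, hκn]
    exact hfin _ _ k2 ((norm_add_le _ _).trans (by linarith))
  · change ‖(κ : ℂ) ^ 3 * (y ^ 3 * d 3 + 3 * y ^ 2 * d 2 + y * d 1)‖ ≤ _
    rw [norm_mul, hκn]
    refine hfin _ _ k3 ((norm_add_le _ _).trans ?_)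
    have h1 := norm_add_le ((y : ℂ) ^ 3 * d 3) (3 * y ^ 2 * d 2)
    have h2 : ‖3 * (y : ℂ) ^ 2 * d 2‖ ≤ 3 * (Y * B) := by
      rw [mul_assoc, norm_mul]
      norm_num
      simpa using b2
    linarith

/-- The polynomial factors of a state are absorbed into the exponential weight. -/
lemma exists_norm_exp_smul_stateOf_le {κ ν ν' : ℝ} (hκ : 0 ≤ κ) (hν : ν < ν') :
    ∃ C : ℝ, 0 < C ∧ ∀ y, 0 < y → ∀ (d : Fin 4 → ℂ) (B : ℝ), (∀ j, ‖d j‖ ≤ B) →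
      ‖(Real.exp (-ν' * y) : ℂ) • stateOf κ y d‖ ≤ C * B * Real.exp (-ν * y) := by
  set r := ν' - ν with hr
  have hr0 : 0 < r := by rw [hr]; linarith
  refine ⟨5 * (1 + κ) ^ 3 * (6 / r ^ 3 * Real.exp r), by positivity, fun y hy d B hd => ?_⟩
  have hB : 0 ≤ B := (norm_nonneg _).trans (hd 0)
  have h1 := norm_stateOf_le hκ hy.le hd
  have h2 : (1 + y) ^ 3 ≤ 6 / r ^ 3 * Real.exp r * Real.exp (r * y) := by
    have h3 := Real.pow_div_factorial_le_exp (r * (1 + y)) (by positivity) 3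
    rw [mul_add, mul_one, Real.exp_add] at h3
    rw [div_mul_eq_mul_div, div_mul_eq_mul_div, le_div_iff₀ (by positivity)]
    have h4 : ((3 : ℕ).factorial : ℝ) = 6 := by norm_num [Nat.factorial]
    rw [h4, div_le_iff₀ (by norm_num)] at h3
    nlinarith
  have h5 : Real.exp (-ν' * y) * Real.exp (r * y) = Real.exp (-ν * y) := by
    rw [← Real.exp_add, hr]
    congr 1
    ring
  rw [norm_smul, Complex.norm_real, Real.norm_eq_abs, abs_of_pos (Real.exp_pos _), ← h5]
  calc Real.exp (-ν' * y) * ‖stateOf κ y d‖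
      ≤ Real.exp (-ν' * y) * (5 * (1 + κ) ^ 3 * (6 / r ^ 3 * Real.exp r * Real.exp (r * y)) * B) := by
        refine mul_le_mul_of_nonneg_left (h1.trans ?_) (Real.exp_pos _).le
        gcongr
    _ = _ := by ring

/-- The state that belongs to a solution in the weighted variables. -/
def outerState (κ ν : ℝ) (D : Fin 4 → ℝ →ᵇ ℂ) (t : ℝ) : Fin 4 → ℂ :=
  (Real.exp (-ν * Real.exp (κ * t)) : ℂ) • stateOf κ (Real.exp (κ * t)) fun j =>
    D j (Real.exp (κ * t))

lemma isSol_outerState {κ ν X η : ℝ} {l₁ l₂ : ℂ} {p D : Fin 4 → ℝ →ᵇ ℂ} {F : ℝ →ᵇ ℂ}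
    {g : ℝ → ℂ} {T : ℝ} (hT : ∀ t, T < t → X < Real.exp (κ * t))
    (hD : OuterRel l₁ l₂ ν X p F D)
    (hvf : ∀ t, T < t → ∀ d : Fin 4 → ℂ, ∀ y, y = Real.exp (κ * t) →
      κ ^ 4 * (y ^ 4 * ((l₁ ^ 2 + l₂ ^ 2) * d 2 - l₁ ^ 2 * l₂ ^ 2 * d 0
        - (p 0 y * d 0 + p 1 y * d 1 + p 2 y * d 2 + p 3 y * d 3))
        + 6 * y ^ 3 * d 3 + 7 * y ^ 2 * d 2 + y * d 1) = vf η t (stateOf κ y d))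
    (hg : ∀ t, T < t → ∀ y, y = Real.exp (κ * t) →
      (κ : ℂ) ^ 4 * (y ^ 4 * (Real.exp (-ν * y) * F y)) = g t) :
    IsSol η g (Set.Ioi T) (outerState κ ν D) := by
  rw [isSol_iff]
  intro t ht
  have hy : HasDerivAt (fun t => Real.exp (κ * t)) (κ * Real.exp (κ * t)) t := by
    have h1 : HasDerivAt (fun t : ℝ => κ * t) κ t := by simpa using (hasDerivAt_id t).const_mul κ
    exact h1.exp.congr_deriv (mul_comm _ _)
  have hyc : HasDerivAt (fun t => ((Real.exp (κ * t) : ℝ) : ℂ))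
      ((κ : ℂ) * (Real.exp (κ * t) : ℝ)) t := by
    simpa using hy.ofReal_comp
  have hec : HasDerivAt (fun t => ((Real.exp (-ν * Real.exp (κ * t)) : ℝ) : ℂ))
      (-(ν : ℂ) * κ * (Real.exp (κ * t) : ℝ) * (Real.exp (-ν * Real.exp (κ * t)) : ℝ)) t := by
    have h1 := ((hy.const_mul (-ν)).exp).ofReal_comp
    refine h1.congr_deriv ?_
    push_cast
    ring
  have hvf' := hvf t ht (fun j => D j (Real.exp (κ * t))) _ rfl
  have hg' := hg t ht _ rfl
  have hvs : vf η t (outerState κ ν D t) = (Real.exp (-ν * Real.exp (κ * t)) : ℂ) *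
      vf η t (stateOf κ (Real.exp (κ * t)) fun j => D j (Real.exp (κ * t))) := vf_smul _ _ _ _
  obtain ⟨d0, d1, d2, d3⟩ := hD _ (hT t ht)
  have hcomp : ∀ (j : Fin 4) (m : ℂ), HasDerivAt (D j) m (Real.exp (κ * t)) →
      HasDerivAt (fun t => D j (Real.exp (κ * t))) (((κ : ℂ) * (Real.exp (κ * t) : ℝ)) * m) t := by
    intro j m h
    have := h.scomp t hy
    refine this.congr_deriv ?_
    rw [Complex.real_smul]
    push_cast
    ring
  have c0 := hcomp 0 _ d0
  have c1 := hcomp 1 _ d1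
  have c2 := hcomp 2 _ d2
  have c3 := hcomp 3 _ d3
  have r0 : (fun t => outerState κ ν D t 0) = fun t =>
      ((Real.exp (-ν * Real.exp (κ * t)) : ℝ) : ℂ) * D 0 (Real.exp (κ * t)) := rfl
  have r1 : (fun t => outerState κ ν D t 1) = fun t =>
      ((Real.exp (-ν * Real.exp (κ * t)) : ℝ) : ℂ) *
        (κ * ((Real.exp (κ * t) : ℝ) * D 1 (Real.exp (κ * t)))) := rfl
  have r2 : (fun t => outerState κ ν D t 2) = fun t =>
      ((Real.exp (-ν * Real.exp (κ * t)) : ℝ) : ℂ) *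
        (κ ^ 2 * (((Real.exp (κ * t) : ℝ) : ℂ) ^ 2 * D 2 (Real.exp (κ * t))
          + (Real.exp (κ * t) : ℝ) * D 1 (Real.exp (κ * t)))) := rfl
  have r3 : (fun t => outerState κ ν D t 3) = fun t =>
      ((Real.exp (-ν * Real.exp (κ * t)) : ℝ) : ℂ) *
        (κ ^ 3 * (((Real.exp (κ * t) : ℝ) : ℂ) ^ 3 * D 3 (Real.exp (κ * t))
          + 3 * ((Real.exp (κ * t) : ℝ) : ℂ) ^ 2 * D 2 (Real.exp (κ * t))
          + (Real.exp (κ * t) : ℝ) * D 1 (Real.exp (κ * t)))) := rfl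
  rw [hvs, ← hvf', ← hg']
  rw [congrFun r1 t, congrFun r2 t, congrFun r3 t, r0, r1, r2, r3]
  refine ⟨?_, ?_, ?_, ?_⟩
  · exact (hec.mul c0).congr_deriv (by ring)
  · refine (hec.mul ((hyc.mul c1).const_mul (κ : ℂ))).congr_deriv ?_
    simp only [Pi.mul_apply]
    ring
  · refine (hec.mul ((((hyc.pow 2).mul c2).add (hyc.mul c1)).const_mul
      ((κ : ℂ) ^ 2))).congr_deriv ?_
    simp only [Pi.pow_apply, Pi.mul_apply, Pi.add_apply]
    push_cast
    ring
  · refine (hec.mul (((((hyc.pow 3).mul c3).add (((hyc.pow 2).const_mul 3).mul c2)).add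
      (hyc.mul c1)).const_mul ((κ : ℂ) ^ 3))).congr_deriv ?_
    simp only [Pi.pow_apply, Pi.mul_apply, Pi.add_apply]
    push_cast
    ring

/-- Decaying solutions of the resolvent equation, in a variable `y = x ^ κ` in which the equation is
a small perturbation of one with constant coefficients. -/
lemma exists_decayingBasis_of_perturbation {κ ν ν' : ℝ} {l₁ l₂ : ℂ} (hκ : 0 < κ) (hν0 : 0 ≤ ν)
    (hν : ν < ν') (h₁ : ν' < l₁.re) (h₂ : ν' < l₂.re) :
    ∃ δ : ℝ, 0 < δ ∧ ∀ (X : ℝ), 0 < X → ∀ (l : Filter ℝ) (η₀ : ℝ),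
      ∀ p : ℝ → Fin 4 → ℝ →ᵇ ℂ, (∀ j, Tendsto (fun x => p x j) l (𝓝 (p η₀ j))) →
      (∀ j, ‖p η₀ j‖ ≤ δ) → ∀ F : ℝ → ℝ →ᵇ ℂ, Tendsto F l (𝓝 (F η₀)) → ∀ g : ℝ → ℝ → ℂ,
      (∀ᶠ η in l, ∀ t, ∀ d : Fin 4 → ℂ, ∀ y, X < y → y = Real.exp (κ * t) →
        κ ^ 4 * (y ^ 4 * ((l₁ ^ 2 + l₂ ^ 2) * d 2 - l₁ ^ 2 * l₂ ^ 2 * d 0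
          - (p η 0 y * d 0 + p η 1 y * d 1 + p η 2 y * d 2 + p η 3 y * d 3))
          + 6 * y ^ 3 * d 3 + 7 * y ^ 2 * d 2 + y * d 1) = vf η t (stateOf κ y d)) →
      (∀ᶠ η in l, ∀ t, ∀ y, X < y → y = Real.exp (κ * t) →
        (κ : ℂ) ^ 4 * (y ^ 4 * (Real.exp (-ν' * y) * F η y)) = g η t) →
      ∃ T z, DecayingBasis l η₀ g (fun t => Real.exp (-ν * Real.exp (κ * t))) T z := by
  obtain ⟨δ, hδ, H⟩ := exists_outerRel l₁ l₂ (hν0.trans hν.le) h₁ h₂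
  refine ⟨δ, hδ, fun X hX l η₀ p hp hpδ F hF g hvf hg => ?_⟩
  obtain ⟨D0, t0, r0, -, -⟩ := H X l η₀ p hp hpδ F hF 0 0
  obtain ⟨D1, t1, r1, a1, b1⟩ := H X l η₀ p hp hpδ (fun _ => 0) tendsto_const_nhds 1 0
  obtain ⟨D2, t2, r2, a2, b2⟩ := H X l η₀ p hp hpδ (fun _ => 0) tendsto_const_nhds 0 1
  obtain ⟨C, hC, hCb⟩ := exists_norm_exp_smul_stateOf_le hκ.le hν
  set T := Real.log X / κ with hTd
  have hT : ∀ t, T < t → X < Real.exp (κ * t) := by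
    intro t ht
    rw [hTd, div_lt_iff₀ hκ] at ht
    rw [← Real.log_lt_iff_lt_exp hX]
    linarith
  have hTinv : ∀ y, X < y → ∃ t, T < t ∧ Real.exp (κ * t) = y := by
    intro y hy
    refine ⟨Real.log y / κ, ?_, ?_⟩
    · rw [hTd]
      exact div_lt_div_of_pos_right (Real.log_lt_log hX hy) hκ
    · rw [mul_div_cancel₀ _ hκ.ne', Real.exp_log (hX.trans hy)]
  set D : Fin 3 → ℝ → Fin 4 → ℝ →ᵇ ℂ := ![D0, D1, D2]
  have hDt : ∀ i j, Tendsto (fun x => D i x j) l (𝓝 (D i η₀ j)) := by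
    intro i j
    fin_cases i
    · exact t0 j
    · exact t1 j
    · exact t2 j
  refine ⟨T, fun i η => outerState κ ν' (D i η), ?_, ?_, ?_, ?_⟩
  · filter_upwards [r0, r1, r2, hvf, hg] with η q0 q1 q2 hvfη hgη
    have hv : ∀ t, T < t → ∀ d : Fin 4 → ℂ, ∀ y, y = Real.exp (κ * t) → _ := fun t ht d y hy =>
      hvfη t d y (by rw [hy]; exact hT t ht) hy
    refine ⟨isSol_outerState hT q0 hv fun t ht y hy => hgη t y (by rw [hy]; exact hT t ht) hy,
      isSol_outerState hT q1 hv ?_, isSol_outerState hT q2 hv ?_⟩ <;>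
    · intro t _ y _
      simp
  · set B : ℝ := ∑ i, ∑ j, ‖D i η₀ j‖ with hB
    refine ⟨C * B, fun i t ht => ?_⟩
    refine hCb _ (Real.exp_pos _) _ B fun j => ?_
    refine ((D i η₀ j).norm_coe_le_norm _).trans ?_
    refine (Finset.single_le_sum (f := fun j => ‖D i η₀ j‖) (fun j _ => norm_nonneg _)
      (Finset.mem_univ j)).trans ?_
    exact Finset.single_le_sum (f := fun i => ∑ j, ‖D i η₀ j‖)
      (fun i _ => Finset.sum_nonneg fun j _ => norm_nonneg _) (Finset.mem_univ i)
  · intro i e he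
    have hev : ∀ᶠ η in l, ∀ j, ‖D i η j - D i η₀ j‖ ≤ e / C := by
      rw [eventually_all]
      intro j
      have h1 := (hDt i j).eventually (Metric.closedBall_mem_nhds _ (div_pos he hC))
      filter_upwards [h1] with η h
      rwa [dist_eq_norm] at h
    filter_upwards [hev] with η h t ht
    have h1 := hCb (Real.exp (κ * t)) (Real.exp_pos _) ((fun j => D i η j (Real.exp (κ * t)))
      - fun j => D i η₀ j (Real.exp (κ * t))) (e / C) fun j =>
        ((D i η j - D i η₀ j).norm_coe_le_norm _).trans (h j)
    rw [stateOf_sub, smul_sub, mul_div_cancel₀ _ hC.ne'] at h1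
    exact h1
  · intro s₁ s₂ hs
    have hz : ∀ y, X < y → s₁ * D1 η₀ 0 y + s₂ * D2 η₀ 0 y = 0 ∧
        s₁ * D1 η₀ 1 y + s₂ * D2 η₀ 1 y = 0 := by
      intro y hy
      obtain ⟨t, ht, rfl⟩ := hTinv y hy
      have h1 := hs t ht
      have e0 := congrFun h1 0
      have e1 := congrFun h1 1
      have hne : (Real.exp (-ν' * Real.exp (κ * t)) : ℂ) ≠ 0 := by
        exact_mod_cast (Real.exp_pos _).ne'
      have hyne : ((Real.exp (κ * t) : ℝ) : ℂ) ≠ 0 := by exact_mod_cast (Real.exp_pos _).ne'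
      have hκne : (κ : ℂ) ≠ 0 := by exact_mod_cast hκ.ne'
      constructor
      · refine (mul_right_injective₀ hne) ?_
        have e0' : s₁ * ((Real.exp (-ν' * Real.exp (κ * t)) : ℂ) * D1 η₀ 0 (Real.exp (κ * t)))
          + s₂ * ((Real.exp (-ν' * Real.exp (κ * t)) : ℂ) * D2 η₀ 0 (Real.exp (κ * t))) = 0 := e0
        simp only [mul_zero]
        linear_combination e0'
      · refine (mul_right_injective₀ (mul_ne_zero hne (mul_ne_zero hκne hyne))) ?_
        have e1' : s₁ * ((Real.exp (-ν' * Real.exp (κ * t)) : ℂ) * (κ * ((Real.exp (κ * t) : ℝ)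
          * D1 η₀ 1 (Real.exp (κ * t))))) + s₂ * ((Real.exp (-ν' * Real.exp (κ * t)) : ℂ) *
          (κ * ((Real.exp (κ * t) : ℝ) * D2 η₀ 1 (Real.exp (κ * t))))) = 0 := e1
        simp only [mul_zero]
        linear_combination e1'
    have hX0 : ∀ j : Fin 4, (∀ y, X < y → s₁ * D1 η₀ j y + s₂ * D2 η₀ j y = 0) →
        s₁ * D1 η₀ j X + s₂ * D2 η₀ j X = 0 := by
      intro j hj
      have hcont : Continuous fun y => s₁ * D1 η₀ j y + s₂ * D2 η₀ j y := by fun_prop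
      have h1 : Tendsto (fun y => s₁ * D1 η₀ j y + s₂ * D2 η₀ j y) (𝓝[>] X)
          (𝓝 (s₁ * D1 η₀ j X + s₂ * D2 η₀ j X)) := hcont.continuousAt.tendsto.mono_left
            nhdsWithin_le_nhds
      refine tendsto_nhds_unique h1 ?_
      refine tendsto_const_nhds.congr' ?_
      filter_upwards [self_mem_nhdsWithin] with y hy
      exact (hj y hy).symm
    have z0 := hX0 0 fun y hy => (hz y hy).1
    have z1 := hX0 1 fun y hy => (hz y hy).2
    rw [a1, a2] at z0
    have hs1 : s₁ = 0 := by simpa using z0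
    refine ⟨hs1, ?_⟩
    rw [hs1, zero_mul, zero_add] at z1
    rw [a2, mul_zero, add_zero] at b2
    rw [b2, mul_one] at z1
    exact z1

/-- The function `1 / x`, made constant to the left of `X`. -/
def invClamp (X : ℝ) (hX : 0 < X) : ℝ →ᵇ ℂ :=
  BoundedContinuousFunction.ofNormedAddCommGroup (fun y => ((max y X : ℝ) : ℂ)⁻¹)
    ((Complex.continuous_ofReal.comp (continuous_id.max continuous_const)).inv₀ fun y => by
      have : (0 : ℝ) < max y X := hX.trans_le (le_max_right _ _)
      exact Complex.ofReal_ne_zero.mpr this.ne') (1 / X) fun y => by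
      have h1 : X ≤ max y X := le_max_right _ _
      rw [norm_inv, Complex.norm_real, Real.norm_eq_abs, abs_of_pos (hX.trans_le h1), one_div]
      exact inv_anti₀ hX h1

lemma norm_invClamp_le (X : ℝ) (hX : 0 < X) : ‖invClamp X hX‖ ≤ 1 / X :=
  BoundedContinuousFunction.norm_ofNormedAddCommGroup_le _ (by positivity) _

lemma invClamp_apply {X : ℝ} (hX : 0 < X) {y : ℝ} (hy : X < y) : invClamp X hX y = (y : ℂ)⁻¹ := by
  change ((max y X : ℝ) : ℂ)⁻¹ = _
  rw [max_eq_left hy.le]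

open Classical in
/-- The function `h`, made constant to the left of `X`; zero by convention if the result is not
bounded and continuous. -/
def clampBdd (X : ℝ) (h : ℝ → ℂ) : ℝ →ᵇ ℂ :=
  if H : Continuous (fun y => h (max y X)) ∧ ∃ C, ∀ y, ‖h (max y X)‖ ≤ C then
    BoundedContinuousFunction.ofNormedAddCommGroup _ H.1 H.2.choose H.2.choose_spec
  else 0

lemma clampBdd_apply {X C : ℝ} {h : ℝ → ℂ} (hc : ContinuousOn h (Set.Ici X))
    (hb : ∀ y, X ≤ y → ‖h y‖ ≤ C) (y : ℝ) : clampBdd X h y = h (max y X) := by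
  have H : Continuous (fun y => h (max y X)) ∧ ∃ C, ∀ y, ‖h (max y X)‖ ≤ C :=
    ⟨hc.comp_continuous (continuous_id.max continuous_const) fun y => Set.mem_Ici.mpr (le_max_right _ _),
      C, fun y => hb _ (le_max_right _ _)⟩
  rw [clampBdd, dif_pos H]
  rfl

lemma norm_clampBdd_sub_le {X C D E : ℝ} {h k : ℝ → ℂ} (hh : ContinuousOn h (Set.Ici X))
    (hk : ContinuousOn k (Set.Ici X)) (hhb : ∀ y, X ≤ y → ‖h y‖ ≤ C) (hkb : ∀ y, X ≤ y → ‖k y‖ ≤ D)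
    (hE : ∀ y, X ≤ y → ‖h y - k y‖ ≤ E) : ‖clampBdd X h - clampBdd X k‖ ≤ E := by
  have hE0 : 0 ≤ E := (norm_nonneg _).trans (hE X le_rfl)
  rw [BoundedContinuousFunction.norm_le hE0]
  intro y
  rw [BoundedContinuousFunction.sub_apply, clampBdd_apply hh hhb, clampBdd_apply hk hkb]
  exact hE _ (le_max_right _ _)

lemma le_expNorm {k j : ℕ} (hj : j ≤ k) {x₀ x : ℝ} (hx : x₀ ≤ x) (ν : ℝ) (g : ℝ → ℂ) :
    ENNReal.ofReal (Real.exp (ν * x)) * ‖iteratedDeriv j g x‖ₑ ≤ expNorm k x₀ ν g :=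
  (le_iSup₂ (f := fun x (_ : x ∈ Set.Ici x₀) =>
    ENNReal.ofReal (Real.exp (ν * x)) * ‖iteratedDeriv j g x‖ₑ) x hx).trans
    (le_iSup₂ (f := fun j (_ : j ∈ Set.Iic k) => ⨆ x ∈ Set.Ici x₀,
      ENNReal.ofReal (Real.exp (ν * x)) * ‖iteratedDeriv j g x‖ₑ) j hj)

lemma exp_mul_norm_le_expNorm {k j : ℕ} (hj : j ≤ k) {x₀ x : ℝ} (hx : x₀ ≤ x) {ν : ℝ} {g : ℝ → ℂ}
    (hg : expNorm k x₀ ν g < ⊤) :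
    Real.exp (ν * x) * ‖iteratedDeriv j g x‖ ≤ (expNorm k x₀ ν g).toReal := by
  have h := ENNReal.toReal_mono hg.ne (le_expNorm hj hx ν g)
  rwa [ENNReal.toReal_mul, ENNReal.toReal_ofReal (Real.exp_pos _).le, toReal_enorm] at h

/-- Decaying solutions for `η` near `η₀ ≠ 0`. -/
lemma exists_decayingBasis {f : ℝ → ℝ → ℂ}
    (hf : ∀ η, ContinuousOn (fun x => f x η) (Set.Ioi 0)) (hf' : GInfty f) {η₀ ν : ℝ}
    (hη₀ : η₀ ≠ 0) (hν0 : 0 ≤ ν) (hν : ν < |η₀|) :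
    ∃ T z, DecayingBasis (𝓝 η₀) η₀ (fun η t => f (Real.exp t) η)
      (fun t => Real.exp (-ν * Real.exp (1 * t))) T z := by
  set k := |η₀| with hk
  set ν' := (ν + k) / 2 with hν'
  have hνν' : ν < ν' := by rw [hν']; linarith
  have hν'k : ν' < k := by rw [hν']; linarith
  have hk2 : k ^ 2 = η₀ ^ 2 := sq_abs η₀
  obtain ⟨δ, hδ, H⟩ := exists_decayingBasis_of_perturbation (κ := 1) (l₁ := k) (l₂ := k) one_pos hν0
    hνν' (by simpa using hν'k) (by simpa using hν'k)
  set X : ℝ := max 1 ((5 + 5 * η₀ ^ 2) / δ) with hXd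
  have hX1 : 1 ≤ X := le_max_left _ _
  have hX : 0 < X := by linarith
  have hXδ : (5 + 5 * η₀ ^ 2) * (1 / X) ≤ δ := by
    have h1 : (5 + 5 * η₀ ^ 2) / δ ≤ X := le_max_right _ _
    rw [div_le_iff₀ hδ] at h1
    rw [mul_one_div, div_le_iff₀ hX]
    linarith
  set I := invClamp X hX with hI
  have hIn : ‖I‖ ≤ 1 / X := norm_invClamp_le X hX
  have hI1 : ‖I‖ ≤ 1 := hIn.trans (by rw [div_le_one hX]; exact hX1)
  have hI2 : ‖I ^ 2‖ ≤ 1 / X := by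
    rw [pow_two]
    refine (norm_mul_le _ _).trans ?_
    nlinarith [norm_nonneg I]
  have hI3 : ‖I ^ 3‖ ≤ 1 / X := by
    rw [pow_succ]
    refine (norm_mul_le _ _).trans ?_
    nlinarith [norm_nonneg I, norm_nonneg (I ^ 2)]
  have hXp : 0 < 1 / X := by positivity
  set p : ℝ → Fin 4 → ℝ →ᵇ ℂ := fun η =>
    ![I ^ 3 - ((η ^ 2 : ℝ) : ℂ) • I ^ 2 + ((η ^ 4 - η₀ ^ 4 : ℝ) : ℂ) • 1,
      ((-9 / 8 : ℝ) : ℂ) • I ^ 3 - ((5 * η ^ 2 : ℝ) : ℂ) • I,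
      ((3 : ℝ) : ℂ) • I ^ 2 + ((2 * η₀ ^ 2 - 2 * η ^ 2 : ℝ) : ℂ) • 1,
      ((5 : ℝ) : ℂ) • I] with hp
  have hpc : ∀ j, Continuous fun η => p η j := by
    intro j
    fin_cases j
    · change Continuous fun η : ℝ => I ^ 3 - ((η ^ 2 : ℝ) : ℂ) • I ^ 2
        + ((η ^ 4 - η₀ ^ 4 : ℝ) : ℂ) • (1 : ℝ →ᵇ ℂ)
      fun_prop
    · change Continuous fun η : ℝ => ((-9 / 8 : ℝ) : ℂ) • I ^ 3 - ((5 * η ^ 2 : ℝ) : ℂ) • I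
      fun_prop
    · change Continuous fun η : ℝ => ((3 : ℝ) : ℂ) • I ^ 2
        + ((2 * η₀ ^ 2 - 2 * η ^ 2 : ℝ) : ℂ) • (1 : ℝ →ᵇ ℂ)
      fun_prop
    · exact continuous_const
  have hns : ∀ (a : ℝ) (w : ℝ →ᵇ ℂ), ‖w‖ ≤ 1 / X → ‖(a : ℂ) • w‖ ≤ |a| * (1 / X) := by
    intro a w hw
    rw [norm_smul, Complex.norm_real, Real.norm_eq_abs]
    exact mul_le_mul_of_nonneg_left hw (abs_nonneg a)
  have hsq := sq_nonneg η₀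
  have hpδ : ∀ j, ‖p η₀ j‖ ≤ δ := by
    intro j
    refine le_trans ?_ hXδ
    fin_cases j
    · change ‖I ^ 3 - ((η₀ ^ 2 : ℝ) : ℂ) • I ^ 2 + ((η₀ ^ 4 - η₀ ^ 4 : ℝ) : ℂ) • (1 : ℝ →ᵇ ℂ)‖ ≤ _
      rw [sub_self, Complex.ofReal_zero, zero_smul, add_zero]
      have h1 := norm_sub_le (I ^ 3) (((η₀ ^ 2 : ℝ) : ℂ) • I ^ 2)
      have h2 := hns (η₀ ^ 2) _ hI2
      rw [abs_of_nonneg hsq] at h2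
      nlinarith
    · change ‖((-9 / 8 : ℝ) : ℂ) • I ^ 3 - ((5 * η₀ ^ 2 : ℝ) : ℂ) • I‖ ≤ _
      have h1 := norm_sub_le (((-9 / 8 : ℝ) : ℂ) • I ^ 3) (((5 * η₀ ^ 2 : ℝ) : ℂ) • I)
      have h2 := hns (-9 / 8) _ hI3
      have h3 := hns (5 * η₀ ^ 2) _ hIn
      rw [abs_of_nonneg (by positivity)] at h3
      rw [abs_of_neg (by norm_num)] at h2
      nlinarith
    · change ‖((3 : ℝ) : ℂ) • I ^ 2 + ((2 * η₀ ^ 2 - 2 * η₀ ^ 2 : ℝ) : ℂ) • (1 : ℝ →ᵇ ℂ)‖ ≤ _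
      rw [sub_self, Complex.ofReal_zero, zero_smul, add_zero]
      have h2 := hns 3 _ hI2
      rw [abs_of_pos (by norm_num)] at h2
      nlinarith
    · change ‖((5 : ℝ) : ℂ) • I‖ ≤ _
      have h2 := hns 5 _ hIn
      rw [abs_of_pos (by norm_num)] at h2
      nlinarith
  set φ : ℝ → ℝ → ℂ := fun η y => (Real.exp (ν' * y) : ℂ) * ((y : ℂ)⁻¹ ^ 4 * f y η) with hφ
  have hsub : Set.Ici X ⊆ Set.Ioi 0 := fun y hy => hX.trans_le hy
  have hφc : ∀ η, ContinuousOn (φ η) (Set.Ici X) := by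
    intro η
    have h1 := (hf η).mono hsub
    have h2 : ContinuousOn (fun y : ℝ => (y : ℂ)⁻¹) (Set.Ici X) :=
      Complex.continuous_ofReal.continuousOn.inv₀ fun y hy =>
        Complex.ofReal_ne_zero.mpr (ne_of_gt (hsub hy))
    exact (Continuous.continuousOn (by fun_prop)).mul ((h2.pow 4).mul h1)
  have hφle : ∀ y, X ≤ y → ∀ w : ℂ, ‖(Real.exp (ν' * y) : ℂ) * ((y : ℂ)⁻¹ ^ 4 * w)‖
      ≤ Real.exp (ν' * y) * ‖w‖ := by
    intro y hy w
    rw [norm_mul, norm_mul, Complex.norm_real, Real.norm_eq_abs, abs_of_pos (Real.exp_pos _)]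
    refine mul_le_mul_of_nonneg_left (mul_le_of_le_one_left (norm_nonneg _) ?_) (Real.exp_pos _).le
    rw [norm_pow, norm_inv, Complex.norm_real, Real.norm_eq_abs, abs_of_pos (hX.trans_le hy)]
    exact pow_le_one₀ (inv_nonneg.mpr (hX.trans_le hy).le) (inv_le_one_of_one_le₀ (hX1.trans hy))
  have hmem : ∀ᶠ η in 𝓝 η₀, η ≠ 0 ∧ ν' < |η| :=
    (eventually_ne_nhds hη₀).and (continuous_abs.continuousAt.eventually_const_lt hν'k)
  have hν'0 : 0 ≤ ν' := hν0.trans hνν'.le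
  have hφb : ∀ η, η ≠ 0 ∧ ν' < |η| → ∀ y, X ≤ y →
      ‖φ η y‖ ≤ (expNorm 0 X ν' fun y => f y η).toReal := by
    intro η hη y hy
    have h1 := exp_mul_norm_le_expNorm le_rfl hy (hf'.finite X hX 0 η hη.1 ν' ⟨hν'0, hη.2⟩)
    rw [iteratedDeriv_zero] at h1
    exact (hφle y hy _).trans h1
  have hm0 : η₀ ≠ 0 ∧ ν' < |η₀| := ⟨hη₀, hν'k⟩
  have hF : Tendsto (fun η => clampBdd X (φ η)) (𝓝 η₀) (𝓝 (clampBdd X (φ η₀))) := by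
    rw [tendsto_iff_norm_sub_tendsto_zero]
    have h0 := hf'.continuous X hX 0 η₀ hη₀ ν' ⟨hν'0, hν'k⟩
    have h1 := (ENNReal.tendsto_toReal ENNReal.zero_ne_top).comp h0
    rw [ENNReal.toReal_zero] at h1
    refine squeeze_zero' (Eventually.of_forall fun _ => norm_nonneg _) ?_ h1
    filter_upwards [hmem, h0.eventually_lt_const ENNReal.zero_lt_top] with η hη hfin
    refine norm_clampBdd_sub_le (hφc η) (hφc η₀) (hφb η hη) (hφb η₀ hm0) fun y hy => ?_
    have h2 := exp_mul_norm_le_expNorm (j := 0) le_rfl hy hfin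
    rw [iteratedDeriv_zero] at h2
    refine le_trans ?_ h2
    have h3 : φ η y - φ η₀ y
        = (Real.exp (ν' * y) : ℂ) * ((y : ℂ)⁻¹ ^ 4 * (f y η - f y η₀)) := by
      simp only [hφ]; ring
    rw [h3]
    exact hφle y hy _
  refine H X hX (𝓝 η₀) η₀ p (fun j => (hpc j).tendsto η₀) hpδ _ hF _ ?_ ?_
  · refine Eventually.of_forall fun η t d y hy hyt => ?_
    have hy0 : (y : ℂ) ≠ 0 := Complex.ofReal_ne_zero.mpr (hX.trans hy).ne'
    have i1 : I y = (y : ℂ)⁻¹ := invClamp_apply hX hy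
    have e1 : Real.exp t = y := by rw [hyt, one_mul]
    have e2 : Real.exp (2 * t) = y ^ 2 := by rw [← e1, ← Real.exp_nat_mul]; norm_num
    have e4 : Real.exp (4 * t) = y ^ 4 := by rw [← e1, ← Real.exp_nat_mul]; norm_num
    have k2 : (k : ℂ) ^ 2 = (η₀ : ℂ) ^ 2 := by exact_mod_cast hk2
    have p0 : p η 0 y = (y : ℂ)⁻¹ ^ 3 - (η : ℂ) ^ 2 * (y : ℂ)⁻¹ ^ 2 + ((η : ℂ) ^ 4 - (η₀ : ℂ) ^ 4) := by
      rw [← i1]; simp [hp]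
    have p1 : p η 1 y = -9 / 8 * (y : ℂ)⁻¹ ^ 3 - 5 * (η : ℂ) ^ 2 * (y : ℂ)⁻¹ := by
      rw [← i1]; simp [hp]
    have p2 : p η 2 y = 3 * (y : ℂ)⁻¹ ^ 2 + (2 * (η₀ : ℂ) ^ 2 - 2 * (η : ℂ) ^ 2) := by
      rw [← i1]; simp [hp]
    have p3 : p η 3 y = 5 * (y : ℂ)⁻¹ := by
      rw [← i1]; simp [hp]
    rw [p0, p1, p2, p3, k2, vf, e1, e2, e4]
    simp only [stateOf, Matrix.cons_val, Complex.ofReal_one, one_pow, one_mul, Complex.ofReal_pow]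
    field_simp
    ring
  · filter_upwards [hmem] with η hη t y hy hyt
    have hy0 : (y : ℂ) ≠ 0 := Complex.ofReal_ne_zero.mpr (hX.trans hy).ne'
    rw [clampBdd_apply (hφc η) (hφb η hη), max_eq_left hy.le]
    simp only [hφ]
    have e1 : Real.exp t = y := by rw [hyt, one_mul]
    have h1 : (Real.exp (-(ν' * y)) : ℂ) * Real.exp (ν' * y) = 1 := by
      rw [← Complex.ofReal_mul, ← Real.exp_add]; simp
    rw [e1, neg_mul]
    field_simp
    simp only [Complex.ofReal_one, one_pow, one_mul]
    linear_combination (f y η) * h1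

/-- Decaying solutions for `η = 0`, where the natural variable is `y = x ^ (1 / 4)`. -/
lemma exists_decayingBasis_zero {f : ℝ → ℝ → ℂ}
    (hf : ContinuousOn (fun x => f x 0) (Set.Ioi 0)) (hf' : GInfty f) {ν : ℝ}
    (hν0 : 0 ≤ ν) (hν : ν < 2 ^ (3 / 2 : ℝ)) :
    ∃ T z, DecayingBasis (pure 0) 0 (fun η t => f (Real.exp t) η)
      (fun t => Real.exp (-ν * Real.exp (1 / 4 * t))) T z := by
  set a : ℝ := 2 ^ (3 / 2 : ℝ) with ha
  have ha2 : a ^ 2 = 8 := by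
    rw [ha, ← Real.rpow_natCast, ← Real.rpow_mul (by norm_num)]
    norm_num
  set ν' := (ν + a) / 2 with hν'
  have hνν' : ν < ν' := by rw [hν']; linarith
  have hν'a : ν' < a := by rw [hν']; linarith
  have hν'0 : 0 ≤ ν' := hν0.trans hνν'.le
  set l₁ : ℂ := a * (1 + Complex.I) with hl₁
  set l₂ : ℂ := a * (1 - Complex.I) with hl₂
  have ha2' : (a : ℂ) ^ 2 = 8 := by exact_mod_cast ha2
  have hl1 : l₁ ^ 2 = 16 * Complex.I := by
    rw [hl₁, mul_pow, ha2']
    linear_combination 8 * Complex.I_sq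
  have hl2 : l₂ ^ 2 = -16 * Complex.I := by
    rw [hl₂, mul_pow, ha2']
    linear_combination 8 * Complex.I_sq
  obtain ⟨δ, hδ, H⟩ := exists_decayingBasis_of_perturbation (κ := 1 / 4) (l₁ := l₁) (l₂ := l₂)
    (by norm_num) hν0 hνν' (by simpa [hl₁] using hν'a) (by simpa [hl₂] using hν'a)
  obtain ⟨C, hC⟩ := hf'.decay_zero 0 ν' ⟨hν'0, hν'a⟩
  rw [eventually_map, eventually_atTop] at hC
  obtain ⟨Y, hY⟩ := hC
  set X : ℝ := max (max 1 Y) (27 / δ) with hXd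
  have hX1 : 1 ≤ X := (le_max_left _ _).trans (le_max_left _ _)
  have hXY : Y ≤ X := (le_max_right _ _).trans (le_max_left _ _)
  have hX : 0 < X := by linarith
  have hXδ : 27 * (1 / X) ≤ δ := by
    have h1 : 27 / δ ≤ X := le_max_right _ _
    rw [div_le_iff₀ hδ] at h1
    rw [mul_one_div, div_le_iff₀ hX]
    linarith
  set I := invClamp X hX with hI
  have hIn : ‖I‖ ≤ 1 / X := norm_invClamp_le X hX
  have hI1 : ‖I‖ ≤ 1 := hIn.trans (by rw [div_le_one hX]; exact hX1)
  have hI2 : ‖I ^ 2‖ ≤ 1 / X := by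
    rw [pow_two]
    refine (norm_mul_le _ _).trans ?_
    nlinarith [norm_nonneg I]
  have hI3 : ‖I ^ 3‖ ≤ 1 / X := by
    rw [pow_succ]
    refine (norm_mul_le _ _).trans ?_
    nlinarith [norm_nonneg I, norm_nonneg (I ^ 2)]
  have hXp : 0 < 1 / X := by positivity
  set p : Fin 4 → ℝ →ᵇ ℂ := ![0, ((-27 : ℝ) : ℂ) • I ^ 3, ((-21 : ℝ) : ℂ) • I ^ 2,
    ((2 : ℝ) : ℂ) • I] with hp
  have hns : ∀ (a : ℝ) (w : ℝ →ᵇ ℂ), ‖w‖ ≤ 1 / X → ‖(a : ℂ) • w‖ ≤ |a| * (1 / X) := by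
    intro a w hw
    rw [norm_smul, Complex.norm_real, Real.norm_eq_abs]
    exact mul_le_mul_of_nonneg_left hw (abs_nonneg a)
  have hpδ : ∀ j, ‖p j‖ ≤ δ := by
    intro j
    refine le_trans ?_ hXδ
    fin_cases j
    · change ‖(0 : ℝ →ᵇ ℂ)‖ ≤ _
      rw [norm_zero]
      positivity
    · have h2 := hns (-27) _ hI3
      rw [abs_of_neg (by norm_num), neg_neg] at h2
      exact h2
    · have h2 := hns (-21) _ hI2
      rw [abs_of_neg (by norm_num), neg_neg] at h2
      exact h2.trans (by linarith)
    · have h2 := hns 2 _ hIn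
      rw [abs_of_pos (by norm_num)] at h2
      exact h2.trans (by linarith)
  set φ : ℝ → ℂ := fun y => (Real.exp (ν' * y) : ℂ) * (256 * (y : ℂ)⁻¹ ^ 4 * f (y ^ 4) 0) with hφ
  have hpos : ∀ y ∈ Set.Ici X, 0 < y := fun y hy => hX.trans_le hy
  have hφc : ContinuousOn φ (Set.Ici X) := by
    have h1 : ContinuousOn (fun y : ℝ => f (y ^ 4) 0) (Set.Ici X) :=
      hf.comp (continuous_pow 4).continuousOn fun y hy => pow_pos (hpos y hy) 4
    have h2 : ContinuousOn (fun y : ℝ => (y : ℂ)⁻¹) (Set.Ici X) :=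
      Complex.continuous_ofReal.continuousOn.inv₀ fun y hy =>
        Complex.ofReal_ne_zero.mpr (hpos y hy).ne'
    exact (Continuous.continuousOn (by fun_prop)).mul
      ((continuousOn_const.mul (h2.pow 4)).mul h1)
  have hφb : ∀ y, X ≤ y → ‖φ y‖ ≤ 256 * C := by
    intro y hy
    have hy0 := hpos y hy
    have hy1 : 1 ≤ y := hX1.trans hy
    have h1 := hY (y ^ 4) (by
      have : y ≤ y ^ 4 := le_self_pow₀ hy1 (by norm_num)
      linarith)
    rw [iteratedDeriv_zero] at h1
    have h2 : (y ^ 4) ^ (1 / 4 : ℝ) = y := by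
      rw [← Real.rpow_natCast, ← Real.rpow_mul hy0.le]
      norm_num
    rw [h2] at h1
    simp only [hφ]
    rw [norm_mul, norm_mul, norm_mul, Complex.norm_real, Real.norm_eq_abs,
      abs_of_pos (Real.exp_pos _), norm_pow, norm_inv, Complex.norm_real, Real.norm_eq_abs,
      abs_of_pos hy0]
    have h3 : y⁻¹ ^ 4 ≤ 1 := pow_le_one₀ (inv_nonneg.mpr hy0.le) (inv_le_one_of_one_le₀ hy1)
    have h4 : 0 ≤ Real.exp (ν' * y) * ‖f (y ^ 4) 0‖ := by positivity
    have h5 := mul_le_mul_of_nonneg_left h3 h4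
    norm_num at h5 ⊢
    linarith
  refine H X hX (pure 0) 0 (fun _ => p) (fun j => tendsto_const_nhds) hpδ
    (fun _ => clampBdd X φ) tendsto_const_nhds _ ?_ ?_
  · rw [eventually_pure]
    intro t d y hy hyt
    have hy0 : (y : ℂ) ≠ 0 := Complex.ofReal_ne_zero.mpr (hX.trans hy).ne'
    have i1 : I y = (y : ℂ)⁻¹ := invClamp_apply hX hy
    have e1 : Real.exp t = y ^ 4 := by
      rw [hyt, ← Real.exp_nat_mul]
      congr 1
      push_cast
      ring
    have p0 : p 0 y = 0 := rfl
    have p1 : p 1 y = -27 * (y : ℂ)⁻¹ ^ 3 := by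
      rw [← i1]; simp [hp]
    have p2 : p 2 y = -21 * (y : ℂ)⁻¹ ^ 2 := by
      rw [← i1]; simp [hp]
    have p3 : p 3 y = 2 * (y : ℂ)⁻¹ := by
      rw [← i1]; simp [hp]
    have hsum : l₁ ^ 2 + l₂ ^ 2 = 0 := by rw [hl1, hl2]; ring
    have hprod : l₁ ^ 2 * l₂ ^ 2 = 256 := by
      rw [hl1, hl2]
      linear_combination -256 * Complex.I_sq
    rw [p0, p1, p2, p3, hsum, hprod, vf, e1]
    simp only [stateOf, Matrix.cons_val, Complex.ofReal_pow, Complex.ofReal_zero]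
    push_cast
    field_simp
    ring
  · rw [eventually_pure]
    intro t y hy hyt
    have hy0 : (y : ℂ) ≠ 0 := Complex.ofReal_ne_zero.mpr (hX.trans hy).ne'
    rw [clampBdd_apply hφc hφb, max_eq_left hy.le]
    simp only [hφ]
    have e1 : Real.exp t = y ^ 4 := by
      rw [hyt, ← Real.exp_nat_mul]
      congr 1
      push_cast
      ring
    have h1 : (Real.exp (-(ν' * y)) : ℂ) * Real.exp (ν' * y) = 1 := by
      rw [← Complex.ofReal_mul, ← Real.exp_add]; simp
    rw [e1, neg_mul]
    generalize ((Real.exp (-(ν' * y)) : ℝ) : ℂ) = A at h1 ⊢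
    generalize ((Real.exp (ν' * y) : ℝ) : ℂ) = B at h1 ⊢
    push_cast
    field_simp
    linear_combination 256 * (f (y ^ 4) 0) * h1

end Outer

/-! ### Controlled solutions of the first-order system -/

/-- The weight `wt` decays at infinity faster than every power of `x = e ^ t`. -/
def Rapid (wt : ℝ → ℝ) : Prop :=
  (∀ t, 0 ≤ wt t) ∧ ∀ m : ℕ, ∃ C, 0 ≤ C ∧ ∀ t, 0 ≤ t → wt t ≤ C * Real.exp (-(m * t))

lemma rapid_exp_exp {κ ν : ℝ} (hκ : 0 < κ) (hν : 0 < ν) :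
    Rapid fun t => Real.exp (-ν * Real.exp (κ * t)) := by
  refine ⟨fun t => (Real.exp_pos _).le, fun m => ?_⟩
  obtain ⟨n, hn⟩ := exists_nat_ge (m / κ)
  rw [div_le_iff₀ hκ] at hn
  refine ⟨n.factorial / ν ^ n, by positivity, fun t ht => ?_⟩
  have h1 := Real.pow_div_factorial_le_exp (ν * Real.exp (κ * t)) (by positivity) n
  rw [mul_pow, ← Real.exp_nat_mul] at h1
  have h2 : Real.exp (m * t) ≤ Real.exp (n * (κ * t)) := by
    rw [Real.exp_le_exp]
    nlinarith
  have h3 : ν ^ n * Real.exp (m * t) / n.factorial ≤ Real.exp (ν * Real.exp (κ * t)) :=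
    le_trans (by gcongr) h1
  simp only [neg_mul]
  rw [Real.exp_neg, Real.exp_neg, ← div_eq_mul_inv, div_div,
    inv_le_comm₀ (Real.exp_pos _) (by positivity), inv_div]
  exact h3

/-- The integrability conditions of a controlled solution, in the variable `t = log x`. -/
def StateControlled (U : ℝ → Fin 4 → ℂ) : Prop :=
  ∃ δ ∈ Set.Ioo (0 : ℝ) (1 / 10), ∀ k : ℕ, k ≤ 2 → ∀ j : Fin 4, (j : ℕ) ≤ k →
    ∫⁻ t, ENNReal.ofReal (Real.exp (2 * (δ + k) * t) * ‖U t j‖ ^ 2) < ⊤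

section Control

open MeasureTheory

variable {η : ℝ} {U V : ℝ → Fin 4 → ℂ}

lemma stateControlled_of_bounds (hU : Continuous U) {wt : ℝ → ℝ} (hwt : Rapid wt) {C T T' : ℝ}
    (h0 : ∀ t < T', ‖U t‖ ≤ C) (h1 : ∀ t, T < t → ‖U t‖ ≤ C * wt t) : StateControlled U := by
  refine ⟨1 / 20, by norm_num, fun k hk j _ => ?_⟩
  set a : ℝ := 2 * (1 / 20 + k) with ha
  have hk' : (k : ℝ) ≤ 2 := by exact_mod_cast hk
  have hk0 : (0 : ℝ) ≤ k := by positivity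
  set φ : ℝ → ℝ := fun t => Real.exp (a * t) * ‖U t j‖ ^ 2 with hφ
  have hφc : Continuous φ := by
    have := (continuous_apply j).comp hU
    simp only [Function.comp_def] at this
    fun_prop
  suffices h : Integrable φ by
    exact h.lintegral_lt_top
  set S := max T 0
  set S' := min T' S with hS'
  have hcomp : ∀ t, ‖U t j‖ ≤ ‖U t‖ := fun t => norm_le_pi_norm _ _
  have i1 : IntegrableOn φ (Set.Iic (S' - 1)) := by
    have hb : IntegrableOn (fun t => Real.exp (a * t) * C ^ 2) (Set.Iic (S' - 1)) :=
      (integrableOn_exp_mul_Iic (by positivity) _).mul_const _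
    refine Integrable.mono' hb hφc.aestronglyMeasurable ?_
    filter_upwards [ae_restrict_mem measurableSet_Iic] with t ht
    have ht' : t < T' := by
      have : S' ≤ T' := min_le_left _ _
      have : t ≤ S' - 1 := ht
      linarith
    rw [Real.norm_eq_abs, abs_of_nonneg (by positivity)]
    have := (hcomp t).trans (h0 t ht')
    exact mul_le_mul_of_nonneg_left (pow_le_pow_left₀ (norm_nonneg _) this 2) (Real.exp_pos _).le
  have i2 : IntegrableOn φ (Set.Icc (S' - 1) S) := hφc.continuousOn.integrableOn_Icc
  have i3 : IntegrableOn φ (Set.Ioi S) := by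
    obtain ⟨D, hD, hDb⟩ := hwt.2 3
    have hb : IntegrableOn (fun t => Real.exp (-1 / 2 * t) * (C * D) ^ 2) (Set.Ioi S) :=
      (integrableOn_exp_mul_Ioi (by norm_num) _).mul_const _
    refine Integrable.mono' hb hφc.aestronglyMeasurable ?_
    filter_upwards [ae_restrict_mem measurableSet_Ioi] with t ht
    have htT : T < t := (le_max_left _ _).trans_lt ht
    have ht0 : 0 ≤ t := (le_max_right T 0).trans (le_of_lt ht)
    rw [Real.norm_eq_abs, abs_of_nonneg (by positivity)]
    have h2 : ‖U t j‖ ^ 2 ≤ (C * D) ^ 2 * Real.exp (-(3 * t)) ^ 2 := by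
      have h4 : ‖U t j‖ ≤ |C| * (D * Real.exp (-(3 * t))) := by
        refine (hcomp t).trans ((h1 t htT).trans ?_)
        refine (mul_le_mul_of_nonneg_right (le_abs_self C) (hwt.1 t)).trans ?_
        exact mul_le_mul_of_nonneg_left (by simpa using hDb t ht0) (abs_nonneg C)
      refine (pow_le_pow_left₀ (norm_nonneg _) h4 2).trans (le_of_eq ?_)
      rw [mul_pow, mul_pow, mul_pow, sq_abs]
      ring
    have h3 : Real.exp (a * t) * Real.exp (-(3 * t)) ^ 2 ≤ Real.exp (-1 / 2 * t) := by
      rw [← Real.exp_nat_mul, ← Real.exp_add, Real.exp_le_exp, ha]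
      push_cast
      nlinarith
    calc Real.exp (a * t) * ‖U t j‖ ^ 2
        ≤ Real.exp (a * t) * ((C * D) ^ 2 * Real.exp (-(3 * t)) ^ 2) := by gcongr
      _ = Real.exp (a * t) * Real.exp (-(3 * t)) ^ 2 * (C * D) ^ 2 := by ring
      _ ≤ _ := mul_le_mul_of_nonneg_right h3 (by positivity)
  have hu : Set.Iic (S' - 1) ∪ Set.Icc (S' - 1) S ∪ Set.Ioi S = Set.univ := by
    ext t
    simp only [Set.mem_union, Set.mem_Iic, Set.mem_Icc, Set.mem_Ioi, Set.mem_univ, iff_true]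
    by_cases h : t ≤ S' - 1
    · simp [h]
    · push Not at h
      by_cases h' : t ≤ S
      · exact Or.inl (Or.inr ⟨h.le, h'⟩)
      · exact Or.inr (not_le.mp h')
  rw [← integrableOn_univ, ← hu]
  exact (i1.union i2).union i3

lemma IsSol.continuous {g : ℝ → ℂ} (h : IsSol η g Set.univ U) : Continuous U :=
  continuous_iff_continuousAt.mpr fun t => (h t trivial).continuousAt

/-- Uniqueness of controlled solutions. -/
lemma StateControlled.unique {g : ℝ → ℂ} (hU : IsSol η g Set.univ U) (hV : IsSol η g Set.univ V)
    (cU : StateControlled U) (cV : StateControlled V) : U = V := by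
  obtain ⟨δ, hδ, hUc⟩ := cU
  obtain ⟨δ', hδ', hVc⟩ := cV
  have hW := hU.sub hV
  rw [sub_self] at hW
  have hWe := hW.eq_comb 0
  set c := coords η 0 ((U - V) 0) with hc
  have hsq : ∀ t j, ‖(U - V) t j‖ ^ 2 ≤ 2 * ‖U t j‖ ^ 2 + 2 * ‖V t j‖ ^ 2 := by
    intro t j
    have h1 : ‖(U - V) t j‖ ≤ ‖U t j‖ + ‖V t j‖ := norm_sub_le _ _
    nlinarith [sq_nonneg (‖U t j‖ - ‖V t j‖), norm_nonneg ((U - V) t j), norm_nonneg (U t j),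
      norm_nonneg (V t j)]
  have hint : ∀ (s : Set ℝ), MeasurableSet s → ∀ (b : ℝ) (j : Fin 4) (k : ℕ), k ≤ 2 → (j : ℕ) ≤ k →
      (∀ t ∈ s, b * t ≤ 2 * (δ + k) * t ∧ b * t ≤ 2 * (δ' + k) * t) →
      ∫⁻ t in s, ENNReal.ofReal (Real.exp (b * t) * ‖(U - V) t j‖ ^ 2) < ⊤ := by
    intro s hs b j k hk hj hb
    have hle : ∀ t ∈ s, ENNReal.ofReal (Real.exp (b * t) * ‖(U - V) t j‖ ^ 2)
        ≤ 2 * ENNReal.ofReal (Real.exp (2 * (δ + k) * t) * ‖U t j‖ ^ 2)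
          + 2 * ENNReal.ofReal (Real.exp (2 * (δ' + k) * t) * ‖V t j‖ ^ 2) := by
      intro t ht
      have e2 : (2 : ENNReal) = ENNReal.ofReal 2 := by simp
      rw [e2, ← ENNReal.ofReal_mul (by norm_num), ← ENNReal.ofReal_mul (by norm_num),
        ← ENNReal.ofReal_add (by positivity) (by positivity)]
      refine ENNReal.ofReal_le_ofReal ?_
      have h1 := Real.exp_le_exp.mpr (hb t ht).1
      have h2 := Real.exp_le_exp.mpr (hb t ht).2
      have h3 := mul_le_mul_of_nonneg_left (hsq t j) (Real.exp_pos (b * t)).le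
      have h4 := mul_le_mul_of_nonneg_right h1 (sq_nonneg ‖U t j‖)
      have h5 := mul_le_mul_of_nonneg_right h2 (sq_nonneg ‖V t j‖)
      linarith
    refine (setLIntegral_mono' hs hle).trans_lt ?_
    have hUj := (continuous_apply j).comp hU.continuous
    have hVj := (continuous_apply j).comp hV.continuous
    simp only [Function.comp_def] at hUj hVj
    have m1 : Measurable fun t => 2 * ENNReal.ofReal (Real.exp (2 * (δ + k) * t) * ‖U t j‖ ^ 2) := by
      refine Measurable.const_mul (ENNReal.measurable_ofReal.comp ?_) _
      exact Continuous.measurable (by fun_prop)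
    rw [lintegral_add_left m1, lintegral_const_mul' _ _ (by simp), lintegral_const_mul' _ _ (by simp)]
    refine ENNReal.add_lt_top.mpr ⟨ENNReal.mul_lt_top (by simp) ?_, ENNReal.mul_lt_top (by simp) ?_⟩
    · exact (setLIntegral_le_lintegral _ _).trans_lt (hUc k hk j hj)
    · exact (setLIntegral_le_lintegral _ _).trans_lt (hVc k hk j hj)
  have hsing : c 0 = 0 ∧ c 1 = 0 := by
    refine comb_singular_eq_zero (η := η) (max_lt hδ.2 hδ'.2) ?_
    rw [← hWe]
    refine hint _ measurableSet_Iio (2 * max δ δ') 0 0 (by norm_num) le_rfl fun t ht => ?_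
    have ht' : t < 0 := ht
    simp only [CharP.cast_eq_zero, add_zero]
    constructor
    · nlinarith [le_max_left δ δ']
    · nlinarith [le_max_right δ δ']
  have hc0 : c = 0 := by
    refine comb_eq_zero_of_decay (η := η) hsing.1 hsing.2 ?_
    rw [← hWe]
    have hj : ∀ j : Fin 4, (j : ℕ) ≤ 2 →
        IntegrableOn (fun t => Real.exp (2 * t) * ‖(U - V) t j‖ ^ 2) (Set.Ioi 0) := by
      intro j hj
      have hcj := (continuous_apply j).comp (hU.continuous.sub hV.continuous)
      refine ⟨Continuous.aestronglyMeasurable ?_, ?_⟩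
      · simp only [Function.comp_def] at hcj
        exact (by fun_prop : Continuous fun t : ℝ => Real.exp (2 * t)).mul (hcj.norm.pow 2)
      · rw [hasFiniteIntegral_iff_ofReal (Eventually.of_forall fun t => by positivity)]
        refine hint _ measurableSet_Ioi 2 j 2 le_rfl hj fun t ht => ?_
        have ht' : 0 < t := ht
        push_cast
        constructor
        · nlinarith [hδ.1]
        · nlinarith [hδ'.1]
    have h3 := ((hj 0 (by simp)).add (hj 1 (by simp))).add (hj 2 (by simp))
    refine h3.congr (Eventually.of_forall fun t => ?_)
    simp only [Pi.add_apply]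
    ring
  have h0 : U - V = 0 := by
    rw [hWe, hc0]
    funext t
    simp [comb]
  exact sub_eq_zero.mp h0

lemma comb_eq_zero_of_rapid {c : Fin 4 → ℂ} (h0 : c 0 = 0) (h1 : c 1 = 0) {wt : ℝ → ℝ}
    (hwt : Rapid wt) {C T : ℝ} (hc : ∀ t, T < t → ‖comb c η t‖ ≤ C * wt t) : c = 0 := by
  have hlim : ∀ j : Fin 4, ∀ᶠ t in atBot, ‖comb c η t j‖ ≤ ‖c 2 * (((0 : ℝ) ^ (j : ℕ) : ℝ) : ℂ)‖ + 1 := by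
    intro j
    have h := tendsto_comb_atBot c η 2 (fun k hk => by fin_cases k <;> simp_all) j
    have h' : Tendsto (fun t => comb c η t j) atBot (𝓝 (c 2 * (((0 : ℝ) ^ (j : ℕ) : ℝ) : ℂ))) := by
      simpa [lead] using h
    exact h'.norm.eventually_le_const (by linarith)
  have hle : ∀ j : Fin 4, ‖c 2 * (((0 : ℝ) ^ (j : ℕ) : ℝ) : ℂ)‖ + 1 ≤ ‖c 2‖ + 1 := by
    intro j
    rw [norm_mul]
    have : ‖(((0 : ℝ) ^ (j : ℕ) : ℝ) : ℂ)‖ ≤ 1 := by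
      rw [Complex.norm_real, norm_pow, norm_zero]
      exact pow_le_one₀ le_rfl zero_le_one
    nlinarith [norm_nonneg (c 2)]
  obtain ⟨T', hT'⟩ := eventually_atBot.mp (eventually_all.mpr hlim)
  have hC : ∀ t, T < t → ‖comb c η t‖ ≤ max C (‖c 2‖ + 1) * wt t := fun t ht =>
    (hc t ht).trans (mul_le_mul_of_nonneg_right (le_max_left _ _) (hwt.1 t))
  have hctl := stateControlled_of_bounds (isSol_comb c η).continuous hwt (T' := T')
    (fun t ht => by
      rw [pi_norm_le_iff_of_nonneg ((by positivity : (0 : ℝ) ≤ ‖c 2‖ + 1).trans (le_max_right C _))]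
      exact fun j => (hT' t ht.le j).trans ((hle j).trans (le_max_right _ _))) hC
  have hz : IsSol η 0 Set.univ (comb 0 η) := isSol_comb 0 η
  have hzc : StateControlled (comb 0 η) := by
    refine ⟨1 / 20, by norm_num, fun k _ j _ => ?_⟩
    simp [comb]
  have := StateControlled.unique (isSol_comb c η) hz hctl hzc
  refine eq_zero_of_comb_eq_zero (η := η) fun t => ?_
  rw [this]
  simp [comb]

end Control

/-! ### Matching of the solutions near `0` and near infinity -/

lemma IsSol.eq_add_comb {η : ℝ} {g : ℝ → ℂ} {s : Set ℝ} (hs : s.OrdConnected) {U P : ℝ → Fin 4 → ℂ}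
    (hU : IsSol η g s U) (hP : IsSol η g Set.univ P) {t₀ : ℝ} (ht₀ : t₀ ∈ s) {t : ℝ} (ht : t ∈ s) :
    U t = P t + comb (coords η t₀ (U t₀ - P t₀)) η t := by
  have h1 : IsSol η g s (P + comb (coords η t₀ (U t₀ - P t₀)) η) := by
    have := hP.add (isSol_comb (coords η t₀ (U t₀ - P t₀)) η)
    rw [add_zero] at this
    exact this.mono (Set.subset_univ s)
  refine IsSol.eqOn hs hU h1 ht₀ ?_ ht
  rw [Pi.add_apply, comb_coords]
  abel

/-- The solution with right-hand side `g` and coordinates `σ` at `x = 1`. -/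
def fullSol (η : ℝ) (g : ℝ → ℂ) (σ : Fin 4 → ℂ) (t : ℝ) : Fin 4 → ℂ :=
  varConst η g t + comb σ η t

lemma isSol_fullSol (η : ℝ) {g : ℝ → ℂ} (hg : Continuous g) (σ : Fin 4 → ℂ) :
    IsSol η g Set.univ (fullSol η g σ) := by
  have := (isSol_varConst η hg).add (isSol_comb σ η)
  rwa [add_zero] at this

section Matching

attribute [local irreducible] coords varConst expState expD innerCoeff

variable {l : Filter ℝ} {η₀ : ℝ}

lemma tendsto_coords (hid : Tendsto (fun η : ℝ => η) l (𝓝 η₀)) (t : ℝ) {u : ℝ → Fin 4 → ℂ}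
    (hu : Tendsto u l (𝓝 (u η₀))) :
    Tendsto (fun η => coords η t (u η)) l (𝓝 (coords η₀ t (u η₀))) :=
  Tendsto.comp (g := fun z : (Fin 4 → ℂ) × ℝ × ℝ => coords z.2.1 z.2.2 z.1)
    (f := fun η => (u η, η, t)) (continuous_coords.tendsto (u η₀, η₀, t))
    (hu.prodMk_nhds (hid.prodMk_nhds tendsto_const_nhds))

lemma tendsto_varConst {J : Set ℝ} {g : ℝ → ℝ → ℂ} (hg : Continuous fun z : J × ℝ => g z.1 z.2)
    (hη₀ : η₀ ∈ J) (t : ℝ) :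
    Tendsto (fun η => varConst η (g η) t) (𝓝[J] η₀) (𝓝 (varConst η₀ (g η₀) t)) := by
  have h2 := continuous_varConst (Λ := J) (e := fun η => (η : ℝ)) continuous_subtype_val
    (g := fun η => g η) hg
  have h3 : Continuous fun η : J => varConst η (g η) t := h2.comp (Continuous.prodMk_left t)
  have h4 : ContinuousOn (fun η => varConst η (g η) t) J := continuousOn_iff_continuous_domRestrict.mpr h3
  exact h4 η₀ hη₀

/-- The coordinates of the solutions that are regular at `x = 0`. -/
lemma exists_regular_coords {J : Set ℝ} {g : ℝ → ℝ → ℂ}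
    (hg : Continuous fun z : J × ℝ => g z.1 z.2) {c : ℝ → ℕ × ℕ → ℂ} {T₀ : ℝ}
    (hc : ∀ η ∈ J, wnorm T₀ (c η) < ⊤)
    (hcc : ∀ η₀ ∈ J, Tendsto (fun η => wnorm T₀ (c η - c η₀)) (𝓝[J] η₀) (𝓝 0))
    (h0 : ∀ η ∈ J, ∀ l, c η (0, l) = 0) (h1 : ∀ η ∈ J, c η (1, 1) = 0)
    (hgc : ∀ η ∈ J, ∀ t < T₀, g η t = expSeries (c η) t) (hη₀ : η₀ ∈ J) :
    ∃ d : ℝ → Fin 4 → ℂ, Tendsto d (𝓝[J] η₀) (𝓝 (d η₀)) ∧ ∀ η ∈ J, ∀ A B : ℂ, ∀ t < T₀,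
      expState 0 (innerCoeff η (c η) A B) t
        = varConst η (g η) t + comb (d η) η t + A • phi 2 η t + B • phi 3 η t := by
  have hid : Tendsto (fun η : ℝ => η) (𝓝[J] η₀) (𝓝 η₀) := nhdsWithin_le_nhds
  have ht₀ : T₀ - 1 < T₀ := by linarith
  have hVt : Tendsto (fun η => expState 0 (innerCoeff η (c η) 0 0) (T₀ - 1)) (𝓝[J] η₀)
      (𝓝 (expState 0 (innerCoeff η₀ (c η₀) 0 0) (T₀ - 1))) := by
    rw [tendsto_pi_nhds]
    intro j
    simp only [expState]
    have h2 := tendsto_expD 0 j ht₀ (wnorm_innerCoeff_lt_top (hc η₀ hη₀) η₀ 0 0)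
      (tendsto_wnorm_innerCoeff hid (hc η₀ hη₀) (hcc η₀ hη₀)
        (tendsto_const_nhds (x := (0 : ℂ))) (tendsto_const_nhds (x := (0 : ℂ))))
    exact Tendsto.comp (g := fun z : ℝ × ℝ => expD 0 (innerCoeff z.1 (c z.1) 0 0) j z.2)
      (f := fun η : ℝ => (η, T₀ - 1)) h2 (tendsto_id.prodMk tendsto_const_nhds)
  refine ⟨fun η => coords η (T₀ - 1)
    (expState 0 (innerCoeff η (c η) 0 0) (T₀ - 1) - varConst η (g η) (T₀ - 1)),
    tendsto_coords hid _ (u := fun η => expState 0 (innerCoeff η (c η) 0 0) (T₀ - 1)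
      - varConst η (g η) (T₀ - 1)) (hVt.sub (tendsto_varConst hg hη₀ _)), fun η hη A B t ht => ?_⟩
  have hs : IsSol η (g η) (Set.Iio T₀) (expState 0 (innerCoeff η (c η) 0 0)) :=
    (isSol_innerCoeff (h0 η hη) (h1 η hη) (hc η hη) η 0 0).congr fun t ht => (hgc η hη t ht).symm
  have hgη : Continuous (g η) := hg.comp (Continuous.prodMk_right (⟨η, hη⟩ : J))
  rw [expState_innerCoeff (hc η hη) η A B ht, ← hs.eq_add_comb Set.ordConnected_Iio
    (isSol_varConst η hgη) (t₀ := T₀ - 1) ht₀ ht]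

/-- The coordinates of the decaying solutions. -/
lemma DecayingBasis.exists_coords {J : Set ℝ} {g : ℝ → ℝ → ℂ}
    (hg : Continuous fun z : J × ℝ => g z.1 z.2) (hη₀ : η₀ ∈ J) (hl : 𝓝[J] η₀ ≤ l) {wt : ℝ → ℝ}
    (hwt : ∀ t, 0 ≤ wt t) {T : ℝ} {z : Fin 3 → ℝ → ℝ → Fin 4 → ℂ}
    (hz : DecayingBasis l η₀ g wt T z) :
    ∃ e₀ e₁ e₂ : ℝ → Fin 4 → ℂ, Tendsto e₀ (𝓝[J] η₀) (𝓝 (e₀ η₀)) ∧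
      Tendsto e₁ (𝓝[J] η₀) (𝓝 (e₁ η₀)) ∧ Tendsto e₂ (𝓝[J] η₀) (𝓝 (e₂ η₀)) ∧
      ∀ᶠ η in 𝓝[J] η₀, η ∈ J ∧
        (∀ t, T < t → z 0 η t = varConst η (g η) t + comb (e₀ η) η t) ∧
        (∀ t, T < t → z 1 η t = comb (e₁ η) η t) ∧ (∀ t, T < t → z 2 η t = comb (e₂ η) η t) := by
  have hid : Tendsto (fun η : ℝ => η) (𝓝[J] η₀) (𝓝 η₀) := nhdsWithin_le_nhds
  have ht₁ : T < T + 1 := by linarith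
  have hzt : ∀ i, Tendsto (fun η => z i η (T + 1)) (𝓝[J] η₀) (𝓝 (z i η₀ (T + 1))) := by
    intro i
    rw [Metric.tendsto_nhds]
    intro e he
    have hw := hwt (T + 1)
    have hpos : 0 < e / (wt (T + 1) + 1) := div_pos he (by linarith)
    filter_upwards [hl (hz.tendsto i _ hpos)] with η hη
    rw [dist_eq_norm]
    refine (hη _ ht₁).trans_lt ?_
    rw [div_mul_eq_mul_div, div_lt_iff₀ (by linarith)]
    nlinarith
  refine ⟨fun η => coords η (T + 1) (z 0 η (T + 1) - varConst η (g η) (T + 1)),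
    fun η => coords η (T + 1) (z 1 η (T + 1)), fun η => coords η (T + 1) (z 2 η (T + 1)),
    tendsto_coords hid _ (u := fun η => z 0 η (T + 1) - varConst η (g η) (T + 1))
      ((hzt 0).sub (tendsto_varConst hg hη₀ _)),
    tendsto_coords hid _ (u := fun η => z 1 η (T + 1)) (hzt 1),
    tendsto_coords hid _ (u := fun η => z 2 η (T + 1)) (hzt 2), ?_⟩
  filter_upwards [hl hz.isSol, self_mem_nhdsWithin] with η hη hηJ
  obtain ⟨k0, k1, k2⟩ := hη
  have hz0 : IsSol η 0 Set.univ (0 : ℝ → Fin 4 → ℂ) := by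
    simpa using (isSol_comb 0 η).smul 0
  have hgη : Continuous (g η) := hg.comp (Continuous.prodMk_right (⟨η, hηJ⟩ : J))
  refine ⟨hηJ, fun t ht => k0.eq_add_comb Set.ordConnected_Ioi (isSol_varConst η hgη) ht₁ ht,
    fun t ht => ?_, fun t ht => ?_⟩
  · simpa using k1.eq_add_comb Set.ordConnected_Ioi hz0 ht₁ ht
  · simpa using k2.eq_add_comb Set.ordConnected_Ioi hz0 ht₁ ht

/-- Cramer's rule for the two singular coordinates, with parameters. -/
lemma exists_cramer {d e₀ e₁ e₂ : ℝ → Fin 4 → ℂ} (hd : Tendsto d l (𝓝 (d η₀)))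
    (h₀ : Tendsto e₀ l (𝓝 (e₀ η₀))) (h₁ : Tendsto e₁ l (𝓝 (e₁ η₀))) (h₂ : Tendsto e₂ l (𝓝 (e₂ η₀)))
    (hdet : e₁ η₀ 0 * e₂ η₀ 1 - e₂ η₀ 0 * e₁ η₀ 1 ≠ 0) :
    ∃ s₁ s₂ : ℝ → ℂ, Tendsto s₁ l (𝓝 (s₁ η₀)) ∧ Tendsto s₂ l (𝓝 (s₂ η₀)) ∧ ∀ᶠ η in l,
      e₀ η 0 + s₁ η * e₁ η 0 + s₂ η * e₂ η 0 = d η 0 ∧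
      e₀ η 1 + s₁ η * e₁ η 1 + s₂ η * e₂ η 1 = d η 1 := by
  have tc : ∀ {u : ℝ → Fin 4 → ℂ}, Tendsto u l (𝓝 (u η₀)) → ∀ j,
      Tendsto (fun η => u η j) l (𝓝 (u η₀ j)) := fun hu j => tendsto_pi_nhds.mp hu j
  have hΔt := ((tc h₁ 0).mul (tc h₂ 1)).sub ((tc h₂ 0).mul (tc h₁ 1))
  refine ⟨fun η => ((d η 0 - e₀ η 0) * e₂ η 1 - e₂ η 0 * (d η 1 - e₀ η 1))
      / (e₁ η 0 * e₂ η 1 - e₂ η 0 * e₁ η 1),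
    fun η => (e₁ η 0 * (d η 1 - e₀ η 1) - (d η 0 - e₀ η 0) * e₁ η 1)
      / (e₁ η 0 * e₂ η 1 - e₂ η 0 * e₁ η 1),
    ((((tc hd 0).sub (tc h₀ 0)).mul (tc h₂ 1)).sub
      ((tc h₂ 0).mul ((tc hd 1).sub (tc h₀ 1)))).div hΔt hdet,
    (((tc h₁ 0).mul ((tc hd 1).sub (tc h₀ 1))).sub
      (((tc hd 0).sub (tc h₀ 0)).mul (tc h₁ 1))).div hΔt hdet, ?_⟩
  filter_upwards [hΔt.eventually_ne hdet] with η hη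
  obtain ⟨Δ, hΔ⟩ : ∃ Δ, Δ = e₁ η 0 * e₂ η 1 - e₂ η 0 * e₁ η 1 := ⟨_, rfl⟩
  rw [← hΔ] at hη ⊢
  constructor <;> field_simp <;> rw [hΔ] <;> ring

/-- The one-parameter families of solutions that are regular at `x = 0` and that decay at infinity
intersect in exactly one solution, which depends continuously on `η`. -/
lemma exists_matching {J : Set ℝ} {g : ℝ → ℝ → ℂ}
    (hg : Continuous fun z : J × ℝ => g z.1 z.2) {c : ℝ → ℕ × ℕ → ℂ} {T₀ : ℝ}
    (hc : ∀ η ∈ J, wnorm T₀ (c η) < ⊤)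
    (hcc : ∀ η₀ ∈ J, Tendsto (fun η => wnorm T₀ (c η - c η₀)) (𝓝[J] η₀) (𝓝 0))
    (h0 : ∀ η ∈ J, ∀ l, c η (0, l) = 0) (h1 : ∀ η ∈ J, c η (1, 1) = 0)
    (hgc : ∀ η ∈ J, ∀ t < T₀, g η t = expSeries (c η) t)
    (hη₀ : η₀ ∈ J) (hl : 𝓝[J] η₀ ≤ l) {wt : ℝ → ℝ} (hwt : Rapid wt) {T : ℝ}
    {z : Fin 3 → ℝ → ℝ → Fin 4 → ℂ} (hz : DecayingBasis l η₀ g wt T z) :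
    ∃ (σ : ℝ → Fin 4 → ℂ) (A B s₁ s₂ : ℝ → ℂ), Tendsto σ (𝓝[J] η₀) (𝓝 (σ η₀)) ∧
      Tendsto A (𝓝[J] η₀) (𝓝 (A η₀)) ∧ Tendsto B (𝓝[J] η₀) (𝓝 (B η₀)) ∧
      Tendsto s₁ (𝓝[J] η₀) (𝓝 (s₁ η₀)) ∧ Tendsto s₂ (𝓝[J] η₀) (𝓝 (s₂ η₀)) ∧
      ∀ᶠ η in 𝓝[J] η₀, (∀ t < T₀, fullSol η (g η) (σ η) t
          = expState 0 (innerCoeff η (c η) (A η) (B η)) t) ∧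
        ∀ t, T < t → fullSol η (g η) (σ η) t = z 0 η t + s₁ η • z 1 η t + s₂ η • z 2 η t := by
  obtain ⟨d, dt, hd⟩ := exists_regular_coords hg hc hcc h0 h1 hgc hη₀
  obtain ⟨e₀, e₁, e₂, et₀, et₁, et₂, hev⟩ := hz.exists_coords hg hη₀ hl hwt.1
  have hself := hev.self_of_nhdsWithin hη₀
  -- the decaying homogeneous solutions have independent singular parts
  have hΔ : e₁ η₀ 0 * e₂ η₀ 1 - e₂ η₀ 0 * e₁ η₀ 1 ≠ 0 := by
    intro hzero
    have hdet : (!![e₁ η₀ 0, e₂ η₀ 0; e₁ η₀ 1, e₂ η₀ 1] : Matrix (Fin 2) (Fin 2) ℂ).det = 0 := by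
      rw [Matrix.det_fin_two_of]
      exact hzero
    obtain ⟨s, hs, hs0⟩ := Matrix.exists_mulVec_eq_zero_iff.mpr hdet
    have q0 : e₁ η₀ 0 * s 0 + e₂ η₀ 0 * s 1 = 0 := by
      simpa [Matrix.mulVec, dotProduct, Fin.sum_univ_two] using congrFun hs0 0
    have q1 : e₁ η₀ 1 * s 0 + e₂ η₀ 1 * s 1 = 0 := by
      simpa [Matrix.mulVec, dotProduct, Fin.sum_univ_two] using congrFun hs0 1
    have hcz : ∀ t, T < t → comb (s 0 • e₁ η₀ + s 1 • e₂ η₀) η₀ t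
        = s 0 • z 1 η₀ t + s 1 • z 2 η₀ t := by
      intro t ht
      rw [comb_add, comb_smul, comb_smul, hself.2.2.1 t ht, hself.2.2.2 t ht]
    obtain ⟨C, hC⟩ := hz.bound
    have hzero : s 0 • e₁ η₀ + s 1 • e₂ η₀ = 0 := by
      refine comb_eq_zero_of_rapid (η := η₀) ?_ ?_ hwt (C := ‖s 0‖ * C + ‖s 1‖ * C) (T := T) ?_
      · simp only [Pi.add_apply, Pi.smul_apply, smul_eq_mul]
        linear_combination q0
      · simp only [Pi.add_apply, Pi.smul_apply, smul_eq_mul]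
        linear_combination q1
      · intro t ht
        rw [hcz t ht]
        refine (norm_add_le _ _).trans ?_
        rw [norm_smul, norm_smul, add_mul, mul_assoc, mul_assoc]
        exact add_le_add (mul_le_mul_of_nonneg_left (hC 1 t ht) (norm_nonneg _))
          (mul_le_mul_of_nonneg_left (hC 2 t ht) (norm_nonneg _))
    obtain ⟨r0, r1⟩ := hz.indep (s 0) (s 1) fun t ht => by
      rw [← hcz t ht, hzero]
      simp [comb]
    refine hs (funext fun i => ?_)
    fin_cases i
    · exact r0
    · exact r1
  obtain ⟨s₁, s₂, st₁, st₂, hs⟩ := exists_cramer dt et₀ et₁ et₂ hΔ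
  have σt := (et₀.add (st₁.smul et₁)).add (st₂.smul et₂)
  have tc : ∀ {u : ℝ → Fin 4 → ℂ} {w : Fin 4 → ℂ}, Tendsto u (𝓝[J] η₀) (𝓝 w) → ∀ j,
      Tendsto (fun η => u η j) (𝓝[J] η₀) (𝓝 (w j)) := fun hu j => tendsto_pi_nhds.mp hu j
  refine ⟨fun η => e₀ η + s₁ η • e₁ η + s₂ η • e₂ η,
    fun η => (e₀ η + s₁ η • e₁ η + s₂ η • e₂ η) 2 - d η 2,
    fun η => (e₀ η + s₁ η • e₁ η + s₂ η • e₂ η) 3 - d η 3, s₁, s₂, σt,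
    (tc σt 2).sub (tc dt 2), (tc σt 3).sub (tc dt 3), st₁, st₂, ?_⟩
  filter_upwards [hev, hs] with η hη hsη
  obtain ⟨hηJ, hzη0, hzη1, hzη2⟩ := hη
  have hσ : e₀ η + s₁ η • e₁ η + s₂ η • e₂ η = d η
      + ((e₀ η + s₁ η • e₁ η + s₂ η • e₂ η) 2 - d η 2) • Pi.single 2 1
      + ((e₀ η + s₁ η • e₁ η + s₂ η • e₂ η) 3 - d η 3) • Pi.single 3 1 := by
    funext j
    fin_cases j
    · simpa using hsη.1
    · simpa using hsη.2
    · simp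
    · simp
  have hsingle : ∀ (j : Fin 4) (t : ℝ), comb (Pi.single j 1) η t = phi j η t := by
    intro j t
    rw [comb, Finset.sum_eq_single j]
    · simp
    · intro k _ hk
      simp [hk]
    · simp
  constructor
  · intro t ht
    rw [hd η hηJ _ _ t ht, fullSol]
    conv_lhs => rw [hσ]
    rw [comb_add, comb_add, comb_smul, comb_smul, hsingle, hsingle]
    abel
  · intro t ht
    rw [hzη0 t ht, hzη1 t ht, hzη2 t ht, fullSol]
    simp only [comb_add, comb_smul]
    abel

end Matching

/-! ### Solutions of the resolvent equation and of the system -/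

lemma q_eq : q = Polynomial.X ^ 4 - Polynomial.X ^ 3 - Polynomial.X ^ 2
    - Polynomial.C (1 / 8) * Polynomial.X := by
  have h1 : (Polynomial.C (1 / 2) : ℝ[X]) * Polynomial.C (1 / 4) = Polynomial.C (1 / 8) := by
    rw [← Polynomial.C_mul]; norm_num
  have h2 : (Polynomial.C (1 / 2) : ℝ[X]) * Polynomial.C (3 / 2) + Polynomial.C (1 / 4) = 1 := by
    rw [← Polynomial.C_mul, ← Polynomial.C_add, ← Polynomial.C_1]; norm_num
  have h3 : (Polynomial.C (3 / 2) : ℝ[X]) = 1 + Polynomial.C (1 / 2) := by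
    rw [← Polynomial.C_1, ← Polynomial.C_add]; norm_num
  unfold q
  linear_combination (-Polynomial.X : ℝ[X]) * h1 - Polynomial.X ^ 2 * h2 - Polynomial.X ^ 3 * h3

lemma r_eq : r = Polynomial.C 2 * Polynomial.X ^ 2 + Polynomial.C 3 * Polynomial.X
    + Polynomial.C 1 := by
  have h1 : (Polynomial.C 2 : ℝ[X]) * Polynomial.C (1 / 2) = 1 := by
    rw [← Polynomial.C_mul, ← Polynomial.C_1]; norm_num
  have h2 : (Polynomial.C 3 : ℝ[X]) = Polynomial.C 2 + 1 := by
    rw [← Polynomial.C_1, ← Polynomial.C_add]; norm_num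
  unfold r
  rw [h2, Polynomial.C_1]
  linear_combination (Polynomial.X + 1 : ℝ[X]) * h1

lemma polyOp_q (v : ℝ → ℂ) (x : ℝ) : polyOp q v x
    = (Dx^[4] v) x - (Dx^[3] v) x - (Dx^[2] v) x - (Dx^[1] v) x / 8 := by
  have hdeg : q.natDegree < 5 := by
    rw [q_eq]
    refine lt_of_le_of_lt (b := 4) ?_ (by norm_num)
    compute_degree
  rw [polyOp, Polynomial.sum_over_range' _ (by simp) 5 hdeg, q_eq]
  simp only [Finset.sum_range_succ, Finset.sum_range_zero, Polynomial.coeff_sub,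
    Polynomial.coeff_X_pow, Polynomial.coeff_C_mul, Polynomial.coeff_X]
  norm_num
  ring

lemma polyOp_r (v : ℝ → ℂ) (x : ℝ) : polyOp r v x
    = 2 * (Dx^[2] v) x + 3 * (Dx^[1] v) x + v x := by
  have hdeg : r.natDegree < 3 := by
    rw [r_eq]
    refine lt_of_le_of_lt (b := 2) ?_ (by norm_num)
    compute_degree
  rw [polyOp, Polynomial.sum_over_range' _ (by simp) 3 hdeg, r_eq]
  simp only [Finset.sum_range_succ, Finset.sum_range_zero, Polynomial.coeff_add,
    Polynomial.coeff_X_pow, Polynomial.coeff_C_mul, Polynomial.coeff_X, Polynomial.coeff_C]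
  norm_num
  ring

lemma contDiffOn_iterate_Dx {v : ℝ → ℂ} (hv : ContDiffOn ℝ ∞ v (Set.Ioi 0)) (j : ℕ) :
    ContDiffOn ℝ ∞ (Dx^[j] v) (Set.Ioi 0) := by
  induction j with
  | zero => exact hv
  | succ j ih =>
    rw [Function.iterate_succ_apply']
    have h1 : ContDiffOn ℝ ∞ (deriv (Dx^[j] v)) (Set.Ioi 0) :=
      ((contDiffOn_infty_iff_deriv_of_isOpen isOpen_Ioi).mp ih).2
    exact Complex.ofRealCLM.contDiff.contDiffOn.mul h1

lemma hasDerivAt_comp_exp {w : ℝ → ℂ} {t : ℝ} (hw : DifferentiableAt ℝ w (Real.exp t)) :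
    HasDerivAt (fun t => w (Real.exp t)) (Dx w (Real.exp t)) t := by
  refine (hw.hasDerivAt.scomp t (Real.hasDerivAt_exp t)).congr_deriv ?_
  rw [Complex.real_smul, Dx]

/-- The state `(v, D v, D² v, D³ v)` at `x = e ^ t`. -/
def dState (v : ℝ → ℂ) (t : ℝ) (j : Fin 4) : ℂ := (Dx^[j] v) (Real.exp t)

lemma hasDerivAt_iterate_Dx {v : ℝ → ℂ} (hv : ContDiffOn ℝ ∞ v (Set.Ioi 0)) (j : ℕ) (t : ℝ) :
    HasDerivAt (fun t => (Dx^[j] v) (Real.exp t)) ((Dx^[j + 1] v) (Real.exp t)) t := by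
  rw [Function.iterate_succ_apply']
  refine hasDerivAt_comp_exp ?_
  exact ((contDiffOn_iterate_Dx hv j).contDiffAt (Ioi_mem_nhds (Real.exp_pos t))).differentiableAt
    (by simp)

lemma solvesResolvent_iff {f v : ℝ → ℂ} {η : ℝ} :
    SolvesResolvent f η v ↔
      ∀ t, (Dx^[4] v) (Real.exp t) = vf η t (dState v t) + f (Real.exp t) := by
  have key : ∀ t, ((Real.exp t : ℝ) : ℂ) * v (Real.exp t) + polyOp q v (Real.exp t)
      - (η : ℂ) ^ 2 * ((Real.exp t : ℝ) : ℂ) ^ 2 * polyOp r v (Real.exp t)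
      + (η : ℂ) ^ 4 * ((Real.exp t : ℝ) : ℂ) ^ 4 * v (Real.exp t)
      = (Dx^[4] v) (Real.exp t) - vf η t (dState v t) := by
    intro t
    have e2 : Real.exp (2 * t) = Real.exp t ^ 2 := by rw [← Real.exp_nat_mul]; norm_num
    have e4 : Real.exp (4 * t) = Real.exp t ^ 4 := by rw [← Real.exp_nat_mul]; norm_num
    rw [polyOp_q, polyOp_r, vf, e2, e4]
    simp only [dState, Fin.isValue, Fin.val_zero, Fin.val_one, Fin.val_two,
      show ((3 : Fin 4) : ℕ) = 3 from rfl, Function.iterate_zero, id]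
    push_cast
    ring
  constructor
  · intro h t
    have h1 := h _ (Real.exp_pos t)
    rw [key] at h1
    rw [← h1]
    ring
  · intro h x hx
    have h1 := key (Real.log x)
    rw [h (Real.log x), Real.exp_log hx] at h1
    rw [h1]
    ring

lemma SolvesResolvent.isSol {f v : ℝ → ℂ} {η : ℝ} (hv : ContDiffOn ℝ ∞ v (Set.Ioi 0))
    (h : SolvesResolvent f η v) : IsSol η (fun t => f (Real.exp t)) Set.univ (dState v) := by
  rw [isSol_iff]
  intro t _
  refine ⟨hasDerivAt_iterate_Dx hv 0 t, hasDerivAt_iterate_Dx hv 1 t, hasDerivAt_iterate_Dx hv 2 t, ?_⟩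
  rw [← solvesResolvent_iff.mp h t]
  exact hasDerivAt_iterate_Dx hv 3 t

lemma contDiff_vf {n : WithTop ℕ∞} (η : ℝ) {U : ℝ → Fin 4 → ℂ} (hU : ContDiff ℝ n U) :
    ContDiff ℝ n fun t => vf η t (U t) := by
  have hc : ∀ j, ContDiff ℝ n fun t => U t j := fun j => contDiff_pi.mp hU j
  have he : ∀ a : ℝ, ContDiff ℝ n fun t : ℝ => ((Real.exp (a * t) : ℝ) : ℂ) := fun a =>
    Complex.ofRealCLM.contDiff.comp (Real.contDiff_exp.comp (contDiff_const.mul contDiff_id))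
  have he1 : ContDiff ℝ n fun t : ℝ => ((Real.exp t : ℝ) : ℂ) :=
    Complex.ofRealCLM.contDiff.comp Real.contDiff_exp
  unfold vf
  have h0 := hc 0
  have h1 := hc 1
  have h2 := hc 2
  have h3 := hc 3
  have e2 := he 2
  have e4 := he 4
  exact (((((h3.add h2).add (h1.div_const 8)).sub (he1.mul h0)).add
    ((contDiff_const.mul e2).mul (((contDiff_const.mul h2).add (contDiff_const.mul h1)).add h0))).sub
    ((contDiff_const.mul e4).mul h0))

lemma IsSol.contDiff {η : ℝ} {g : ℝ → ℂ} {U : ℝ → Fin 4 → ℂ} (hU : IsSol η g Set.univ U)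
    (hg : ContDiff ℝ ∞ g) : ContDiff ℝ ∞ U := by
  rw [contDiff_infty]
  intro n
  induction n with
  | zero => exact contDiff_zero.mpr hU.continuous
  | succ n ih =>
    push_cast
    rw [contDiff_succ_iff_deriv]
    refine ⟨fun t => (hU t trivial).differentiableAt, by simp, ?_⟩
    have hd : deriv U = fun t => ![U t 1, U t 2, U t 3, vf η t (U t) + g t] :=
      funext fun t => (hU t trivial).deriv
    rw [hd]
    have hc : ∀ j, ContDiff ℝ n fun t => U t j := fun j => contDiff_pi.mp ih j
    have hvf := (contDiff_vf η ih).add (hg.of_le (by exact_mod_cast le_top))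
    refine contDiff_pi.mpr fun j => ?_
    fin_cases j
    · exact hc 1
    · exact hc 2
    · exact hc 3
    · exact hvf

/-- The function of `x` that belongs to a solution of the system. -/
def ofState (U : ℝ → Fin 4 → ℂ) (x : ℝ) : ℂ := U (Real.log x) 0

section OfState

variable {η : ℝ} {f : ℝ → ℂ} {U : ℝ → Fin 4 → ℂ}

lemma hasDerivAt_comp_log {u : ℝ → ℂ} {u' : ℂ} {x : ℝ} (hx : 0 < x)
    (hu : HasDerivAt u u' (Real.log x)) :
    HasDerivAt (fun x => u (Real.log x)) ((x : ℂ)⁻¹ * u') x := by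
  refine (hu.scomp x (Real.hasDerivAt_log hx.ne')).congr_deriv ?_
  rw [Complex.real_smul, Complex.ofReal_inv]

lemma Dx_comp_log {u : ℝ → ℂ} {u' : ℂ} {x : ℝ} (hx : 0 < x) {w : ℝ → ℂ}
    (hw : ∀ y, 0 < y → w y = u (Real.log y)) (hu : HasDerivAt u u' (Real.log x)) : Dx w x = u' := by
  have h1 : w =ᶠ[𝓝 x] fun x => u (Real.log x) := by
    filter_upwards [Ioi_mem_nhds hx] with y hy
    exact hw y hy
  rw [Dx, h1.deriv_eq, (hasDerivAt_comp_log hx hu).deriv]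
  have : (x : ℂ) ≠ 0 := Complex.ofReal_ne_zero.mpr hx.ne'
  field_simp

lemma iterate_Dx_ofState (hU : IsSol η (fun t => f (Real.exp t)) Set.univ U) :
    (∀ j : Fin 4, ∀ x, 0 < x → (Dx^[j] (ofState U)) x = U (Real.log x) j) ∧
      ∀ x, 0 < x → (Dx^[4] (ofState U)) x = vf η (Real.log x) (U (Real.log x)) + f x := by
  rw [isSol_iff] at hU
  have h0 : ∀ x, 0 < x → (Dx^[0] (ofState U)) x = U (Real.log x) 0 := fun x _ => rfl
  have h1 : ∀ x, 0 < x → (Dx^[1] (ofState U)) x = U (Real.log x) 1 := by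
    intro x hx
    rw [Function.iterate_succ_apply']
    exact Dx_comp_log (u := fun t => U t 0) hx h0 (hU _ trivial).1
  have h2 : ∀ x, 0 < x → (Dx^[2] (ofState U)) x = U (Real.log x) 2 := by
    intro x hx
    rw [Function.iterate_succ_apply']
    exact Dx_comp_log hx h1 (hU _ trivial).2.1
  have h3 : ∀ x, 0 < x → (Dx^[3] (ofState U)) x = U (Real.log x) 3 := by
    intro x hx
    rw [Function.iterate_succ_apply']
    exact Dx_comp_log hx h2 (hU _ trivial).2.2.1
  refine ⟨fun j => ?_, fun x hx => ?_⟩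
  · fin_cases j
    · exact h0
    · exact h1
    · exact h2
    · exact h3
  · rw [Function.iterate_succ_apply']
    have := Dx_comp_log hx h3 (hU _ trivial).2.2.2
    rwa [Real.exp_log hx] at this

lemma dState_ofState (hU : IsSol η (fun t => f (Real.exp t)) Set.univ U) : dState (ofState U) = U := by
  funext t j
  rw [dState, (iterate_Dx_ofState hU).1 j _ (Real.exp_pos t), Real.log_exp]

lemma solvesResolvent_ofState (hU : IsSol η (fun t => f (Real.exp t)) Set.univ U) :
    SolvesResolvent f η (ofState U) := by
  rw [solvesResolvent_iff]
  intro t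
  rw [(iterate_Dx_ofState hU).2 _ (Real.exp_pos t), Real.log_exp, dState_ofState hU]

lemma contDiffOn_ofState (hU : IsSol η (fun t => f (Real.exp t)) Set.univ U)
    (hf : ContDiffOn ℝ ∞ f (Set.Ioi 0)) : ContDiffOn ℝ ∞ (ofState U) (Set.Ioi 0) := by
  have hg : ContDiff ℝ ∞ fun t => f (Real.exp t) := by
    rw [← contDiffOn_univ]
    exact hf.comp Real.contDiff_exp.contDiffOn fun t _ => Real.exp_pos t
  have h0 : ContDiff ℝ ∞ fun t => U t 0 := contDiff_pi.mp (hU.contDiff hg) 0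
  exact h0.comp_contDiffOn (Real.contDiffOn_log.mono fun x hx => ne_of_gt hx)

end OfState

open MeasureTheory in
lemma lintegral_Ioi_eq_lintegral_exp (F : ℝ → ENNReal) :
    ∫⁻ x in Set.Ioi (0 : ℝ), F x = ∫⁻ t, ENNReal.ofReal (Real.exp t) * F (Real.exp t) := by
  have h := lintegral_image_eq_lintegral_abs_deriv_mul (f := Real.exp) (f' := Real.exp)
    MeasurableSet.univ (fun t _ => (Real.hasDerivAt_exp t).hasDerivWithinAt)
    Real.exp_injective.injOn F
  rw [Set.image_univ, Real.range_exp] at h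
  simpa [abs_of_pos (Real.exp_pos _)] using h

open MeasureTheory in
lemma weightedNormSq_eq (k : ℕ) (δ : ℝ) (v : ℝ → ℂ) :
    weightedNormSq k (-δ - k) v = ∑ j ∈ Finset.range (k + 1),
      ∫⁻ t, ENNReal.ofReal (Real.exp (2 * (δ + k) * t) * ‖(Dx^[j] v) (Real.exp t)‖ ^ 2) := by
  refine Finset.sum_congr rfl fun j _ => ?_
  rw [lintegral_Ioi_eq_lintegral_exp]
  refine lintegral_congr fun t => ?_
  rw [← ENNReal.ofReal_mul (Real.exp_pos t).le]
  congr 1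
  rw [← Real.exp_mul, mul_div_cancel₀ _ (Real.exp_pos t).ne']
  congr 2
  ring

open MeasureTheory in
lemma stateControlled_dState_iff (v : ℝ → ℂ) : StateControlled (dState v) ↔
    ∃ δ ∈ Set.Ioo (0 : ℝ) (1 / 10), ∀ k : ℕ, k ≤ 2 → weightedNormSq k (-δ - k) v < ⊤ := by
  refine exists_congr fun δ => and_congr_right fun _ => forall_congr' fun k => forall_congr' fun hk => ?_
  rw [weightedNormSq_eq, ENNReal.sum_lt_top]
  constructor
  · intro h j hj
    rw [Finset.mem_range] at hj
    exact h ⟨j, by omega⟩ (by simp only; omega)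
  · intro h j hj
    exact h j (Finset.mem_range.mpr (by omega))

lemma IsControlledSolution.isSol {f v : ℝ → ℂ} {η : ℝ} (h : IsControlledSolution f η v) :
    IsSol η (fun t => f (Real.exp t)) Set.univ (dState v) ∧ StateControlled (dState v) :=
  ⟨h.2.1.isSol h.1, (stateControlled_dState_iff v).mpr h.2.2⟩

lemma isControlledSolution_ofState {f : ℝ → ℂ} {η : ℝ} {U : ℝ → Fin 4 → ℂ}
    (hf : ContDiffOn ℝ ∞ f (Set.Ioi 0)) (hU : IsSol η (fun t => f (Real.exp t)) Set.univ U)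
    (hc : StateControlled U) : IsControlledSolution f η (ofState U) := by
  refine ⟨contDiffOn_ofState hU hf, solvesResolvent_ofState hU, ?_⟩
  rw [← stateControlled_dState_iff, dState_ofState hU]
  exact hc

/-! ### Regularity of all derivatives -/

/-- A class of functions `w = w(x, η)` that is stable under the operations with which the resolvent
equation expresses the fourth derivative of a solution through its lower derivatives. -/
structure StableClass (P : (ℝ → ℝ → ℂ) → Prop) : Prop where
  congr : ∀ w w', (∀ x, 0 < x → ∀ η, w x η = w' x η) → P w → P w'
  add : ∀ w w', P w → P w' → P fun x η => w x η + w' x η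
  smul : ∀ (c : ℂ) w, P w → P fun x η => c * w x η
  eta : ∀ w, P w → P fun x η => (η : ℂ) * w x η
  inv : ∀ w, P w → P fun x η => (x : ℂ)⁻¹ * w x η

/-- The functions whose first `n` derivatives in `x` belong to the class `P`. -/
def DerivClass (P : (ℝ → ℝ → ℂ) → Prop) : ℕ → (ℝ → ℝ → ℂ) → Prop
  | 0, w => P w
  | n + 1, w => P w ∧ ∃ w', (∀ η x, 0 < x → HasDerivAt (fun y => w y η) (w' x η) x) ∧
      DerivClass P n w'

section DerivClass

variable {P : (ℝ → ℝ → ℂ) → Prop}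

lemma DerivClass.of_succ {n : ℕ} {w : ℝ → ℝ → ℂ} (h : DerivClass P (n + 1) w) :
    DerivClass P n w := by
  induction n generalizing w with
  | zero => exact h.1
  | succ n ih =>
    obtain ⟨h0, w', h1, h2⟩ := h
    exact ⟨h0, w', h1, ih h2⟩

lemma StableClass.derivClass (hP : StableClass P) (n : ℕ) : StableClass (DerivClass P n) := by
  induction n with
  | zero => exact hP
  | succ n ih =>
    refine ⟨?_, ?_, ?_, ?_, ?_⟩
    · rintro w w' h ⟨h0, d, h1, h2⟩
      refine ⟨hP.congr w w' h h0, d, fun η x hx => ?_, h2⟩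
      refine (h1 η x hx).congr_of_eventuallyEq ?_
      filter_upwards [Ioi_mem_nhds hx] with y hy
      exact (h y hy η).symm
    · rintro w w' ⟨h0, d, h1, h2⟩ ⟨k0, e, k1, k2⟩
      exact ⟨hP.add _ _ h0 k0, _, fun η x hx => (h1 η x hx).add (k1 η x hx), ih.add _ _ h2 k2⟩
    · rintro c w ⟨h0, d, h1, h2⟩
      exact ⟨hP.smul c _ h0, _, fun η x hx => (h1 η x hx).const_mul c, ih.smul c _ h2⟩
    · rintro w ⟨h0, d, h1, h2⟩
      exact ⟨hP.eta _ h0, _, fun η x hx => (h1 η x hx).const_mul (η : ℂ), ih.eta _ h2⟩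
    · intro w hw
      have hn := hw.of_succ
      obtain ⟨h0, d, h1, h2⟩ := hw
      refine ⟨hP.inv _ h0, fun x η => (x : ℂ)⁻¹ * d x η + (-1) * ((x : ℂ)⁻¹ * ((x : ℂ)⁻¹ * w x η)),
        fun η x hx => ?_, ih.add _ _ (ih.inv _ h2) (ih.smul _ _ (ih.inv _ (ih.inv _ hn)))⟩
      have hx0 : (x : ℂ) ≠ 0 := Complex.ofReal_ne_zero.mpr hx.ne'
      have hinv : HasDerivAt (fun y : ℝ => (y : ℂ)⁻¹) (-((x : ℂ) ^ 2)⁻¹) x :=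
        (hasDerivAt_inv hx0).comp_ofReal
      refine (hinv.mul (h1 η x hx)).congr_deriv ?_
      field_simp
      ring

lemma DerivClass.iteratedDeriv (hP : StableClass P) {n : ℕ} {w : ℝ → ℝ → ℂ}
    (h : DerivClass P n w) : P fun x η => iteratedDeriv n (fun y => w y η) x := by
  induction n generalizing w with
  | zero =>
    simp only [iteratedDeriv_zero]
    exact h
  | succ n ih =>
    obtain ⟨h0, d, h1, h2⟩ := h
    refine hP.congr _ _ (fun x hx η => ?_) (ih h2)
    rw [iteratedDeriv_succ']
    refine (Filter.EventuallyEq.iteratedDeriv_eq n ?_).symm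
    filter_upwards [Ioi_mem_nhds hx] with y hy
    exact (h1 η y hy).deriv

lemma contDiffOn_iteratedDeriv {v : ℝ → ℂ} (hv : ContDiffOn ℝ ∞ v (Set.Ioi 0)) (j : ℕ) :
    ContDiffOn ℝ ∞ (iteratedDeriv j v) (Set.Ioi 0) := by
  induction j with
  | zero => simpa using hv
  | succ j ih =>
    rw [iteratedDeriv_succ]
    exact ((contDiffOn_infty_iff_deriv_of_isOpen isOpen_Ioi).mp ih).2

lemma derivClass_of_iteratedDeriv {f : ℝ → ℝ → ℂ}
    (hf : ∀ η, ContDiffOn ℝ ∞ (fun x => f x η) (Set.Ioi 0))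
    (h : ∀ j, P fun x η => iteratedDeriv j (fun y => f y η) x) (n j : ℕ) :
    DerivClass P n fun x η => iteratedDeriv j (fun y => f y η) x := by
  induction n generalizing j with
  | zero => exact h j
  | succ n ih =>
    refine ⟨h j, _, fun η x hx => ?_, ih (j + 1)⟩
    have h2 : DifferentiableAt ℝ (iteratedDeriv j fun y => f y η) x :=
      ((contDiffOn_iteratedDeriv (hf η) j).contDiffAt (Ioi_mem_nhds hx)).differentiableAt (by simp)
    rw [iteratedDeriv_succ]
    exact h2.hasDerivAt

/-- If a stable class contains all derivatives of the right-hand side and the state of the solution,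
then it contains all derivatives of the solution. -/
lemma StableClass.iteratedDeriv_ofState (hP : StableClass P) {f : ℝ → ℝ → ℂ}
    (hf : ∀ η, ContDiffOn ℝ ∞ (fun x => f x η) (Set.Ioi 0))
    (hfP : ∀ j, P fun x η => iteratedDeriv j (fun y => f y η) x) {U : ℝ → ℝ → Fin 4 → ℂ}
    (hU : ∀ η, IsSol η (fun t => f (Real.exp t) η) Set.univ (U η))
    (hUP : ∀ j, P fun x η => U η (Real.log x) j) (n : ℕ) :
    P fun x η => iteratedDeriv n (fun y => ofState (U η) y) x := by
  set V0 : ℝ → ℝ → ℂ := fun x η => U η (Real.log x) 0 with hV0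
  set V1 : ℝ → ℝ → ℂ := fun x η => (x : ℂ)⁻¹ * U η (Real.log x) 1 with hV1
  set V2 : ℝ → ℝ → ℂ := fun x η => (x : ℂ)⁻¹ * ((x : ℂ)⁻¹ * (U η (Real.log x) 2
    + (-1) * U η (Real.log x) 1)) with hV2
  set V3 : ℝ → ℝ → ℂ := fun x η => (x : ℂ)⁻¹ * ((x : ℂ)⁻¹ * ((x : ℂ)⁻¹ * (U η (Real.log x) 3
    + ((-3) * U η (Real.log x) 2 + 2 * U η (Real.log x) 1)))) with hV3
  set V4 : ℝ → ℝ → ℂ := fun x η => (-5) * ((x : ℂ)⁻¹ * V3 x η) + ((-3) * ((x : ℂ)⁻¹ * ((x : ℂ)⁻¹ * V2 x η))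
    + ((9 / 8) * ((x : ℂ)⁻¹ * ((x : ℂ)⁻¹ * ((x : ℂ)⁻¹ * V1 x η)))
    + ((-1) * ((x : ℂ)⁻¹ * ((x : ℂ)⁻¹ * ((x : ℂ)⁻¹ * V0 x η)))
    + ((η : ℂ) * ((η : ℂ) * (2 * V2 x η + (5 * ((x : ℂ)⁻¹ * V1 x η) + (x : ℂ)⁻¹ * ((x : ℂ)⁻¹ * V0 x η))))
    + ((-1) * ((η : ℂ) * ((η : ℂ) * ((η : ℂ) * ((η : ℂ) * V0 x η))))
    + (x : ℂ)⁻¹ * ((x : ℂ)⁻¹ * ((x : ℂ)⁻¹ * ((x : ℂ)⁻¹ * f x η)))))))) with hV4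
  have hinv : ∀ x : ℝ, 0 < x → HasDerivAt (fun y : ℝ => (y : ℂ)⁻¹) (-((x : ℂ) ^ 2)⁻¹) x := by
    intro x hx
    exact (hasDerivAt_inv (Complex.ofReal_ne_zero.mpr hx.ne')).comp_ofReal
  have hd := fun (η x : ℝ) (_ : 0 < x) => isSol_iff.mp (hU η) (Real.log x) trivial
  have d0 : ∀ η x, 0 < x → HasDerivAt (fun y => V0 y η) (V1 x η) x := fun η x hx =>
    hasDerivAt_comp_log (u := fun t => U η t 0) hx (hd η x hx).1
  have d1 : ∀ η x, 0 < x → HasDerivAt (fun y => V1 y η) (V2 x η) x := by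
    intro η x hx
    have hx0 : (x : ℂ) ≠ 0 := Complex.ofReal_ne_zero.mpr hx.ne'
    refine ((hinv x hx).mul (hasDerivAt_comp_log hx (hd η x hx).2.1)).congr_deriv ?_
    simp only [hV2]
    field_simp
    ring
  have d2 : ∀ η x, 0 < x → HasDerivAt (fun y => V2 y η) (V3 x η) x := by
    intro η x hx
    have hx0 : (x : ℂ) ≠ 0 := Complex.ofReal_ne_zero.mpr hx.ne'
    have h1 := hasDerivAt_comp_log hx (hd η x hx).2.1
    have h2 := hasDerivAt_comp_log hx (hd η x hx).2.2.1
    refine ((hinv x hx).mul ((hinv x hx).mul (h2.add (h1.const_mul (-1))))).congr_deriv ?_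
    simp only [hV3, Pi.mul_apply, Pi.add_apply]
    field_simp
    ring
  have d3 : ∀ η x, 0 < x → HasDerivAt (fun y => V3 y η) (V4 x η) x := by
    intro η x hx
    have hx0 : (x : ℂ) ≠ 0 := Complex.ofReal_ne_zero.mpr hx.ne'
    have h1 := hasDerivAt_comp_log hx (hd η x hx).2.1
    have h2 := hasDerivAt_comp_log hx (hd η x hx).2.2.1
    have h3 := hasDerivAt_comp_log hx (hd η x hx).2.2.2
    refine ((hinv x hx).mul ((hinv x hx).mul ((hinv x hx).mul
      (h3.add ((h2.const_mul (-3)).add (h1.const_mul 2)))))).congr_deriv ?_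
    have e1 : Real.exp (Real.log x) = x := Real.exp_log hx
    have e2 : Real.exp (2 * Real.log x) = x ^ 2 := by
      rw [show (2 : ℝ) * Real.log x = ((2 : ℕ) : ℝ) * Real.log x by norm_num, Real.exp_nat_mul, e1]
    have e4 : Real.exp (4 * Real.log x) = x ^ 4 := by
      rw [show (4 : ℝ) * Real.log x = ((4 : ℕ) : ℝ) * Real.log x by norm_num, Real.exp_nat_mul, e1]
    simp only [hV4, hV3, hV2, hV1, hV0, Pi.mul_apply, Pi.add_apply, vf, e1, e2, e4,
      Complex.ofReal_pow]
    field_simp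
    ring
  have key : ∀ n, DerivClass P n V0 ∧ DerivClass P n V1 ∧ DerivClass P n V2 ∧ DerivClass P n V3 := by
    have p0 := hUP 0
    have p1 : P V1 := hP.inv _ (hUP 1)
    have p2 : P V2 := hP.inv _ (hP.inv _ (hP.add _ _ (hUP 2) (hP.smul _ _ (hUP 1))))
    have p3 : P V3 := hP.inv _ (hP.inv _ (hP.inv _ (hP.add _ _ (hUP 3)
      (hP.add _ _ (hP.smul _ _ (hUP 2)) (hP.smul _ _ (hUP 1))))))
    intro n
    induction n with
    | zero => exact ⟨p0, p1, p2, p3⟩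
    | succ n ih =>
      obtain ⟨q0, q1, q2, q3⟩ := ih
      have hS := hP.derivClass n
      have hf0 : DerivClass P n f := by
        have := derivClass_of_iteratedDeriv hf hfP n 0
        simpa using this
      have q4 : DerivClass P n V4 := by
        refine hS.add _ _ (hS.smul _ _ (hS.inv _ q3)) ?_
        refine hS.add _ _ (hS.smul _ _ (hS.inv _ (hS.inv _ q2))) ?_
        refine hS.add _ _ (hS.smul _ _ (hS.inv _ (hS.inv _ (hS.inv _ q1)))) ?_
        refine hS.add _ _ (hS.smul _ _ (hS.inv _ (hS.inv _ (hS.inv _ q0)))) ?_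
        refine hS.add _ _ (hS.eta _ (hS.eta _ (hS.add _ _ (hS.smul _ _ q2)
          (hS.add _ _ (hS.smul _ _ (hS.inv _ q1)) (hS.inv _ (hS.inv _ q0)))))) ?_
        refine hS.add _ _ (hS.smul _ _ (hS.eta _ (hS.eta _ (hS.eta _ (hS.eta _ q0))))) ?_
        exact hS.inv _ (hS.inv _ (hS.inv _ (hS.inv _ hf0)))
      exact ⟨⟨p0, V1, d0, q1⟩, ⟨p1, V2, d1, q2⟩, ⟨p2, V3, d2, q3⟩, ⟨p3, V4, d3, q4⟩⟩
  exact (key n).1.iteratedDeriv hP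

end DerivClass

/-! ### Families of controlled solutions -/

section Family

attribute [local irreducible] coords varConst expState expD innerCoeff

/-- A family of right-hand sides `g η`, `η ∈ J`, in the variable `t = log x`, that near `x = 0` are
given by generalised power series with coefficients `c η` without resonant terms. -/
structure InnerData (J : Set ℝ) (g : ℝ → ℝ → ℂ) (c : ℝ → ℕ × ℕ → ℂ) (T₀ : ℝ) : Prop where
  cont : Continuous fun z : J × ℝ => g z.1 z.2
  fin : ∀ η ∈ J, wnorm T₀ (c η) < ⊤
  lim : ∀ η₀ ∈ J, Tendsto (fun η => wnorm T₀ (c η - c η₀)) (𝓝[J] η₀) (𝓝 0)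
  zero_left : ∀ η ∈ J, ∀ l, c η (0, l) = 0
  one_one : ∀ η ∈ J, c η (1, 1) = 0
  eq : ∀ η ∈ J, ∀ t < T₀, g η t = expSeries (c η) t

lemma exists_innerData {f : ℝ → ℝ → ℂ}
    (hf : ∀ η, ContDiffOn ℝ ∞ (fun x => f x η) (Set.Ioi 0)) (hf0 : G0Vanishing f)
    (hfc : DerivsContinuous f) {J : Set ℝ} (hJ : AdmissibleInterval J) :
    ∃ c T₀, InnerData J (fun η t => f (Real.exp t) η) c T₀ := by
  obtain ⟨ε, hε, F, hF, hF0⟩ := hf0 J hJ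
  refine ⟨fun η => taylorCoeff fun x₁ x₂ => F x₁ x₂ η, Real.log ε, ?_, ?_, ?_, ?_, ?_, ?_⟩
  · rcases hJ with ⟨a, b, -, -, h0⟩ | rfl
    · have h1 := hfc 0
      simp only [iteratedDeriv_zero] at h1
      refine h1.comp_continuous (f := fun z : J × ℝ => (Real.exp z.2, (z.1 : ℝ))) (by fun_prop) ?_
      intro z
      refine ⟨Real.exp_pos _, fun h => h0 ?_⟩
      rw [← h]
      exact z.1.2
    · have h1 : Continuous fun z : ({0} : Set ℝ) × ℝ => f (Real.exp z.2) 0 :=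
        (hf 0).continuousOn.comp_continuous (by fun_prop) fun z => Real.exp_pos _
      refine h1.congr fun z => ?_
      rw [show (z.1 : ℝ) = 0 from z.1.2]
  · exact fun η hη => hF.wnorm_taylorCoeff_lt_top hε hη
  · exact fun η hη => hF.tendsto_wnorm_taylorCoeff hε hη
  · intro η hη l
    rcases Nat.eq_zero_or_pos l with rfl | hl
    · have h1 := partialZero_eq_taylorCoeff (fun x₁ x₂ => F x₁ x₂ η) 0 0
      rw [partialZero] at h1
      simpa [(hF0 η hη).1] using h1.symm
    · have h1 := partialZero_eq_taylorCoeff (fun x₁ x₂ => F x₁ x₂ η) 0 l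
      rw [hF.no_pure η hη l hl] at h1
      simpa [Nat.factorial_ne_zero] using h1.symm
  · intro η hη
    have h1 := partialZero_eq_taylorCoeff (fun x₁ x₂ => F x₁ x₂ η) 1 1
    rw [(hF0 η hη).2] at h1
    simpa using h1.symm
  · exact fun η hη t ht => hF.eq_expSeries hε hη ht

lemma exists_norm_expState_le {T : ℝ} {a : ℕ × ℕ → ℂ} (ha : wnorm T a < ⊤) :
    ∃ C T', ∀ t < T', ‖expState 0 a t‖ ≤ C := by
  have h1 : ∀ i : Fin 4, ∃ C, ∀ᶠ t in atBot, ‖expD 0 a i t‖ ≤ C := by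
    intro i
    have h := tendsto_expD_atBot 0 0 i ha fun p _ => by simpa using expo_nonneg p
    simp only [zero_mul, neg_zero, Real.exp_zero, Complex.ofReal_one, one_mul] at h
    exact ⟨_, h.norm.eventually_le_const (lt_add_one _)⟩
  choose C hC using h1
  obtain ⟨T', hT'⟩ := eventually_atBot.mp (eventually_all.mpr hC)
  refine ⟨∑ i, |C i|, T', fun t ht => ?_⟩
  rw [pi_norm_le_iff_of_nonneg (Finset.sum_nonneg fun i _ => abs_nonneg _)]
  intro i
  rw [expState]
  exact (hT' t ht.le i).trans ((le_abs_self _).trans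
    (Finset.single_le_sum (f := fun i => |C i|) (fun i _ => abs_nonneg _) (Finset.mem_univ i)))

variable {J : Set ℝ} {g : ℝ → ℝ → ℂ} {c : ℝ → ℕ × ℕ → ℂ} {T₀ : ℝ} {l : Filter ℝ} {η₀ : ℝ}

lemma norm_comb_three_le {w C C' : ℝ} (hC' : C ≤ C') (hw : 0 ≤ w) (s₁ s₂ : ℂ) {z₀ z₁ z₂ : Fin 4 → ℂ}
    (h₀ : ‖z₀‖ ≤ C * w) (h₁ : ‖z₁‖ ≤ C * w) (h₂ : ‖z₂‖ ≤ C * w) :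
    ‖z₀ + s₁ • z₁ + s₂ • z₂‖ ≤ (C' * (1 + ‖s₁‖ + ‖s₂‖)) * w := by
  have k : C * w ≤ C' * w := mul_le_mul_of_nonneg_right hC' hw
  refine (norm_add₃_le).trans ?_
  rw [norm_smul, norm_smul]
  have k1 := mul_le_mul_of_nonneg_left (h₁.trans k) (norm_nonneg s₁)
  have k2 := mul_le_mul_of_nonneg_left (h₂.trans k) (norm_nonneg s₂)
  linarith

/-- The matched solutions are controlled, and they and their dependence on `η` inherit the decay of
the solutions near infinity. -/
lemma InnerData.exists_controlled (h : InnerData J g c T₀) (hη₀ : η₀ ∈ J) (hl : 𝓝[J] η₀ ≤ l)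
    {wt : ℝ → ℝ} (hwt : Rapid wt) {T : ℝ} {z : Fin 3 → ℝ → ℝ → Fin 4 → ℂ}
    (hz : DecayingBasis l η₀ g wt T z) :
    ∃ (σ : ℝ → Fin 4 → ℂ) (A B : ℝ → ℂ), Tendsto σ (𝓝[J] η₀) (𝓝 (σ η₀)) ∧
      Tendsto A (𝓝[J] η₀) (𝓝 (A η₀)) ∧ Tendsto B (𝓝[J] η₀) (𝓝 (B η₀)) ∧
      (∀ᶠ η in 𝓝[J] η₀, StateControlled (fullSol η (g η) (σ η)) ∧
        ∀ t < T₀, fullSol η (g η) (σ η) t = expState 0 (innerCoeff η (c η) (A η) (B η)) t) ∧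
      (∃ C, ∀ t, T < t → ‖fullSol η₀ (g η₀) (σ η₀) t‖ ≤ C * wt t) ∧
      ∀ e : ℝ, 0 < e → ∀ᶠ η in 𝓝[J] η₀, ∀ t, T < t →
        ‖fullSol η (g η) (σ η) t - fullSol η₀ (g η₀) (σ η₀) t‖ ≤ e * wt t := by
  obtain ⟨σ, A, B, s₁, s₂, hσ, hA, hB, hs₁, hs₂, hm⟩ := exists_matching h.cont h.fin h.lim
    h.zero_left h.one_one h.eq hη₀ hl hwt hz
  obtain ⟨C, hC⟩ := hz.bound
  have hself := hm.self_of_nhdsWithin hη₀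
  refine ⟨σ, A, B, hσ, hA, hB, ?_, ⟨C * (1 + ‖s₁ η₀‖ + ‖s₂ η₀‖), fun t ht => ?_⟩, fun e he => ?_⟩
  · have hb : ∀ i, ∀ᶠ η in 𝓝[J] η₀, ∀ t, T < t → ‖z i η t‖ ≤ (C + 1) * wt t := by
      intro i
      filter_upwards [hl (hz.tendsto i 1 one_pos)] with η hη t ht
      have h1 := hη t ht
      have h2 := hC i t ht
      have h3 := norm_le_norm_add_norm_sub' (z i η t) (z i η₀ t)
      linarith
    filter_upwards [hm, hb 0, hb 1, hb 2, self_mem_nhdsWithin] with η hη h0 h1 h2 hηJ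
    refine ⟨?_, hη.1⟩
    obtain ⟨D, T', hD⟩ := exists_norm_expState_le
      (wnorm_innerCoeff_lt_top (h.fin η hηJ) η (A η) (B η))
    have hgη : Continuous (g η) := h.cont.comp (Continuous.prodMk_right (⟨η, hηJ⟩ : J))
    refine stateControlled_of_bounds (isSol_fullSol η hgη (σ η)).continuous hwt
      (C := max D ((C + 1) * (1 + ‖s₁ η‖ + ‖s₂ η‖))) (T := T) (T' := min T₀ T') ?_ ?_
    · intro t ht
      rw [hη.1 t (ht.trans_le (min_le_left _ _))]
      exact (hD t (ht.trans_le (min_le_right _ _))).trans (le_max_left _ _)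
    · intro t ht
      rw [hη.2 t ht]
      exact (norm_comb_three_le le_rfl (hwt.1 t) _ _ (h0 t ht) (h1 t ht) (h2 t ht)).trans
        (mul_le_mul_of_nonneg_right (le_max_right _ _) (hwt.1 t))
  · rw [hself.2 t ht]
    exact norm_comb_three_le le_rfl (hwt.1 t) _ _ (hC 0 t ht) (hC 1 t ht) (hC 2 t ht)
  · obtain ⟨K, hK⟩ : ∃ K, K = 3 + ‖s₁ η₀‖ + ‖s₂ η₀‖ + 2 * |C| := ⟨_, rfl⟩
    have hK0 : 0 < K := by rw [hK]; positivity
    have he' : 0 < e / K := div_pos he hK0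
    have d : ∀ {s : ℝ → ℂ}, Tendsto s (𝓝[J] η₀) (𝓝 (s η₀)) →
        ∀ᶠ η in 𝓝[J] η₀, ‖s η - s η₀‖ ≤ e / K ∧ ‖s η‖ ≤ ‖s η₀‖ + 1 := by
      intro s hs
      have h1 : Tendsto (fun η => ‖s η - s η₀‖) (𝓝[J] η₀) (𝓝 0) := by
        simpa using (hs.sub_const (s η₀)).norm
      exact (h1.eventually_le_const he').and (hs.norm.eventually_le_const (by linarith))
    filter_upwards [hm, d hs₁, d hs₂, hl (hz.tendsto 0 _ he'), hl (hz.tendsto 1 _ he'),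
      hl (hz.tendsto 2 _ he')] with η hη k1 k2 z0 z1 z2 t ht
    have hw := hwt.1 t
    have hCt : ∀ i, ‖z i η₀ t‖ ≤ |C| * wt t := fun i =>
      (hC i t ht).trans (mul_le_mul_of_nonneg_right (le_abs_self C) hw)
    have hone : ∀ {s : ℝ → ℂ} (i : Fin 3), ‖s η - s η₀‖ ≤ e / K ∧ ‖s η‖ ≤ ‖s η₀‖ + 1 →
        ‖z i η t - z i η₀ t‖ ≤ e / K * wt t →
        ‖s η • z i η t - s η₀ • z i η₀ t‖ ≤ e / K * (‖s η₀‖ + 1 + |C|) * wt t := by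
      intro s i hs hzi
      have e1 : s η • z i η t - s η₀ • z i η₀ t
          = s η • (z i η t - z i η₀ t) + (s η - s η₀) • z i η₀ t := by
        rw [smul_sub, sub_smul]; abel
      rw [e1]
      refine (norm_add_le _ _).trans ?_
      rw [norm_smul, norm_smul]
      have m1 := mul_le_mul hs.2 hzi (norm_nonneg _) (by positivity)
      have m2 := mul_le_mul hs.1 (hCt i) (norm_nonneg _) he'.le
      linarith
    have m1 := hone (s := s₁) 1 k1 (z1 t ht)
    have m2 := hone (s := s₂) 2 k2 (z2 t ht)
    have e2 : z 0 η t + s₁ η • z 1 η t + s₂ η • z 2 η t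
        - (z 0 η₀ t + s₁ η₀ • z 1 η₀ t + s₂ η₀ • z 2 η₀ t)
        = (z 0 η t - z 0 η₀ t) + (s₁ η • z 1 η t - s₁ η₀ • z 1 η₀ t)
          + (s₂ η • z 2 η t - s₂ η₀ • z 2 η₀ t) := by abel
    rw [hη.2 t ht, hself.2 t ht, e2]
    refine (norm_add₃_le).trans ?_
    have e3 : e / K * K = e := div_mul_cancel₀ e hK0.ne'
    calc _ ≤ e / K * wt t + e / K * (‖s₁ η₀‖ + 1 + |C|) * wt t
          + e / K * (‖s₂ η₀‖ + 1 + |C|) * wt t := add_le_add (add_le_add (z0 t ht) m1) m2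
      _ = e / K * K * wt t := by rw [hK]; ring
      _ = e * wt t := by rw [e3]

/-- The properties of a family of controlled solutions near a parameter `η₀`. By uniqueness, they
are those of the matched solutions. -/
lemma InnerData.controlled_properties (h : InnerData J g c T₀) (hη₀ : η₀ ∈ J) (hl : 𝓝[J] η₀ ≤ l)
    {wt : ℝ → ℝ} (hwt : Rapid wt) {T : ℝ} {z : Fin 3 → ℝ → ℝ → Fin 4 → ℂ}
    (hz : DecayingBasis l η₀ g wt T z) {U : ℝ → ℝ → Fin 4 → ℂ}
    (hU : ∀ η ∈ J, IsSol η (g η) Set.univ (U η)) (hUc : ∀ η ∈ J, StateControlled (U η)) :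
    (∃ A B : ℝ → ℂ, Tendsto A (𝓝[J] η₀) (𝓝 (A η₀)) ∧ Tendsto B (𝓝[J] η₀) (𝓝 (B η₀)) ∧
      ∀ᶠ η in 𝓝[J] η₀, ∀ t < T₀,
        U η t = expState 0 (innerCoeff η (c η) (A η) (B η)) t) ∧
      (∀ t, Tendsto (fun y : ℝ × ℝ => U y.1 y.2) (𝓝[J] η₀ ×ˢ 𝓝 t) (𝓝 (U η₀ t))) ∧
      (∃ C, ∀ t, T < t → ‖U η₀ t‖ ≤ C * wt t) ∧
      ∀ e : ℝ, 0 < e → ∀ᶠ η in 𝓝[J] η₀, ∀ t, T < t → ‖U η t - U η₀ t‖ ≤ e * wt t := by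
  obtain ⟨σ, A, B, hσ, hA, hB, hc, hb, hd⟩ := h.exists_controlled hη₀ hl hwt hz
  have hUσ : ∀ᶠ η in 𝓝[J] η₀, U η = fullSol η (g η) (σ η) := by
    filter_upwards [hc, self_mem_nhdsWithin] with η hη hηJ
    have hgη : Continuous (g η) := h.cont.comp (Continuous.prodMk_right (⟨η, hηJ⟩ : J))
    exact (hUc η hηJ).unique (hU η hηJ) (isSol_fullSol η hgη (σ η)) hη.1
  have hself := hUσ.self_of_nhdsWithin hη₀
  refine ⟨⟨A, B, hA, hB, ?_⟩, fun t => ?_, ?_, fun e he => ?_⟩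
  · filter_upwards [hUσ, hc] with η h1 h2
    rw [h1]
    exact h2.2
  · have h1 : Tendsto (fun y : ℝ × ℝ => varConst y.1 (g y.1) y.2) (𝓝[J] η₀ ×ˢ 𝓝 t)
        (𝓝 (varConst η₀ (g η₀) t)) := by
      have h2 := continuous_varConst (Λ := J) (e := fun η => (η : ℝ)) continuous_subtype_val
        (g := fun η => g η) h.cont
      have h3 := h2.tendsto (⟨η₀, hη₀⟩, t)
      rw [nhds_prod_eq] at h3
      rw [nhdsWithin_eq_map_subtype_coe hη₀]
      have h4 : Filter.map (Subtype.val : J → ℝ) (𝓝 ⟨η₀, hη₀⟩) ×ˢ 𝓝 t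
          = Filter.map (fun y : J × ℝ => ((y.1 : ℝ), y.2)) (𝓝 ⟨η₀, hη₀⟩ ×ˢ 𝓝 t) := by
        have := Filter.prod_map_map_eq (f₁ := 𝓝 (⟨η₀, hη₀⟩ : J)) (f₂ := 𝓝 t)
          (m₁ := (Subtype.val : J → ℝ)) (m₂ := id)
        simpa using this
      rw [h4, tendsto_map'_iff]
      exact h3
    have hid : Tendsto (fun y : ℝ × ℝ => y.1) (𝓝[J] η₀ ×ˢ 𝓝 t) (𝓝 η₀) :=
      (tendsto_fst).mono_right nhdsWithin_le_nhds
    have h5 : Tendsto (fun y : ℝ × ℝ => comb (σ y.1) y.1 y.2) (𝓝[J] η₀ ×ˢ 𝓝 t)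
        (𝓝 (comb (σ η₀) η₀ t)) :=
      Tendsto.comp (g := fun z : (Fin 4 → ℂ) × ℝ × ℝ => comb z.1 z.2.1 z.2.2)
        (f := fun y : ℝ × ℝ => (σ y.1, y.1, y.2)) (continuous_comb.tendsto (σ η₀, η₀, t))
        ((hσ.comp tendsto_fst).prodMk_nhds (hid.prodMk_nhds tendsto_snd))
    rw [hself]
    refine (h1.add h5).congr' ?_
    filter_upwards [hUσ.prod_inl (𝓝 t)] with y hy
    rw [hy, fullSol]
  · rw [hself]
    exact hb
  · filter_upwards [hUσ, hd e he] with η h1 h2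
    rw [h1, hself]
    exact h2

end Family

section Resolvent

variable {f : ℝ → ℝ → ℂ} {J : Set ℝ} {U : ℝ → ℝ → Fin 4 → ℂ} {η₀ : ℝ}

lemma exists_basis_of_admissible (hf : ∀ η, ContDiffOn ℝ ∞ (fun x => f x η) (Set.Ioi 0))
    (hfi : GInfty f) (hJ : AdmissibleInterval J) (hη₀ : η₀ ∈ J) :
    ∃ l wt T z, 𝓝[J] η₀ ≤ l ∧ Rapid wt ∧
      DecayingBasis l η₀ (fun η t => f (Real.exp t) η) wt T z := by
  by_cases h0 : η₀ = 0
  · subst h0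
    have hJ0 : J = {0} := by
      rcases hJ with ⟨a, b, -, -, h⟩ | h
      · exact absurd hη₀ h
      · exact h
    obtain ⟨T, z, hz⟩ := exists_decayingBasis_zero (hf 0).continuousOn hfi (ν := 1) zero_le_one
      (Real.one_lt_rpow (by norm_num) (by norm_num))
    refine ⟨_, _, T, z, ?_, rapid_exp_exp (by norm_num) one_pos, hz⟩
    rw [hJ0, nhdsWithin_singleton]
  · have hpos : 0 < |η₀| := abs_pos.mpr h0
    obtain ⟨T, z, hz⟩ := exists_decayingBasis (fun η => (hf η).continuousOn) hfi h0
      (ν := |η₀| / 2) (by linarith) (by linarith)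
    exact ⟨_, _, T, z, nhdsWithin_le_nhds, rapid_exp_exp one_pos (by linarith), hz⟩

lemma exists_controlled_state (hf : ∀ η, ContDiffOn ℝ ∞ (fun x => f x η) (Set.Ioi 0))
    (hf0 : G0Vanishing f) (hfi : GInfty f) (hfc : DerivsContinuous f) (η : ℝ) :
    ∃ U, IsSol η (fun t => f (Real.exp t) η) Set.univ U ∧ StateControlled U := by
  obtain ⟨J, hJ, hη⟩ : ∃ J, AdmissibleInterval J ∧ η ∈ J := by
    by_cases h : η = 0
    · exact ⟨{0}, Or.inr rfl, h⟩
    · exact ⟨Set.Icc η η, Or.inl ⟨η, η, le_rfl, rfl, by simpa using Ne.symm h⟩, by simp⟩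
  obtain ⟨c, T₀, hc⟩ := exists_innerData hf hf0 hfc hJ
  obtain ⟨l, wt, T, z, hl, hwt, hz⟩ := exists_basis_of_admissible hf hfi hJ hη
  obtain ⟨σ, A, B, -, -, -, h, -⟩ := hc.exists_controlled hη hl hwt hz
  refine ⟨_, isSol_fullSol η ?_ (σ η), (h.self_of_nhdsWithin hη).1⟩
  exact hc.cont.comp (Continuous.prodMk_right (⟨η, hη⟩ : J))

/-! ### Behaviour of the solutions near `x = 0` -/

lemma expState_innerCoeff_injective {c : ℕ × ℕ → ℂ} {T η : ℝ} (hc : wnorm T c < ⊤) {A B A' B' : ℂ}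
    (h : ∀ t < T, expState 0 (innerCoeff η c A B) t = expState 0 (innerCoeff η c A' B') t) :
    A = A' ∧ B = B' := by
  have ht : T - 1 < T := by linarith
  have h1 := h _ ht
  rw [expState_innerCoeff hc η A B ht, expState_innerCoeff hc η A' B' ht, add_assoc, add_assoc,
    add_left_cancel_iff] at h1
  have h2 : ∀ a b : ℂ, comb ![0, 0, a, b] η (T - 1)
      = a • phi 2 η (T - 1) + b • phi 3 η (T - 1) := by
    intro a b
    simp [comb, Fin.sum_univ_four]
  rw [← h2, ← h2] at h1
  have h3 := congrArg (coords η (T - 1)) h1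
  rw [coords_comb, coords_comb] at h3
  exact ⟨by simpa using congrFun h3 2, by simpa using congrFun h3 3⟩

lemma expD_zero_zero (a : ℕ × ℕ → ℂ) (t : ℝ) : expD 0 a 0 t = expSeries a t := by
  simp [expD, expSeries]

lemma G0_ofState (hf : ∀ η, ContDiffOn ℝ ∞ (fun x => f x η) (Set.Ioi 0))
    (hf0 : G0Vanishing f) (hfi : GInfty f) (hfc : DerivsContinuous f)
    (hU : ∀ η, IsSol η (fun t => f (Real.exp t) η) Set.univ (U η))
    (hUc : ∀ η, StateControlled (U η)) : G0 fun x η => ofState (U η) x := by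
  intro J hJ
  obtain ⟨c, T₀, hc⟩ := exists_innerData hf hf0 hfc hJ
  have hloc : ∀ η₀ ∈ J, ∃ A B : ℝ → ℂ, Tendsto A (𝓝[J] η₀) (𝓝 (A η₀)) ∧
      Tendsto B (𝓝[J] η₀) (𝓝 (B η₀)) ∧ ∀ᶠ η in 𝓝[J] η₀, ∀ t < T₀,
        U η t = expState 0 (innerCoeff η (c η) (A η) (B η)) t := by
    intro η₀ hη₀
    obtain ⟨l, wt, T, z, hl, hwt, hz⟩ := exists_basis_of_admissible hf hfi hJ hη₀
    exact (hc.controlled_properties hη₀ hl hwt hz (fun η _ => hU η) fun η _ => hUc η).1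
  have hex : ∀ η, ∃ y : ℂ × ℂ, η ∈ J → ∀ t < T₀,
      U η t = expState 0 (innerCoeff η (c η) y.1 y.2) t := by
    intro η
    by_cases hη : η ∈ J
    · obtain ⟨A, B, -, -, h⟩ := hloc η hη
      exact ⟨(A η, B η), fun _ => h.self_of_nhdsWithin hη⟩
    · exact ⟨0, fun h => absurd h hη⟩
  choose Y hY using hex
  -- the coefficients are unique, hence equal to the locally defined continuous ones
  have hYc : ∀ η₀ ∈ J, Tendsto (fun η => (Y η).1) (𝓝[J] η₀) (𝓝 (Y η₀).1) ∧
      Tendsto (fun η => (Y η).2) (𝓝[J] η₀) (𝓝 (Y η₀).2) := by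
    intro η₀ hη₀
    obtain ⟨A, B, hA, hB, h⟩ := hloc η₀ hη₀
    have hev : ∀ᶠ η in 𝓝[J] η₀, A η = (Y η).1 ∧ B η = (Y η).2 := by
      filter_upwards [h, self_mem_nhdsWithin] with η h1 hη
      exact expState_innerCoeff_injective (hc.fin η hη) fun t ht => by
        rw [← h1 t ht, ← hY η hη t ht]
    have hself := hev.self_of_nhdsWithin hη₀
    rw [← hself.1, ← hself.2]
    exact ⟨hA.congr' (hev.mono fun η h => h.1), hB.congr' (hev.mono fun η h => h.2)⟩
  refine ⟨Real.exp T₀ / 2, by positivity, _, unfolds_of_expSeries (Real.exp_pos T₀)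
    (fun η => innerCoeff η (c η) (Y η).1 (Y η).2) ?_ ?_ ?_ ?_⟩
  · intro η hη
    rw [Real.log_exp]
    exact wnorm_innerCoeff_lt_top (hc.fin η hη) _ _ _
  · intro η₀ hη₀
    rw [Real.log_exp]
    have hid : Tendsto (fun η : ℝ => η) (𝓝[J] η₀) (𝓝 η₀) := nhdsWithin_le_nhds
    exact tendsto_wnorm_innerCoeff hid (hc.fin η₀ hη₀) (hc.lim η₀ hη₀)
      (hYc η₀ hη₀).1 (hYc η₀ hη₀).2
  · intro η hη l hl
    exact innerCoeff_zero_left (hc.zero_left η hη) _ _ _ hl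
  · intro η hη t ht
    rw [Real.log_exp] at ht
    rw [ofState, Real.log_exp, hY η hη t ht, ← expD_zero_zero]
    rfl

end Resolvent

/-! ### Decay and continuity of all derivatives -/

lemma stableClass_continuousOn : StableClass fun w =>
    ContinuousOn (fun p : ℝ × ℝ => w p.1 p.2) {p : ℝ × ℝ | 0 < p.1 ∧ p.2 ≠ 0} where
  congr w w' h hw := hw.congr fun p hp => (h p.1 hp.1 p.2).symm
  add w w' hw hw' := hw.add hw'
  smul c w hw := continuousOn_const.mul hw
  eta w hw := (by fun_prop : Continuous fun p : ℝ × ℝ => (p.2 : ℂ)).continuousOn.mul hw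
  inv w hw := by
    refine ContinuousOn.mul (ContinuousOn.inv₀ ?_ fun p hp => ?_) hw
    · exact (by fun_prop : Continuous fun p : ℝ × ℝ => (p.1 : ℂ)).continuousOn
    · exact Complex.ofReal_ne_zero.mpr hp.1.ne'

lemma stableClass_isBoundedUnder (E : ℝ → ℝ) (hE : ∀ x, 0 ≤ E x) (η₀ : ℝ) : StableClass fun w =>
    IsBoundedUnder (· ≤ ·) atTop fun x : ℝ => E x * ‖w x η₀‖ := by
  have mono : ∀ {w w' : ℝ → ℝ → ℂ} (K : ℝ), (∀ᶠ x in atTop, ‖w' x η₀‖ ≤ K * ‖w x η₀‖) → 0 ≤ K →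
      (IsBoundedUnder (· ≤ ·) atTop fun x : ℝ => E x * ‖w x η₀‖) →
      IsBoundedUnder (· ≤ ·) atTop fun x : ℝ => E x * ‖w' x η₀‖ := by
    rintro w w' K h hK ⟨C, hC⟩
    rw [eventually_map] at hC
    refine ⟨K * C, eventually_map.mpr ?_⟩
    filter_upwards [h, hC] with x h1 h2
    calc E x * ‖w' x η₀‖ ≤ E x * (K * ‖w x η₀‖) := mul_le_mul_of_nonneg_left h1 (hE x)
      _ = K * (E x * ‖w x η₀‖) := by ring
      _ ≤ K * C := mul_le_mul_of_nonneg_left h2 hK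
  refine ⟨?_, ?_, ?_, ?_, ?_⟩
  · intro w w' h
    refine mono (w := w) (w' := w') 1 ?_ zero_le_one
    filter_upwards [eventually_gt_atTop 0] with x hx
    rw [h x hx, one_mul]
  · rintro w w' ⟨C, hC⟩ ⟨C', hC'⟩
    rw [eventually_map] at hC hC'
    refine ⟨C + C', eventually_map.mpr ?_⟩
    filter_upwards [hC, hC'] with x h1 h2
    have := mul_le_mul_of_nonneg_left (norm_add_le (w x η₀) (w' x η₀)) (hE x)
    linarith
  · intro c w
    exact mono (w := w) (w' := fun x η => c * w x η) ‖c‖ (Eventually.of_forall fun x => (norm_mul _ _).le) (norm_nonneg c)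
  · intro w
    exact mono (w := w) (w' := fun x η => (η : ℂ) * w x η) ‖(η₀ : ℂ)‖ (Eventually.of_forall fun x => (norm_mul _ _).le) (norm_nonneg _)
  · intro w
    refine mono (w := w) (w' := fun x η => (x : ℂ)⁻¹ * w x η) 1 ?_ zero_le_one
    filter_upwards [eventually_ge_atTop 1] with x hx
    rw [norm_mul, norm_inv, Complex.norm_real, Real.norm_eq_abs, abs_of_nonneg (by linarith)]
    exact mul_le_mul_of_nonneg_right (inv_le_one_of_one_le₀ hx) (norm_nonneg _)

/-- `w(·, η)` is bounded on `[x₀, ∞)` with the weight `e ^ (νx)` for `η = η₀`, and it depends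
continuously on `η` at `η₀` with respect to the weighted supremum norm. -/
def ExpContinuousAt (x₀ ν η₀ : ℝ) (w : ℝ → ℝ → ℂ) : Prop :=
  (∃ C, ∀ x, x₀ ≤ x → Real.exp (ν * x) * ‖w x η₀‖ ≤ C) ∧
    ∀ e : ℝ, 0 < e → ∀ᶠ η in 𝓝 η₀, ∀ x, x₀ ≤ x →
      Real.exp (ν * x) * ‖w x η - w x η₀‖ ≤ e

lemma ExpContinuousAt.mul {x₀ ν η₀ : ℝ} {w : ℝ → ℝ → ℂ} (hw : ExpContinuousAt x₀ ν η₀ w) (K : ℝ)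
    {m : ℝ → ℂ} (hm : ∀ x, x₀ ≤ x → ‖m x‖ ≤ K) : ExpContinuousAt x₀ ν η₀ fun x η => m x * w x η := by
  have hK : 0 ≤ K := (norm_nonneg _).trans (hm x₀ le_rfl)
  have key : ∀ x, x₀ ≤ x → ∀ z : ℂ, ∀ B, Real.exp (ν * x) * ‖z‖ ≤ B →
      Real.exp (ν * x) * ‖m x * z‖ ≤ K * B := by
    intro x hx z B h
    rw [norm_mul, mul_left_comm]
    exact mul_le_mul (hm x hx) h (by positivity) hK
  obtain ⟨⟨C, hC⟩, hd⟩ := hw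
  refine ⟨⟨K * C, fun x hx => key x hx _ _ (hC x hx)⟩, fun e he => ?_⟩
  filter_upwards [hd (e / (K + 1)) (by positivity)] with η hη x hx
  rw [← mul_sub]
  refine (key x hx _ _ (hη x hx)).trans ?_
  rw [mul_div_assoc', div_le_iff₀ (by positivity)]
  linarith

lemma stableClass_expContinuousAt {x₀ : ℝ} (hx₀ : 0 < x₀) (ν η₀ : ℝ) :
    StableClass (ExpContinuousAt x₀ ν η₀) := by
  refine ⟨?_, ?_, ?_, ?_, ?_⟩
  · rintro w w' h ⟨⟨C, hC⟩, hd⟩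
    refine ⟨⟨C, fun x hx => ?_⟩, fun e he => ?_⟩
    · rw [← h x (hx₀.trans_le hx)]
      exact hC x hx
    · filter_upwards [hd e he] with η hη x hx
      rw [← h x (hx₀.trans_le hx), ← h x (hx₀.trans_le hx)]
      exact hη x hx
  · rintro w w' ⟨⟨C, hC⟩, hd⟩ ⟨⟨C', hC'⟩, hd'⟩
    refine ⟨⟨C + C', fun x hx => ?_⟩, fun e he => ?_⟩
    · have := mul_le_mul_of_nonneg_left (norm_add_le (w x η₀) (w' x η₀)) (Real.exp_pos (ν * x)).le
      linarith [hC x hx, hC' x hx]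
    · filter_upwards [hd (e / 2) (by positivity), hd' (e / 2) (by positivity)] with η h1 h2 x hx
      have := mul_le_mul_of_nonneg_left (norm_add_le (w x η - w x η₀) (w' x η - w' x η₀))
        (Real.exp_pos (ν * x)).le
      rw [add_sub_add_comm]
      linarith [h1 x hx, h2 x hx]
  · intro c w hw
    exact hw.mul ‖c‖ (m := fun _ => c) fun _ _ => le_rfl
  · intro w hw
    obtain ⟨⟨C, hC⟩, hd⟩ := hw.mul ‖(η₀ : ℂ)‖ (m := fun _ => (η₀ : ℂ)) fun _ _ => le_rfl
    obtain ⟨⟨D, hD⟩, hdw⟩ := hw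
    refine ⟨⟨C, hC⟩, fun e he => ?_⟩
    have hD0 : 0 ≤ D := le_trans (by positivity) (hD x₀ le_rfl)
    have hη : ∀ᶠ η in 𝓝 η₀, ‖((η - η₀ : ℝ) : ℂ)‖ ≤ min 1 (e / (4 * (D + 1))) := by
      have h1 : Tendsto (fun η : ℝ => ‖((η - η₀ : ℝ) : ℂ)‖) (𝓝 η₀) (𝓝 0) := by
        have : Continuous fun η : ℝ => ‖((η - η₀ : ℝ) : ℂ)‖ := by fun_prop
        simpa using this.tendsto η₀
      exact h1.eventually_le_const (by positivity)
    filter_upwards [hd (e / 4) (by positivity), hdw (e / 4) (by positivity), hη] with η h1 h2 h3 x hx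
    have e1 : (η : ℂ) * w x η - (η₀ : ℂ) * w x η₀ = ((η₀ : ℂ) * w x η - (η₀ : ℂ) * w x η₀)
        + (((η - η₀ : ℝ) : ℂ) * (w x η - w x η₀) + ((η - η₀ : ℝ) : ℂ) * w x η₀) := by
      push_cast; ring
    have h4 := norm_add₃_le (a := (η₀ : ℂ) * w x η - (η₀ : ℂ) * w x η₀)
      (b := ((η - η₀ : ℝ) : ℂ) * (w x η - w x η₀)) (c := ((η - η₀ : ℝ) : ℂ) * w x η₀)
    rw [add_assoc, ← e1, norm_mul, norm_mul] at h4
    have h5 := mul_le_mul_of_nonneg_left h4 (Real.exp_pos (ν * x)).le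
    have h6 := mul_le_mul (h3.trans (min_le_left _ _)) (h2 x hx) (by positivity) zero_le_one
    have h7 := mul_le_mul (h3.trans (min_le_right _ _)) (hD x hx) (by positivity) (by positivity)
    have h8 : e / (4 * (D + 1)) * D ≤ e / 4 := by
      rw [div_mul_eq_mul_div, div_le_div_iff₀ (by positivity) (by positivity)]
      nlinarith
    have h9 := h1 x hx
    linarith
  · intro w hw
    refine hw.mul x₀⁻¹ (m := fun x => (x : ℂ)⁻¹) fun x hx => ?_
    rw [norm_inv, Complex.norm_real, Real.norm_eq_abs, abs_of_pos (hx₀.trans_le hx)]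
    exact inv_anti₀ hx₀ hx

lemma expNorm_le {k : ℕ} {x₀ ν C : ℝ} {g : ℝ → ℂ}
    (h : ∀ j ≤ k, ∀ x, x₀ ≤ x → Real.exp (ν * x) * ‖iteratedDeriv j g x‖ ≤ C) :
    expNorm k x₀ ν g ≤ ENNReal.ofReal C := by
  refine iSup₂_le fun j hj => iSup₂_le fun x hx => ?_
  rw [← ofReal_norm, ← ENNReal.ofReal_mul (Real.exp_pos _).le]
  exact ENNReal.ofReal_le_ofReal (h j hj x hx)

section

variable {f : ℝ → ℝ → ℂ}

lemma iteratedDeriv_sub_eta (hf : ∀ η, ContDiffOn ℝ ∞ (fun x => f x η) (Set.Ioi 0)) (j : ℕ)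
    {x : ℝ} (hx : 0 < x) (η η₀ : ℝ) : iteratedDeriv j (fun y => f y η - f y η₀) x
      = iteratedDeriv j (fun y => f y η) x - iteratedDeriv j (fun y => f y η₀) x := by
  have h : ∀ η, ContDiffAt ℝ j (fun x => f x η) x := fun η =>
    ((hf η).contDiffAt (Ioi_mem_nhds hx)).of_le (by exact_mod_cast le_top)
  exact iteratedDeriv_sub (h η) (h η₀)

lemma GInfty.expContinuousAt (hf : ∀ η, ContDiffOn ℝ ∞ (fun x => f x η) (Set.Ioi 0))
    (hfi : GInfty f) {x₀ ν η₀ : ℝ} (hx₀ : 0 < x₀) (hη₀ : η₀ ≠ 0) (hν : ν ∈ Set.Ico 0 |η₀|) (j : ℕ) :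
    ExpContinuousAt x₀ ν η₀ fun x η => iteratedDeriv j (fun y => f y η) x := by
  refine ⟨⟨_, fun x hx => exp_mul_norm_le_expNorm le_rfl hx (hfi.finite x₀ hx₀ j η₀ hη₀ ν hν)⟩,
    fun e he => ?_⟩
  have h := hfi.continuous x₀ hx₀ j η₀ hη₀ ν hν
  filter_upwards [h.eventually_le_const (ENNReal.ofReal_pos.mpr he)] with η hη x hx
  rw [← iteratedDeriv_sub_eta hf j (hx₀.trans_le hx)]
  refine (exp_mul_norm_le_expNorm le_rfl hx (hη.trans_lt ENNReal.ofReal_lt_top)).trans ?_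
  exact ENNReal.toReal_le_of_le_ofReal he.le hη

/-- For `η ≠ 0`, both parts of the decay condition follow from bounds that are locally uniform in
the weighted norm. -/
lemma GInfty.of_expContinuousAt (hf : ∀ η, ContDiffOn ℝ ∞ (fun x => f x η) (Set.Ioi 0))
    (h0 : ∀ j : ℕ, ∀ ν ∈ Set.Ico (0 : ℝ) (2 ^ (3 / 2 : ℝ)),
      IsBoundedUnder (· ≤ ·) atTop fun x : ℝ =>
        Real.exp (ν * x ^ (1 / 4 : ℝ)) * ‖iteratedDeriv j (fun y => f y 0) x‖)
    (h : ∀ x₀ ν η₀ : ℝ, 0 < x₀ → η₀ ≠ 0 → ν ∈ Set.Ico 0 |η₀| → ∀ j : ℕ,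
      ExpContinuousAt x₀ ν η₀ fun x η => iteratedDeriv j (fun y => f y η) x) : GInfty f := by
  refine ⟨h0, fun η hη j ν hν => ?_, fun x₀ hx₀ k η hη ν hν => ?_, fun x₀ hx₀ k η₀ hη₀ ν hν => ?_⟩
  · obtain ⟨C, hC⟩ := (h 1 ν η one_pos hη hν j).1
    exact ⟨C, eventually_map.mpr ((eventually_ge_atTop 1).mono hC)⟩
  · choose C hC using fun j => (h x₀ ν η hx₀ hη hν j).1
    have hC0 : ∀ j, 0 ≤ C j := fun j => le_trans (by positivity) (hC j x₀ le_rfl)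
    refine (expNorm_le (C := ∑ j ∈ Finset.range (k + 1), C j) fun j hj x hx => ?_).trans_lt
      ENNReal.ofReal_lt_top
    exact (hC j x hx).trans (Finset.single_le_sum (fun i _ => hC0 i)
      (Finset.mem_range.mpr (by omega)))
  · rw [ENNReal.tendsto_nhds_zero]
    intro e he
    by_cases htop : e = ⊤
    · rw [htop]
      exact Eventually.of_forall fun _ => le_top
    have he' : 0 < e.toReal := ENNReal.toReal_pos he.ne' htop
    have hall : ∀ᶠ η in 𝓝 η₀, ∀ j ∈ Finset.range (k + 1), ∀ x, x₀ ≤ x → Real.exp (ν * x) *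
        ‖iteratedDeriv j (fun y => f y η) x - iteratedDeriv j (fun y => f y η₀) x‖ ≤ e.toReal :=
      (Finset.eventually_all _).mpr fun j _ => (h x₀ ν η₀ hx₀ hη₀ hν j).2 _ he'
    filter_upwards [hall] with η hη
    rw [← ENNReal.ofReal_toReal htop]
    refine expNorm_le fun j hj x hx => ?_
    rw [iteratedDeriv_sub_eta hf j (hx₀.trans_le hx)]
    exact hη j (Finset.mem_range.mpr (by omega)) x hx

variable {U : ℝ → ℝ → Fin 4 → ℂ}

lemma isBoundedUnder_state_zero (hf : ∀ η, ContDiffOn ℝ ∞ (fun x => f x η) (Set.Ioi 0))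
    (hf0 : G0Vanishing f) (hfi : GInfty f) (hfc : DerivsContinuous f)
    (hU : ∀ η, IsSol η (fun t => f (Real.exp t) η) Set.univ (U η))
    (hUc : ∀ η, StateControlled (U η)) {ν : ℝ} (hν : ν ∈ Set.Ico (0 : ℝ) (2 ^ (3 / 2 : ℝ)))
    (j : Fin 4) : IsBoundedUnder (· ≤ ·) atTop fun x : ℝ =>
      Real.exp (ν * x ^ (1 / 4 : ℝ)) * ‖U 0 (Real.log x) j‖ := by
  obtain ⟨ν', h1, h2⟩ := exists_between hν.2
  have hν' : 0 < ν' := hν.1.trans_lt h1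
  obtain ⟨c, T₀, hc⟩ := exists_innerData hf hf0 hfc (Or.inr rfl : AdmissibleInterval {0})
  obtain ⟨T, z, hz⟩ := exists_decayingBasis_zero (hf 0).continuousOn hfi hν'.le h2
  obtain ⟨-, -, ⟨C, hC⟩, -⟩ := hc.controlled_properties (Set.mem_singleton 0)
    (nhdsWithin_singleton (0 : ℝ)).le (rapid_exp_exp (by norm_num) hν') hz (fun η _ => hU η)
    fun η _ => hUc η
  refine ⟨|C|, eventually_map.mpr ?_⟩
  filter_upwards [eventually_gt_atTop (Real.exp T), eventually_gt_atTop 0] with x hx hx0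
  have hxT : T < Real.log x := (Real.lt_log_iff_exp_lt hx0).mpr hx
  have e1 : Real.exp (1 / 4 * Real.log x) = x ^ (1 / 4 : ℝ) := by
    rw [Real.rpow_def_of_pos hx0, mul_comm]
  have h3 := (norm_le_pi_norm (U 0 (Real.log x)) j).trans (hC _ hxT)
  rw [e1] at h3
  have hx4 : 0 ≤ x ^ (1 / 4 : ℝ) := Real.rpow_nonneg hx0.le _
  have h4 : Real.exp (ν * x ^ (1 / 4 : ℝ)) * Real.exp (-ν' * x ^ (1 / 4 : ℝ)) ≤ 1 := by
    rw [← Real.exp_add, Real.exp_le_one_iff]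
    nlinarith
  calc _ ≤ Real.exp (ν * x ^ (1 / 4 : ℝ)) * (|C| * Real.exp (-ν' * x ^ (1 / 4 : ℝ))) := by
        refine mul_le_mul_of_nonneg_left (h3.trans ?_) (Real.exp_pos _).le
        exact mul_le_mul_of_nonneg_right (le_abs_self C) (Real.exp_pos _).le
    _ = |C| * (Real.exp (ν * x ^ (1 / 4 : ℝ)) * Real.exp (-ν' * x ^ (1 / 4 : ℝ))) := by ring
    _ ≤ |C| := mul_le_of_le_one_right (abs_nonneg C) h4

/-- The properties of the family of controlled solutions near `η₀ ≠ 0`. -/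
lemma controlled_properties_of_ne_zero (hf : ∀ η, ContDiffOn ℝ ∞ (fun x => f x η) (Set.Ioi 0))
    (hf0 : G0Vanishing f) (hfi : GInfty f) (hfc : DerivsContinuous f)
    (hU : ∀ η, IsSol η (fun t => f (Real.exp t) η) Set.univ (U η))
    (hUc : ∀ η, StateControlled (U η)) {η₀ ν : ℝ} (hη₀ : η₀ ≠ 0) (hν0 : 0 < ν) (hν : ν < |η₀|) :
    (∀ t, Tendsto (fun y : ℝ × ℝ => U y.1 y.2) (𝓝 (η₀, t)) (𝓝 (U η₀ t))) ∧
      ∃ T, (∃ C, ∀ t, T < t → ‖U η₀ t‖ ≤ C * Real.exp (-ν * Real.exp t)) ∧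
        ∀ e : ℝ, 0 < e → ∀ᶠ η in 𝓝 η₀, ∀ t, T < t →
          ‖U η t - U η₀ t‖ ≤ e * Real.exp (-ν * Real.exp t) := by
  have hpos : 0 < |η₀| := abs_pos.mpr hη₀
  have hJn : Set.Icc (η₀ - |η₀| / 2) (η₀ + |η₀| / 2) ∈ 𝓝 η₀ := Icc_mem_nhds (by linarith) (by linarith)
  have hJ : AdmissibleInterval (Set.Icc (η₀ - |η₀| / 2) (η₀ + |η₀| / 2)) := by
    refine Or.inl ⟨_, _, by linarith, rfl, fun h => ?_⟩
    have h1 := h.1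
    have h2 := h.2
    rcases abs_cases η₀ with ⟨h3, -⟩ | ⟨h3, -⟩ <;> rw [h3] at h1 h2 hpos <;> linarith
  obtain ⟨c, T₀, hc⟩ := exists_innerData hf hf0 hfc hJ
  obtain ⟨T, z, hz⟩ := exists_decayingBasis (fun η => (hf η).continuousOn) hfi hη₀ hν0.le hν
  obtain ⟨-, h1, h2, h3⟩ := hc.controlled_properties (mem_of_mem_nhds hJn) nhdsWithin_le_nhds
    (rapid_exp_exp one_pos hν0) hz (fun η _ => hU η) fun η _ => hUc η
  rw [nhdsWithin_eq_nhds.mpr hJn] at h1 h3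
  simp only [one_mul] at h2 h3
  refine ⟨fun t => ?_, T, h2, h3⟩
  rw [nhds_prod_eq]
  exact h1 t

lemma expContinuousAt_state (hf : ∀ η, ContDiffOn ℝ ∞ (fun x => f x η) (Set.Ioi 0))
    (hf0 : G0Vanishing f) (hfi : GInfty f) (hfc : DerivsContinuous f)
    (hU : ∀ η, IsSol η (fun t => f (Real.exp t) η) Set.univ (U η))
    (hUc : ∀ η, StateControlled (U η)) {x₀ ν η₀ : ℝ} (hx₀ : 0 < x₀) (hη₀ : η₀ ≠ 0)
    (hν : ν ∈ Set.Ico 0 |η₀|) (j : Fin 4) :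
    ExpContinuousAt x₀ ν η₀ fun x η => U η (Real.log x) j := by
  obtain ⟨ν', h1, h2⟩ := exists_between hν.2
  obtain ⟨hc, T, ⟨C, hC⟩, hd⟩ :=
    controlled_properties_of_ne_zero hf hf0 hfi hfc hU hUc hη₀ (hν.1.trans_lt h1) h2
  have hw : ∀ x, 0 < x → Real.exp (ν * x) * Real.exp (-ν' * Real.exp (Real.log x)) ≤ 1 := by
    intro x hx
    rw [Real.exp_log hx, ← Real.exp_add, Real.exp_le_one_iff]
    nlinarith
  -- on the compact part of the half-line the weight is bounded by `M`
  obtain ⟨M, hM⟩ : ∃ M, M = Real.exp (ν * Real.exp T) := ⟨_, rfl⟩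
  have hM0 : 0 < M := hM ▸ Real.exp_pos _
  have hcomp : ∀ x, x₀ ≤ x → Real.log x ≤ T →
      Real.log x ∈ Set.Icc (Real.log x₀) T ∧ Real.exp (ν * x) ≤ M := by
    intro x hx hxT
    refine ⟨⟨Real.log_le_log hx₀ hx, hxT⟩, ?_⟩
    rw [hM, Real.exp_le_exp]
    exact mul_le_mul_of_nonneg_left ((Real.log_le_iff_le_exp (hx₀.trans_le hx)).mp hxT) hν.1
  have tail : ∀ x, x₀ ≤ x → ∀ (u : Fin 4 → ℂ) (B : ℝ), 0 ≤ B →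
      ‖u‖ ≤ B * Real.exp (-ν' * Real.exp (Real.log x)) → Real.exp (ν * x) * ‖u j‖ ≤ B := by
    intro x hx u B hB h
    have h3 := mul_le_mul_of_nonneg_left ((norm_le_pi_norm u j).trans h) (Real.exp_pos (ν * x)).le
    have h4 := mul_le_mul_of_nonneg_left (hw x (hx₀.trans_le hx)) hB
    linarith
  constructor
  · obtain ⟨D, hD⟩ := isCompact_Icc.exists_bound_of_continuousOn (s := Set.Icc (Real.log x₀) T)
      (hU η₀).continuous.continuousOn
    refine ⟨max |C| (M * D), fun x hx => ?_⟩
    rcases le_or_gt (Real.log x) T with hxT | hxT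
    · obtain ⟨hm, hb⟩ := hcomp x hx hxT
      refine le_trans ?_ (le_max_right _ _)
      exact mul_le_mul hb ((norm_le_pi_norm _ j).trans (hD _ hm)) (norm_nonneg _) hM0.le
    · refine le_trans (tail x hx _ |C| (abs_nonneg C) ?_) (le_max_left _ _)
      exact (hC _ hxT).trans (mul_le_mul_of_nonneg_right (le_abs_self C) (Real.exp_pos _).le)
  · intro e he
    have hK : ∀ᶠ η in 𝓝 η₀, ∀ t ∈ Set.Icc (Real.log x₀) T, ‖U η t - U η₀ t‖ ≤ e / M := by
      refine isCompact_Icc.eventually_forall_of_forall_eventually fun t _ => ?_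
      have h3 : Tendsto (fun y : ℝ × ℝ => U η₀ y.2) (𝓝 (η₀, t)) (𝓝 (U η₀ t)) :=
        ((hU η₀).continuous.comp continuous_snd).tendsto (η₀, t)
      have h4 := ((hc t).sub h3).norm
      rw [sub_self, norm_zero] at h4
      exact h4.eventually_le_const (by positivity)
    filter_upwards [hK, hd e he] with η k1 k2 x hx
    rcases le_or_gt (Real.log x) T with hxT | hxT
    · obtain ⟨hm, hb⟩ := hcomp x hx hxT
      have h3 := mul_le_mul hb ((norm_le_pi_norm (U η (Real.log x) - U η₀ (Real.log x)) j).trans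
        (k1 _ hm)) (norm_nonneg _) hM0.le
      rw [mul_div_cancel₀ _ hM0.ne'] at h3
      exact h3
    · exact tail x hx (U η (Real.log x) - U η₀ (Real.log x)) e he.le (k2 _ hxT)

lemma continuousOn_state (hf : ∀ η, ContDiffOn ℝ ∞ (fun x => f x η) (Set.Ioi 0))
    (hf0 : G0Vanishing f) (hfi : GInfty f) (hfc : DerivsContinuous f)
    (hU : ∀ η, IsSol η (fun t => f (Real.exp t) η) Set.univ (U η))
    (hUc : ∀ η, StateControlled (U η)) (j : Fin 4) :
    ContinuousOn (fun p : ℝ × ℝ => U p.2 (Real.log p.1) j) {p : ℝ × ℝ | 0 < p.1 ∧ p.2 ≠ 0} := by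
  rintro ⟨x, η₀⟩ ⟨hx, hη₀⟩
  have hpos : 0 < |η₀| := abs_pos.mpr hη₀
  have h := (controlled_properties_of_ne_zero hf hf0 hfi hfc hU hUc hη₀ (half_pos hpos)
    (half_lt_self hpos)).1 (Real.log x)
  have h1 : Tendsto (fun p : ℝ × ℝ => (p.2, Real.log p.1)) (𝓝 (x, η₀)) (𝓝 (η₀, Real.log x)) :=
    (continuous_snd.tendsto (x, η₀)).prodMk_nhds
      ((Real.continuousAt_log (ne_of_gt hx)).tendsto.comp (continuous_fst.tendsto (x, η₀)))
  exact (tendsto_pi_nhds.mp (h.comp h1) j).mono_left nhdsWithin_le_nhds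

end

section

variable {f : ℝ → ℝ → ℂ} {U : ℝ → ℝ → Fin 4 → ℂ}

lemma GInfty_ofState (hf : ∀ η, ContDiffOn ℝ ∞ (fun x => f x η) (Set.Ioi 0))
    (hf0 : G0Vanishing f) (hfi : GInfty f) (hfc : DerivsContinuous f)
    (hU : ∀ η, IsSol η (fun t => f (Real.exp t) η) Set.univ (U η))
    (hUc : ∀ η, StateControlled (U η)) : GInfty fun x η => ofState (U η) x := by
  have hv : ∀ η, ContDiffOn ℝ ∞ (fun x => ofState (U η) x) (Set.Ioi 0) := fun η =>
    contDiffOn_ofState (f := fun x => f x η) (hU η) (hf η)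
  refine GInfty.of_expContinuousAt (f := fun x η => ofState (U η) x) hv (fun j ν hν => ?_)
    fun x₀ ν η₀ hx₀ hη₀ hν j => ?_
  · have hS := stableClass_isBoundedUnder (fun x => Real.exp (ν * x ^ (1 / 4 : ℝ)))
      (fun x => (Real.exp_pos _).le) 0
    exact StableClass.iteratedDeriv_ofState hS (f := f) hf
      (fun i => hfi.decay_zero i ν hν) hU
      (fun i => isBoundedUnder_state_zero hf hf0 hfi hfc hU hUc hν i) j
  · exact StableClass.iteratedDeriv_ofState (stableClass_expContinuousAt hx₀ ν η₀) (f := f) hf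
      (fun i => hfi.expContinuousAt hf hx₀ hη₀ hν i) hU
      (fun i => expContinuousAt_state hf hf0 hfi hfc hU hUc hx₀ hη₀ hν i) j

lemma derivsContinuous_ofState (hf : ∀ η, ContDiffOn ℝ ∞ (fun x => f x η) (Set.Ioi 0))
    (hf0 : G0Vanishing f) (hfi : GInfty f) (hfc : DerivsContinuous f)
    (hU : ∀ η, IsSol η (fun t => f (Real.exp t) η) Set.univ (U η))
    (hUc : ∀ η, StateControlled (U η)) : DerivsContinuous fun x η => ofState (U η) x := by
  intro j
  exact StableClass.iteratedDeriv_ofState stableClass_continuousOn (f := f) hf hfc hU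
    (fun i => continuousOn_state hf hf0 hfi hfc hU hUc i) j

lemma IsControlledSolution.eqOn_ofState {h w : ℝ → ℂ} {η : ℝ} {V : ℝ → Fin 4 → ℂ}
    (hw : IsControlledSolution h η w) (hV : IsSol η (fun t => h (Real.exp t)) Set.univ V)
    (hVc : StateControlled V) : Set.EqOn w (ofState V) (Set.Ioi 0) := by
  intro x hx
  obtain ⟨h1, h2⟩ := hw.isSol
  have hx' : (0 : ℝ) < x := hx
  rw [ofState, ← h2.unique h1 hV hVc, dState, Real.exp_log hx']
  rfl

end

end

end ThinFilmResolvent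

theorem mainTheorem4 (f : ℝ → ℝ → ℂ)
    (hf_smooth : ∀ η : ℝ, ContDiffOn ℝ ∞ (fun x => f x η) (Set.Ioi 0))
    (hf_zero : ThinFilmResolvent.G0Vanishing f)
    (hf_infty : ThinFilmResolvent.GInfty f)
    (hf_cont : ThinFilmResolvent.DerivsContinuous f) :
    ∃ v : ℝ → ℝ → ℂ,
      (∀ η : ℝ,
        ThinFilmResolvent.IsControlledSolution (fun x => f x η) η (fun x => v x η) ∧
        ∀ w : ℝ → ℂ, ThinFilmResolvent.IsControlledSolution (fun x => f x η) η w →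
          Set.EqOn w (fun x => v x η) (Set.Ioi 0)) ∧
      ThinFilmResolvent.G0 v ∧
      ThinFilmResolvent.GInfty v ∧
      ThinFilmResolvent.DerivsContinuous v := by
  choose U hU hUc using ThinFilmResolvent.exists_controlled_state hf_smooth hf_zero hf_infty hf_cont
  exact ⟨fun x η => ThinFilmResolvent.ofState (U η) x,
    fun η => ⟨ThinFilmResolvent.isControlledSolution_ofState (f := fun x => f x η) (hf_smooth η) (hU η) (hUc η),
      fun w hw => hw.eqOn_ofState (h := fun x => f x η) (hU η) (hUc η)⟩,
    ThinFilmResolvent.G0_ofState hf_smooth hf_zero hf_infty hf_cont hU hUc,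
    ThinFilmResolvent.GInfty_ofState hf_smooth hf_zero hf_infty hf_cont hU hUc,
    ThinFilmResolvent.derivsContinuous_ofState hf_smooth hf_zero hf_infty hf_cont hU hUc⟩
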